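/- **Setting.** Let $d,s\ge 2$, $\ell\ge 0$ be integers. Let $n=n_0,\dots,n_{d-1}$, $n_d=\ell$ and $p=p_0,\dots,p_{s-1}$, $p_s=\ell$ be layer widths, $W^{(1)}_i\in\mathbb R^{n_i\times n_{i-1}}$ $(1\le i\le d)$ and $W^{(2)}_i\in\mathbb R^{p_i\times p_{i-1}}$ $(1\le i\le s)$ weight matrices, and $$\mathcal G^{(1)}(h)=\mathrm{relu}(W^{(1)}_d\cdots\mathrm{relu}(W^{(1)}_1h)\cdots),\qquad \mathcal G^{(2)}(m)=\mathrm{relu}(W^{(2)}_s\cdots\mathrm{relu}(W^{(2)}_1m)\cdots),$$ with $\mathrm{relu}(x)=\max(x,0)$ entrywise. For $h_0\in\mathbb R^n$, $m_0\in\mathbb R^p$ put $$f(h,m)=\tfrac12\big\|\mathcal G^{(1)}(h_0)\odot\mathcal G^{(2)}(m_0)-\mathcal G^{(1)}(h)\odot\mathcal G^{(2)}(m)\big\|_2^2 ,$$ where $\odot$ is the entrywise product. For nonzero $x,y\in\mathbb R^k$ with angle $\theta=\angle(x,y)$ let $$Q_{x,y}=\frac{\pi-\theta}{2\pi}I_k+\frac{\sin\theta}{2\pi}M_{\hat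 x\leftrightarrow\hat y},$$ where $\hat x=x/\|x\|_2$, $\hat y=y/\|y\|_2$, and $M_{\hat x\leftrightarrow\hat y}$ is the matrix exchanging $\hat x$ and $\hat y$ and vanishing on $\mathrm{span}\{x,y\}^\perp$. For a matrix $W$ let $W_{+,x}=\mathrm{diag}(Wx>0)\,W$. Matrix norms are spectral norms. * $W\in\mathbb R^{l\times k}$ with rows $w_i^\top$ satisfies the **WDC** with constants $(\epsilon,\alpha)$ if for all nonzero $x,y\in\mathbb R^k$: $\big\|\sum_{i=1}^l 1_{w_i\cdot x>0}1_{w_i\cdot y>0}\,w_iw_i^\top-\alpha Q_{x,y}\big\|\le\epsilon$. * $B\in\mathbb R^{\ell\times k}$, $C\in\mathbb R^{\ell\times q}$ satisfy the **joint-WDC** with constants $(\epsilon,\alpha)$ if for all nonzero $h,x\in\mathbb R^k$ and nonzero $m,y\in\mathbb R^q$ $$\Big\|B_{+,h}^\top\mathrm{diag}(C_{+,m}m\odot C_{+,y}y)B_{+,x}-\tfrac{\alpha}{\ell}\,(m^\top Q_{m,y}y)\,Q_{h,x}\Big\|\le\tfrac{\epsilon}{\ell}\|m\|_2\|y\|_2,$$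 $$\Big\|C_{+,m}^\top\mathrm{diag}(B_{+,h}h\odot B_{+,x}x)C_{+,y}-\tfrac{\alpha}{\ell}\,(h^\top Q_{h,x}x)\,Q_{m,y}\Big\|\le\tfrac{\epsilon}{\ell}\|h\|_2\|x\|_2.$$ Let $\mathcal K=\{(h,0):h\in\mathbb R^n\}\cup\{(0,m):m\in\mathbb R^p\}$, and for $r\in\mathbb R$, $(a,b)\in\mathbb R^n\times\mathbb R^p$, $$\mathcal A_{r,(a,b)}=\Big\{(h,m):\exists c>0,\ \big\|(h,m)-(ca,\tfrac1c b)\big\|_2\le r\big\|(ca,\tfrac1cb)\big\|_2\Big\}.$$ Let $g(\theta)=\arccos\frac{(\pi-\theta)\cos\theta+\sin\theta}{\pi}$, $\check\theta_0=\pi$, $\check\theta_{i+1}=g(\check\theta_i)$ and $$\rho_d=\sum_{i=1}^{d-1}\frac{\sin\check\theta_i}{\pi}\prod_{j=i+1}^{d-1}\frac{\pi-\check\theta_j}{\pi}.$$ Write $D_{u}f(h,m)=\lim_{t\to0^+}\frac{f((h,m)+tu)-f(h,m)}{t}$ for $u\in\mathbb R^n\times\mathbb R^p$. Call $w\in\mathbb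 R^n\times\mathbb R^p$ admissible at $(h,m)$ if $f$ is differentiable at $(h,m)+\delta w$ for all sufficiently small $\delta>0$, and for such $w$ let $$g_1=\big(\lim_{\delta\to0^+}\nabla_hf((h,m)+\delta w),\,0\big),\qquad g_2=\big(0,\,\lim_{\delta\to0^+}\nabla_mf((h,m)+\delta w)\big).$$ **Theorem.** One has $\rho_d>0$ for all $d\ge2$ and $\rho_d\to1$ as $d\to\infty$. There are absolute constants $K_1,K_2>0$ such that the following holds for all networks as above. Let $\epsilon>0$ and $0<\alpha_1,\alpha_2\le1$ with $\alpha=\alpha_1\alpha_2$ satisfy $$K_1(d^7s^2+d^2s^7)\,\epsilon^{1/4}/(\alpha_1\alpha_2)<1 .$$ Suppose that $W^{(1)}_i$ $(1\le i\le d-1)$ and $W^{(2)}_i$ $(1\le i\le s-1)$ satisfy the WDC with constants $(\epsilon,1)$, that $W^{(1)}_d$ satisfies the WDC with constants $(\epsilon,\alpha_1)$, that $W^{(2)}_s$ satisfies the WDC with constants $(\epsilon,\alpha_2)$, and that $(W^{(1)}_d,W^{(2)}_s)$ satisfies the joint-WDC with constants $(\epsilon,\alpha)$. Let $(h_0,m_0)\ne(0,0)$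 and $$\mathcal A=\mathcal A_{K_2d^3s^3\epsilon^{1/4}\alpha^{-1},(h_0,m_0)}\cup\mathcal A_{K_2d^8s^3\epsilon^{1/4}\alpha^{-1},(-\rho_dh_0,m_0)}\cup\mathcal A_{K_2d^3s^8\epsilon^{1/4}\alpha^{-1},(\rho_sh_0,-m_0)}\cup\mathcal A_{K_2d^8s^8\epsilon^{1/4}\alpha^{-1},(-\rho_d\rho_sh_0,-m_0)}.$$ Then: 1. For every $(h,m)\notin\mathcal A\cup\mathcal K$ there is an admissible $w$ at $(h,m)$, and for every admissible $w$ the limits defining $g_1$ and $g_2$ exist and, for $g=g_1$ or for $g=g_2$, the one-sided directional derivative $D_{-g}f(h,m)$ exists and $D_{-g}f(h,m)<0$. 2. For every $(h,m)\in\mathcal K$ and every $(x,y)\in\mathbb R^n\times\mathbb R^p$, the one-sided directional derivative $D_{(x,y)}f(h,m)$ exists and $D_{(x,y)}f(h,m)\le0$. -/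

import Mathlib

open Filter
open scoped Topology

namespace BlindDemod

noncomputable section

open scoped Matrix

/-- Euclidean space `ℝⁿ` with the `ℓ²` norm. -/
abbrev Vec (n : ℕ) : Type := EuclideanSpace ℝ (Fin n)

/-! ### The matrices `W_{+,x}`, `M` and `Q` -/

/-- `diag(W x > 0)`. -/
def posDiag {l n : ℕ} (W : Matrix (Fin l) (Fin n) ℝ) (x : Vec n) : Matrix (Fin l) (Fin l) ℝ :=
  Matrix.diagonal fun i => if 0 < (W *ᵥ x.ofLp) i then 1 else 0

/-- `W_{+,x} = diag(W x > 0) W`. -/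
def posPart {l n : ℕ} (W : Matrix (Fin l) (Fin n) ℝ) (x : Vec n) : Matrix (Fin l) (Fin n) ℝ :=
  posDiag W x * W

/-- `x̂ = x / ‖x‖₂`. -/
def unit {n : ℕ} (x : Vec n) : Vec n := ‖x‖⁻¹ • x

/-- The orthogonal projection matrix onto the line spanned by `a` (it is `0` if `a = 0`). -/
def lineProj {n : ℕ} (a : Vec n) : Matrix (Fin n) (Fin n) ℝ :=
  (‖a‖ ^ 2)⁻¹ • Matrix.vecMulVec a.ofLp a.ofLp

/-- The matrix exchanging `x̂` and `ŷ` and vanishing on the orthogonal complement of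
`span {x, y}`; see `swap_mulVec_left`, `swap_mulVec_right` and `swap_mulVec_orthogonal`. -/
def swap {n : ℕ} (x y : Vec n) : Matrix (Fin n) (Fin n) ℝ :=
  lineProj (unit x + unit y) - lineProj (unit x - unit y)

lemma lineProj_mulVec {n : ℕ} (a z : Vec n) :
    WithLp.toLp 2 (lineProj a *ᵥ z.ofLp) = ((‖a‖ ^ 2)⁻¹ * inner ℝ a z) • a := by
  ext i
  have h : a.ofLp ⬝ᵥ z.ofLp = inner ℝ a z := by
    simp [PiLp.inner_apply, dotProduct, mul_comm]
  simp [lineProj, Matrix.smul_mulVec, Matrix.vecMulVec_mulVec, h]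
  ring

lemma swap_mulVec {n : ℕ} (x y z : Vec n) :
    WithLp.toLp 2 (swap x y *ᵥ z.ofLp) =
      ((‖unit x + unit y‖ ^ 2)⁻¹ * inner ℝ (unit x + unit y) z) • (unit x + unit y) -
      ((‖unit x - unit y‖ ^ 2)⁻¹ * inner ℝ (unit x - unit y) z) • (unit x - unit y) := by
  rw [← lineProj_mulVec, ← lineProj_mulVec, swap, Matrix.sub_mulVec, WithLp.toLp_sub]

lemma norm_unit {n : ℕ} {x : Vec n} (hx : x ≠ 0) : ‖unit x‖ = 1 := by
  simp [unit, norm_smul, inv_mul_cancel₀ (norm_ne_zero_iff.mpr hx)]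

lemma swap_mulVec_left {n : ℕ} {x y : Vec n} (hx : x ≠ 0) (hy : y ≠ 0) :
    WithLp.toLp 2 (swap x y *ᵥ (unit x).ofLp) = unit y := by
  rw [swap_mulVec]
  have h1 := norm_unit hx
  have h2 := norm_unit hy
  generalize unit x = u at *
  generalize unit y = v at *
  have key : ∀ a : Vec n, ((‖a‖ ^ 2)⁻¹ * (‖a‖ ^ 2 / 2)) • a = (1 / 2 : ℝ) • a := by
    intro a
    by_cases ha : a = 0
    · simp [ha]
    · have : ‖a‖ ≠ 0 := norm_ne_zero_iff.mpr ha
      congr 1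
      field_simp
  have e1 : inner ℝ (u + v) u = ‖u + v‖ ^ 2 / 2 := by
    rw [norm_add_sq_real, inner_add_left, real_inner_self_eq_norm_sq, h1, h2, real_inner_comm]
    ring
  have e2 : inner ℝ (u - v) u = ‖u - v‖ ^ 2 / 2 := by
    rw [norm_sub_sq_real, inner_sub_left, real_inner_self_eq_norm_sq, h1, h2, real_inner_comm]
    ring
  rw [e1, e2, key, key]
  module

lemma swap_comm {n : ℕ} (x y : Vec n) : swap x y = swap y x := by
  have h : lineProj (unit x - unit y) = lineProj (unit y - unit x) := by
    rw [← neg_sub (unit y) (unit x)]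
    simp only [lineProj, norm_neg, WithLp.ofLp_neg, Matrix.neg_vecMulVec, Matrix.vecMulVec_neg,
      neg_neg]
  rw [swap, swap, h, add_comm]

lemma swap_mulVec_right {n : ℕ} {x y : Vec n} (hx : x ≠ 0) (hy : y ≠ 0) :
    WithLp.toLp 2 (swap x y *ᵥ (unit y).ofLp) = unit x := by
  rw [swap_comm, swap_mulVec_left hy hx]

lemma swap_mulVec_orthogonal {n : ℕ} {x y z : Vec n} (hx : inner ℝ x z = 0)
    (hy : inner ℝ y z = 0) : WithLp.toLp 2 (swap x y *ᵥ z.ofLp) = 0 := by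
  rw [swap_mulVec]
  simp [unit, inner_add_left, inner_sub_left, real_inner_smul_left, hx, hy]

/-- `Q_{x,y} = (π - θ)/(2π) I + (sin θ)/(2π) M_{x̂ ↔ ŷ}` with `θ = ∠(x, y)`. -/
def Q {n : ℕ} (x y : Vec n) : Matrix (Fin n) (Fin n) ℝ :=
  ((Real.pi - InnerProductGeometry.angle x y) / (2 * Real.pi)) • (1 : Matrix (Fin n) (Fin n) ℝ) +
    (Real.sin (InnerProductGeometry.angle x y) / (2 * Real.pi)) • swap x y

/-! ### The two weight conditions; matrix norms are spectral norms -/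

section Conditions

open scoped Matrix.Norms.L2Operator

/-- The Weight Distributed Condition with constants `ε` and `α`. -/
def WDC {l n : ℕ} (W : Matrix (Fin l) (Fin n) ℝ) (ε α : ℝ) : Prop :=
  ∀ x y : Vec n, x ≠ 0 → y ≠ 0 →
    ‖(∑ i, ((if 0 < W i ⬝ᵥ x.ofLp then (1 : ℝ) else 0) *
        (if 0 < W i ⬝ᵥ y.ofLp then (1 : ℝ) else 0)) • Matrix.vecMulVec (W i) (W i)) -
      α • Q x y‖ ≤ ε

/-- The joint Weight Distributed Condition with constants `ε` and `α`. -/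
def JointWDC {l n p : ℕ} (B : Matrix (Fin l) (Fin n) ℝ) (C : Matrix (Fin l) (Fin p) ℝ)
    (ε α : ℝ) : Prop :=
  ∀ (h x : Vec n) (m y : Vec p), h ≠ 0 → x ≠ 0 → m ≠ 0 → y ≠ 0 →
    ‖(posPart B h)ᵀ *
          Matrix.diagonal ((posPart C m *ᵥ m.ofLp) * (posPart C y *ᵥ y.ofLp)) * posPart B x -
        (α / l * (m.ofLp ⬝ᵥ (Q m y *ᵥ y.ofLp))) • Q h x‖ ≤ ε / l * ‖m‖ * ‖y‖ ∧
    ‖(posPart C m)ᵀ *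
          Matrix.diagonal ((posPart B h *ᵥ h.ofLp) * (posPart B x *ᵥ x.ofLp)) * posPart C y -
        (α / l * (h.ofLp ⬝ᵥ (Q h x *ᵥ x.ofLp))) • Q m y‖ ≤ ε / l * ‖h‖ * ‖x‖

end Conditions

/-! ### Generative networks and the empirical risk -/

/-- One layer `x ↦ relu(W x)`. -/
def layer {l n : ℕ} (W : Matrix (Fin l) (Fin n) ℝ) (x : Vec n) : Vec l :=
  WithLp.toLp 2 fun i => max ((W *ᵥ x.ofLp) i) 0

/-- The composition of the first `k` layers; `W i` is the weight matrix of layer `i + 1`. -/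
def innerNet {n : ℕ → ℕ} (W : ∀ i, Matrix (Fin (n (i + 1))) (Fin (n i)) ℝ) :
    (k : ℕ) → Vec (n 0) → Vec (n k)
  | 0, x => x
  | k + 1, x => layer (W k) (innerNet W k x)

/-- The `d`-layer ReLU network: the `d - 1` inner layers `W 0, …, W (d - 2)`, followed by the last
layer `V`. -/
def generator {n : ℕ → ℕ} {l : ℕ} (d : ℕ) (W : ∀ i, Matrix (Fin (n (i + 1))) (Fin (n i)) ℝ)
    (V : Matrix (Fin l) (Fin (n (d - 1))) ℝ) (x : Vec (n 0)) : Vec l :=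
  layer V (innerNet W (d - 1) x)

/-- Entrywise product. -/
def hadamard {l : ℕ} (u v : Vec l) : Vec l := WithLp.toLp 2 fun i => u i * v i

/-- `f(h, m) = ½ ‖G₁(h₀) ⊙ G₂(m₀) - G₁(h) ⊙ G₂(m)‖₂²`. -/
def risk {n p l : ℕ} (G₁ : Vec n → Vec l) (G₂ : Vec p → Vec l) (h₀ : Vec n) (m₀ : Vec p)
    (h : Vec n) (m : Vec p) : ℝ :=
  1 / 2 * ‖hadamard (G₁ h₀) (G₂ m₀) - hadamard (G₁ h) (G₂ m)‖ ^ 2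

/-! ### One-sided directional derivatives and the directions `g₁`, `g₂` -/

/-- The one-sided directional derivative of `f` at `(h, m)` in the direction `(x, y)` exists and
equals `D`. -/
def HasOneSidedDeriv {n p : ℕ} (f : Vec n → Vec p → ℝ) (h : Vec n) (m : Vec p)
    (x : Vec n) (y : Vec p) (D : ℝ) : Prop :=
  Tendsto (fun t : ℝ => (f (h + t • x) (m + t • y) - f h m) / t) (𝓝[>] 0) (𝓝 D)

/-- `f` is differentiable at `(h, m) + δ w` for all sufficiently small `δ > 0`, `w = (w₁, w₂)`. -/
def Admissible {n p : ℕ} (f : Vec n → Vec p → ℝ) (h : Vec n) (m : Vec p)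
    (w₁ : Vec n) (w₂ : Vec p) : Prop :=
  ∀ᶠ δ : ℝ in 𝓝[>] 0,
    DifferentiableAt ℝ (fun z : Vec n × Vec p => f z.1 z.2) (h + δ • w₁, m + δ • w₂)

/-- `v = lim_{δ → 0⁺} ∇_h f((h, m) + δ w)`, so that `g₁ = (v, 0)`. -/
def IsLimitGradLeft {n p : ℕ} (f : Vec n → Vec p → ℝ) (h : Vec n) (m : Vec p)
    (w₁ : Vec n) (w₂ : Vec p) (v : Vec n) : Prop :=
  Tendsto (fun δ : ℝ => gradient (fun h' => f h' (m + δ • w₂)) (h + δ • w₁)) (𝓝[>] 0) (𝓝 v)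

/-- `v = lim_{δ → 0⁺} ∇_m f((h, m) + δ w)`, so that `g₂ = (0, v)`. -/
def IsLimitGradRight {n p : ℕ} (f : Vec n → Vec p → ℝ) (h : Vec n) (m : Vec p)
    (w₁ : Vec n) (w₂ : Vec p) (v : Vec p) : Prop :=
  Tendsto (fun δ : ℝ => gradient (fun m' => f (h + δ • w₁) m') (m + δ • w₂)) (𝓝[>] 0) (𝓝 v)

/-! ### The exceptional sets -/

/-- `K = {(h, 0)} ∪ {(0, m)}`. -/
def axes (n p : ℕ) : Set (Vec n × Vec p) :=
  {z | ∃ h : Vec n, z = (h, 0)} ∪ {z | ∃ m : Vec p, z = (0, m)}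

/-- The neighborhood `A_{r,(a,b)}` of the hyperbolic curve `{(c a, b / c) : c > 0}`; the norm is
the `ℓ²` norm on the product. -/
def hyperbolicNhd {n p : ℕ} (r : ℝ) (a : Vec n) (b : Vec p) : Set (Vec n × Vec p) :=
  {z | ∃ c : ℝ, 0 < c ∧
    ‖WithLp.toLp 2 z - WithLp.toLp 2 (c • a, (1 / c) • b)‖ ≤
      r * ‖WithLp.toLp 2 (c • a, (1 / c) • b)‖}

/-- `g(θ) = arccos(((π - θ) cos θ + sin θ) / π)`. -/
def angleMap (θ : ℝ) : ℝ :=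
  Real.arccos (((Real.pi - θ) * Real.cos θ + Real.sin θ) / Real.pi)

/-- `θ̌₀ = π` and `θ̌ᵢ₊₁ = g(θ̌ᵢ)`. -/
def checkAngle : ℕ → ℝ
  | 0 => Real.pi
  | i + 1 => angleMap (checkAngle i)

/-- `ρ_d = ∑_{i=1}^{d-1} (sin θ̌ᵢ / π) ∏_{j=i+1}^{d-1} (π - θ̌ⱼ) / π`. -/
def rho (d : ℕ) : ℝ :=
  ∑ i ∈ Finset.Ico 1 d, Real.sin (checkAngle i) / Real.pi *
    ∏ j ∈ Finset.Ico (i + 1) d, (Real.pi - checkAngle j) / Real.pi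

/-- The union `A` of the four hyperbolic neighborhoods, with constant `K₂`. -/
def fourNhds {n p : ℕ} (K₂ : ℝ) (d s : ℕ) (ε α : ℝ) (h₀ : Vec n) (m₀ : Vec p) :
    Set (Vec n × Vec p) :=
  hyperbolicNhd (K₂ * (d : ℝ) ^ 3 * (s : ℝ) ^ 3 * ε ^ (1 / 4 : ℝ) * α⁻¹) h₀ m₀ ∪
  hyperbolicNhd (K₂ * (d : ℝ) ^ 8 * (s : ℝ) ^ 3 * ε ^ (1 / 4 : ℝ) * α⁻¹) (-(rho d) • h₀) m₀ ∪
  hyperbolicNhd (K₂ * (d : ℝ) ^ 3 * (s : ℝ) ^ 8 * ε ^ (1 / 4 : ℝ) * α⁻¹) (rho s • h₀) (-m₀) ∪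
  hyperbolicNhd (K₂ * (d : ℝ) ^ 8 * (s : ℝ) ^ 8 * ε ^ (1 / 4 : ℝ) * α⁻¹)
    (-(rho d * rho s) • h₀) (-m₀)

end

end BlindDemod

open BlindDemod

namespace BlindDemod

open scoped Matrix

/-! Write Λ_x for the linear piece of a network at x, so that G(x) = Λ_x x, and put y₀ = G₁(h₀) ⊙
G₂(m₀). Where the piece does not change, ∇_h f = Λ_hᵀ((G₁(h) ⊙ G₂(m) - y₀) ⊙ G₂(m)); the weight
conditions make this nearly deterministic.

Concentration. One inner layer halves squared norms and sends the angle θ between two inputs to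
about `angleMap θ` (`InnerWDC.angle_step`). Since `angleMap` is nonexpansive (`angleMap_lipschitz`),
angle errors only add up over the layers. Hence 2ᵏ Λ_xᵀ Λ_y y is close to an explicit combination of
y and x (`InnerWDC.pattern_transpose`). With the joint condition at the last layers, the rescaled
gradient is within a multiple of (d² + s²)√ε of α times `gradField` (`norm_grad_sub_le`).

Small limiting gradient. Pairing `gradField` with h determines ‖h‖‖m‖ (`radial_bound`). Pairing it
with the part of h₀ orthogonal to h bounds (π - φ) sin φ for φ = ∠(h, h₀) (`tangential_bound`,
`angle_dichotomy`), so φ is near 0 or near π. The same holds for m, and the four combinations give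
the four hyperbolic neighborhoods (`mem_fourNhds`). Two facts on the iterates θᵢ of `angleMap` keep
the losses polynomial in the depth: cos θᵢ ≥ 1/4 for i ≥ 2, and `coefProd` decays no faster than k⁻⁵
(`coefProd_ge`), because θᵢ = O(1/i).

Descent at kinks. The limit v of gradients along w and the derivative of f along -v may come from
different linear pieces. All pieces adjacent to h obey the same concentration bound
(`norm_limit_grad_sub_le`), so if f does not decrease along -v, then `gradField` is itself of the
size of the error (`exists_descent_left`). Outside the neighborhoods this cannot happen for both h
and m.

On the axes the first-order term of f is minus an inner product of entrywise nonnegative vectors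
(`hasOneSidedDeriv_risk_axis`). Finally ρ_k is the cosine of θ̌_k (`rho_eq_cos`), which gives its
positivity and its limit. -/

/-! ### Matrices acting on Euclidean space -/

/-- The linear map of Euclidean spaces given by a matrix. -/
noncomputable abbrev act {l n : ℕ} (M : Matrix (Fin l) (Fin n) ℝ) : Vec n →ₗ[ℝ] Vec l :=
  Matrix.toEuclideanLin M

lemma inner_eq_dotProduct {n : ℕ} (x y : Vec n) : inner ℝ x y = x.ofLp ⬝ᵥ y.ofLp := by
  simp [PiLp.inner_apply, dotProduct, mul_comm]

lemma act_apply {l n : ℕ} (M : Matrix (Fin l) (Fin n) ℝ) (x : Vec n) :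
    act M x = WithLp.toLp 2 (M *ᵥ x.ofLp) := rfl

lemma act_mul {l k n : ℕ} (M : Matrix (Fin l) (Fin k) ℝ) (N : Matrix (Fin k) (Fin n) ℝ)
    (x : Vec n) : act (M * N) x = act M (act N x) := by
  simp

lemma act_add {l n : ℕ} (M N : Matrix (Fin l) (Fin n) ℝ) (x : Vec n) :
    act (M + N) x = act M x + act N x := by
  rw [act_apply, Matrix.add_mulVec, WithLp.toLp_add, ← act_apply, ← act_apply]

lemma act_smul {l n : ℕ} (c : ℝ) (M : Matrix (Fin l) (Fin n) ℝ) (x : Vec n) :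
    act (c • M) x = c • act M x := by
  rw [act_apply, Matrix.smul_mulVec, WithLp.toLp_smul, ← act_apply]

lemma act_one {n : ℕ} (x : Vec n) : act (1 : Matrix (Fin n) (Fin n) ℝ) x = x := by
  simp

lemma inner_act {l n : ℕ} (M : Matrix (Fin l) (Fin n) ℝ) (x : Vec l) (y : Vec n) :
    inner ℝ x (act M y) = inner ℝ (act Mᵀ x) y := by
  rw [inner_eq_dotProduct, inner_eq_dotProduct, act_apply, act_apply]
  simp only
  rw [Matrix.mulVec_transpose, Matrix.dotProduct_mulVec]

lemma inner_act' {l n : ℕ} (M : Matrix (Fin l) (Fin n) ℝ) (x : Vec l) (y : Vec n) :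
    inner ℝ (act M y) x = inner ℝ y (act Mᵀ x) := by
  rw [real_inner_comm, inner_act, real_inner_comm]

section
open scoped Matrix.Norms.L2Operator

lemma norm_act_le {l n : ℕ} {M : Matrix (Fin l) (Fin n) ℝ} {c : ℝ} (h : ‖M‖ ≤ c) (x : Vec n) :
    ‖act M x‖ ≤ c * ‖x‖ :=
  (Matrix.l2_opNorm_mulVec M x).trans (mul_le_mul_of_nonneg_right h (norm_nonneg x))

end

/-- A matrix and its transpose have the same norm: ‖Mᵀz‖² = ⟨z, M Mᵀz⟩, then Cauchy–Schwarz. -/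
lemma norm_act_transpose_sq_le {l n : ℕ} {M : Matrix (Fin l) (Fin n) ℝ} {c : ℝ} (hc : 0 ≤ c)
    (h : ∀ x, ‖act M x‖ ^ 2 ≤ c * ‖x‖ ^ 2) (z : Vec l) :
    ‖act Mᵀ z‖ ^ 2 ≤ c * ‖z‖ ^ 2 := by
  by_cases h0 : act Mᵀ z = 0
  · rw [h0, norm_zero, zero_pow two_ne_zero]
    exact mul_nonneg hc (sq_nonneg _)
  have e : ‖act Mᵀ z‖ ^ 2 = inner ℝ z (act M (act Mᵀ z)) := by
    rw [inner_act, real_inner_self_eq_norm_sq]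
  have h1 : ‖act Mᵀ z‖ ^ 2 ≤ ‖z‖ * ‖act M (act Mᵀ z)‖ := e ▸ real_inner_le_norm _ _
  have h2 := h (act Mᵀ z)
  have h3 : 0 < ‖act Mᵀ z‖ ^ 2 := by positivity
  have h4 : (‖act Mᵀ z‖ ^ 2) ^ 2 ≤ ‖z‖ ^ 2 * ‖act M (act Mᵀ z)‖ ^ 2 := by
    rw [← mul_pow]; gcongr
  nlinarith [sq_nonneg ‖z‖]

/-! ### One layer -/

lemma posPart_mulVec {l n : ℕ} (W : Matrix (Fin l) (Fin n) ℝ) (x : Vec n) (z : Fin n → ℝ)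
    (i : Fin l) :
    (posPart W x *ᵥ z) i = if 0 < (W *ᵥ x.ofLp) i then (W *ᵥ z) i else 0 := by
  rw [posPart, posDiag, ← Matrix.mulVec_mulVec, Matrix.mulVec_diagonal]
  split_ifs <;> simp

lemma layer_eq {l n : ℕ} (W : Matrix (Fin l) (Fin n) ℝ) (x : Vec n) :
    layer W x = act (posPart W x) x := by
  rw [act_apply, layer]
  congr 1
  funext i
  rw [posPart_mulVec]
  split_ifs with h
  · exact max_eq_left h.le
  · exact max_eq_right (not_lt.mp h)

lemma layer_zero {l n : ℕ} (W : Matrix (Fin l) (Fin n) ℝ) : layer W 0 = 0 := by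
  rw [layer_eq, map_zero]

/-- Puts the sum in `WDC` into the form W_{+,x}ᵀ W_{+,y}, in which layers can be composed. -/
lemma sum_vecMulVec_eq {l n : ℕ} (W : Matrix (Fin l) (Fin n) ℝ) (x y : Vec n) :
    (∑ i, ((if 0 < W i ⬝ᵥ x.ofLp then (1 : ℝ) else 0) *
        (if 0 < W i ⬝ᵥ y.ofLp then (1 : ℝ) else 0)) • Matrix.vecMulVec (W i) (W i)) =
      (posPart W x)ᵀ * posPart W y := by
  ext a b
  rw [Matrix.sum_apply, Matrix.mul_apply]
  refine Finset.sum_congr rfl fun i _ => ?_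
  simp only [posPart, posDiag, Matrix.transpose_apply, Matrix.diagonal_mul, Matrix.smul_apply,
    Matrix.vecMulVec_apply, smul_eq_mul, Matrix.mulVec]
  change _ = (if 0 < W i ⬝ᵥ x.ofLp then (1 : ℝ) else 0) * W i a *
    ((if 0 < W i ⬝ᵥ y.ofLp then (1 : ℝ) else 0) * W i b)
  ring

section
open scoped Matrix.Norms.L2Operator

lemma WDC.norm_sub_le {l n : ℕ} {W : Matrix (Fin l) (Fin n) ℝ} {ε α : ℝ} (hW : WDC W ε α)
    {x y : Vec n} (hx : x ≠ 0) (hy : y ≠ 0) (z : Vec n) :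
    ‖act (posPart W x)ᵀ (act (posPart W y) z) - α • act (Q x y) z‖ ≤ ε * ‖z‖ := by
  have h := hW x y hx hy
  rw [sum_vecMulVec_eq] at h
  have := norm_act_le h z
  simpa [act_mul, LinearMap.sub_apply] using this

end

/-- The cosine of `angleMap θ`. -/
noncomputable def angleCos (θ : ℝ) : ℝ :=
  ((Real.pi - θ) * Real.cos θ + Real.sin θ) / Real.pi

lemma act_Q_right {n : ℕ} {x y : Vec n} (hx : x ≠ 0) (hy : y ≠ 0) :
    act (Q x y) y = ((Real.pi - InnerProductGeometry.angle x y) / (2 * Real.pi)) • y +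
      (Real.sin (InnerProductGeometry.angle x y) / (2 * Real.pi) * ‖y‖) • unit x := by
  have hy' : y = ‖y‖ • unit y := by
    rw [unit, smul_smul, mul_inv_cancel₀ (norm_ne_zero_iff.mpr hy), one_smul]
  have h1 : act (swap x y) y = ‖y‖ • unit x := by
    have h := congrArg (act (swap x y)) hy'
    rwa [map_smul, act_apply _ (unit y), swap_mulVec_right hx hy] at h
  rw [Q, act_add, act_smul, act_smul, act_one, h1, smul_smul]

lemma act_Q_self {n : ℕ} {x : Vec n} (hx : x ≠ 0) (z : Vec n) :
    act (Q x x) z = (1 / 2 : ℝ) • z := by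
  rw [Q, InnerProductGeometry.angle_self hx, Real.sin_zero, zero_div, zero_smul, add_zero, act_smul,
    act_one]
  congr 1
  field_simp
  ring

lemma inner_unit_self {n : ℕ} (x : Vec n) : inner ℝ x (unit x) = ‖x‖ := by
  by_cases hx : x = 0
  · simp [hx]
  rw [unit, inner_smul_right, real_inner_self_eq_norm_sq]
  have : ‖x‖ ≠ 0 := norm_ne_zero_iff.mpr hx
  field_simp

/-- The origin of `angleCos`: if a layer realised Q exactly, its outputs would have norms ‖x‖/√2,
‖y‖/√2 and an angle with this cosine. -/
lemma inner_act_Q {n : ℕ} {x y : Vec n} (hx : x ≠ 0) (hy : y ≠ 0) :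
    inner ℝ x (act (Q x y) y) =
      1 / 2 * (‖x‖ * ‖y‖ * angleCos (InnerProductGeometry.angle x y)) := by
  rw [act_Q_right hx hy, inner_add_right, inner_smul_right, inner_smul_right, inner_unit_self,
    ← InnerProductGeometry.cos_angle_mul_norm_mul_norm x y, angleCos]
  field_simp

lemma WDC.inner_layer {l n : ℕ} {W : Matrix (Fin l) (Fin n) ℝ} {ε : ℝ} (hW : WDC W ε 1)
    {x y : Vec n} (hx : x ≠ 0) (hy : y ≠ 0) :
    |inner ℝ (layer W x) (layer W y) -
      1 / 2 * (‖x‖ * ‖y‖ * angleCos (InnerProductGeometry.angle x y))| ≤ ε * (‖x‖ * ‖y‖) := by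
  rw [layer_eq, layer_eq, ← inner_act_Q hx hy, inner_act', ← inner_sub_right]
  have h := hW.norm_sub_le hx hy y
  rw [one_smul] at h
  refine (abs_real_inner_le_norm _ _).trans ?_
  nlinarith [norm_nonneg x]

lemma WDC.norm_act_posPart_sq {l n : ℕ} {W : Matrix (Fin l) (Fin n) ℝ} {ε : ℝ} (hW : WDC W ε 1)
    {x : Vec n} (hx : x ≠ 0) (z : Vec n) :
    |‖act (posPart W x) z‖ ^ 2 - 1 / 2 * ‖z‖ ^ 2| ≤ ε * ‖z‖ ^ 2 := by
  have h := hW.norm_sub_le hx hx z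
  rw [one_smul, act_Q_self hx] at h
  have e : ‖act (posPart W x) z‖ ^ 2 - 1 / 2 * ‖z‖ ^ 2 =
      inner ℝ z (act (posPart W x)ᵀ (act (posPart W x) z) - (1 / 2 : ℝ) • z) := by
    rw [inner_sub_right, ← inner_act', inner_smul_right, real_inner_self_eq_norm_sq,
      real_inner_self_eq_norm_sq]
  rw [e]
  refine (abs_real_inner_le_norm _ _).trans ?_
  nlinarith [norm_nonneg z]

lemma WDC.norm_layer_sq {l n : ℕ} {W : Matrix (Fin l) (Fin n) ℝ} {ε : ℝ} (hW : WDC W ε 1)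
    (x : Vec n) : |‖layer W x‖ ^ 2 - 1 / 2 * ‖x‖ ^ 2| ≤ ε * ‖x‖ ^ 2 := by
  by_cases hx : x = 0
  · simp [hx, layer_zero]
  · rw [layer_eq]
    exact hW.norm_act_posPart_sq hx x

/-! ### The angle map -/

lemma hasDerivAt_angleCos (θ : ℝ) :
    HasDerivAt angleCos (-((Real.pi - θ) * Real.sin θ) / Real.pi) θ := by
  have h := ((((hasDerivAt_id θ).const_sub Real.pi).mul (Real.hasDerivAt_cos θ)).add
    (Real.hasDerivAt_sin θ)).div_const Real.pi
  refine h.congr_deriv ?_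
  simp only [id]
  ring

lemma continuous_angleCos : Continuous angleCos :=
  continuous_iff_continuousAt.mpr fun θ => (hasDerivAt_angleCos θ).continuousAt

lemma strictAntiOn_angleCos : StrictAntiOn angleCos (Set.Icc 0 Real.pi) := by
  refine strictAntiOn_of_deriv_neg (convex_Icc _ _) continuous_angleCos.continuousOn ?_
  intro θ hθ
  rw [interior_Icc] at hθ
  rw [(hasDerivAt_angleCos θ).deriv]
  have h1 : 0 < Real.pi - θ := sub_pos.mpr hθ.2
  have h2 := Real.sin_pos_of_pos_of_lt_pi hθ.1 hθ.2
  have := mul_pos h1 h2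
  exact div_neg_of_neg_of_pos (by linarith) Real.pi_pos

lemma angleCos_zero : angleCos 0 = 1 := by
  simp [angleCos, Real.pi_ne_zero]

lemma angleCos_pi : angleCos Real.pi = 0 := by
  simp [angleCos]

lemma angleCos_nonneg {θ : ℝ} (h : θ ∈ Set.Icc 0 Real.pi) : 0 ≤ angleCos θ := by
  rw [← angleCos_pi]
  exact strictAntiOn_angleCos.antitoneOn h ⟨Real.pi_pos.le, le_rfl⟩ h.2

lemma angleCos_le_one {θ : ℝ} (h : θ ∈ Set.Icc 0 Real.pi) : angleCos θ ≤ 1 := by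
  rw [← angleCos_zero]
  exact strictAntiOn_angleCos.antitoneOn ⟨le_rfl, Real.pi_pos.le⟩ h h.1

lemma angleMap_eq (θ : ℝ) : angleMap θ = Real.arccos (angleCos θ) := rfl

lemma cos_angleMap {θ : ℝ} (h : θ ∈ Set.Icc 0 Real.pi) :
    Real.cos (angleMap θ) = angleCos θ := by
  rw [angleMap_eq]
  exact Real.cos_arccos (by linarith [angleCos_nonneg h]) (angleCos_le_one h)

lemma continuous_angleMap : Continuous angleMap :=
  Real.continuous_arccos.comp continuous_angleCos

lemma angleMap_mem (θ : ℝ) : angleMap θ ∈ Set.Icc 0 Real.pi :=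
  ⟨Real.arccos_nonneg _, Real.arccos_le_pi _⟩

lemma angleMap_zero : angleMap 0 = 0 := by
  rw [angleMap_eq, angleCos_zero, Real.arccos_one]

lemma angleMap_pi : angleMap Real.pi = Real.pi / 2 := by
  rw [angleMap_eq, angleCos_pi, Real.arccos_zero]

lemma monotoneOn_angleMap : MonotoneOn angleMap (Set.Icc 0 Real.pi) := fun _ ha _ hb hab =>
  Real.arccos_le_arccos (strictAntiOn_angleCos.antitoneOn ha hb hab)

lemma deriv_angleMap_le {θ : ℝ} (h : θ ∈ Set.Ioo 0 Real.pi) :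
    DifferentiableAt ℝ angleMap θ ∧ deriv angleMap θ ≤ 1 := by
  have h' : θ ∈ Set.Icc 0 Real.pi := ⟨h.1.le, h.2.le⟩
  have hK0 := angleCos_nonneg h'
  have hK1 : angleCos θ < 1 := by
    rw [← angleCos_zero]
    exact strictAntiOn_angleCos ⟨le_rfl, Real.pi_pos.le⟩ h' h.1
  have hd := (Real.hasDerivAt_arccos (by linarith) hK1.ne).comp θ (hasDerivAt_angleCos θ)
  have hd' : HasDerivAt angleMap _ θ := hd
  refine ⟨hd'.differentiableAt, ?_⟩
  rw [hd'.deriv]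
  have hs := Real.sin_pos_of_pos_of_lt_pi h.1 h.2
  have hp := Real.pi_pos
  have h1 : 0 < 1 - angleCos θ ^ 2 := by nlinarith
  have hq : 0 < √(1 - angleCos θ ^ 2) := Real.sqrt_pos.mpr h1
  have hu0 : 0 < 1 - θ / Real.pi := by
    rw [sub_pos, div_lt_one hp]; exact h.2
  have hv0 : 0 < Real.sin θ / Real.pi := by positivity
  have huv : (1 - θ / Real.pi) + Real.sin θ / Real.pi ≤ 1 := by
    have := div_le_div_of_nonneg_right (Real.sin_le h.1.le) hp.le
    linarith
  have eK : angleCos θ = (1 - θ / Real.pi) * Real.cos θ + Real.sin θ / Real.pi := by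
    rw [angleCos]; field_simp
  -- With u = 1 - θ/π and v = sin θ/π one has u² sin² θ + (u cos θ + v)² = u² + 2uv cos θ + v² ≤ (u
  -- + v)² ≤ 1, the last step being sin θ ≤ θ.
  have key : (1 - θ / Real.pi) * Real.sin θ ≤ √(1 - angleCos θ ^ 2) := by
    refine Real.le_sqrt_of_sq_le ?_
    rw [eK]
    generalize 1 - θ / Real.pi = u at *
    generalize Real.sin θ / Real.pi = v at *
    have hc := Real.cos_le_one θ
    have hsc := Real.sin_sq_add_cos_sq θ
    have : u * v * Real.cos θ ≤ u * v := by
      have := mul_pos hu0 hv0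
      nlinarith
    have h2 : (u + v) ^ 2 ≤ 1 := by nlinarith
    have h3 : u ^ 2 * Real.sin θ ^ 2 + u ^ 2 * Real.cos θ ^ 2 = u ^ 2 := by
      rw [← mul_add, hsc, mul_one]
    nlinarith
  have e2 : -(1 / √(1 - angleCos θ ^ 2)) * (-((Real.pi - θ) * Real.sin θ) / Real.pi) =
      ((1 - θ / Real.pi) * Real.sin θ) / √(1 - angleCos θ ^ 2) := by
    field_simp
  rw [e2]
  exact (div_le_one hq).mpr key

/-- Nonexpansiveness keeps the angle errors of successive layers additive instead of compounding. -/
lemma angleMap_lipschitz {a b : ℝ} (ha : a ∈ Set.Icc 0 Real.pi) (hb : b ∈ Set.Icc 0 Real.pi) :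
    |angleMap a - angleMap b| ≤ |a - b| := by
  wlog hab : a ≤ b generalizing a b
  · rw [abs_sub_comm, abs_sub_comm a]
    exact this hb ha (le_of_not_ge hab)
  have h := Convex.image_sub_le_mul_sub_of_deriv_le (convex_Icc 0 Real.pi)
    continuous_angleMap.continuousOn
    (fun x hx => by
      rw [interior_Icc] at hx
      exact (deriv_angleMap_le hx).1.differentiableWithinAt) (C := 1)
    (fun x hx => by
      rw [interior_Icc] at hx
      exact (deriv_angleMap_le hx).2) a ha b hb hab
  have h2 := monotoneOn_angleMap ha hb hab
  rw [abs_sub_comm, abs_sub_comm a, abs_of_nonneg (sub_nonneg.mpr h2),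
    abs_of_nonneg (sub_nonneg.mpr hab)]
  linarith

/-- The difference of cosines is 2 sin((a+b)/2) sin((b-a)/2), which is at least 2 sin²((b-a)/2),
hence at least 2((b-a)/π)² by Jordan's inequality; then π² ≤ 10. Cosine errors become angle errors
at the cost of a square root. -/
lemma sq_sub_le_abs_cos_sub {a b : ℝ} (ha : a ∈ Set.Icc 0 Real.pi) (hb : b ∈ Set.Icc 0 Real.pi) :
    (a - b) ^ 2 ≤ 5 * |Real.cos a - Real.cos b| := by
  wlog hab : a ≤ b generalizing a b
  · rw [abs_sub_comm, ← neg_sub, neg_sq]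
    exact this hb ha (le_of_not_ge hab)
  have hp := Real.pi_pos
  have h1 : Real.cos a - Real.cos b = 2 * Real.sin ((b + a) / 2) * Real.sin ((b - a) / 2) := by
    rw [Real.cos_sub_cos, show (a - b) / 2 = -((b - a) / 2) by ring, Real.sin_neg, add_comm a]
    ring
  have ht0 : 0 ≤ (b - a) / 2 := by linarith
  have ht1 : (b - a) / 2 ≤ Real.pi / 2 := by linarith [ha.1, hb.2]
  have hs := Real.mul_le_sin ht0 ht1
  have h2 : Real.sin ((b - a) / 2) ≤ Real.sin ((b + a) / 2) := by
    by_cases hm : (b + a) / 2 ≤ Real.pi / 2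
    · exact Real.sin_le_sin_of_le_of_le_pi_div_two (by linarith) hm (by linarith [ha.1])
    · rw [← Real.sin_pi_sub ((b + a) / 2)]
      exact Real.sin_le_sin_of_le_of_le_pi_div_two (by linarith) (by linarith) (by linarith [hb.2])
  have hb1 : (b - a) / Real.pi ≤ Real.sin ((b - a) / 2) := by
    calc (b - a) / Real.pi = 2 / Real.pi * ((b - a) / 2) := by ring
      _ ≤ _ := hs
  have hb0 : 0 ≤ (b - a) / Real.pi := div_nonneg (by linarith) hp.le
  have h3 : 2 * ((b - a) / Real.pi) ^ 2 ≤ Real.cos a - Real.cos b := by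
    rw [h1]; nlinarith
  have h4 : (a - b) ^ 2 = Real.pi ^ 2 * ((b - a) / Real.pi) ^ 2 := by
    field_simp
    ring
  have h5 : Real.pi ^ 2 ≤ 10 := by nlinarith [Real.pi_lt_d2]
  refine le_trans ?_ (mul_le_mul_of_nonneg_left (le_abs_self _) (by norm_num))
  rw [h4]
  nlinarith [sq_nonneg ((b - a) / Real.pi)]

lemma mul_cos_le_sin {θ : ℝ} (h0 : 0 ≤ θ) (h1 : θ ≤ Real.pi / 2) :
    θ * Real.cos θ ≤ Real.sin θ := by
  rcases h1.eq_or_lt with rfl | h1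
  · simp
  · have hc := Real.cos_pos_of_mem_Ioo ⟨by linarith [Real.pi_pos], h1⟩
    have := Real.le_tan h0 h1
    rwa [Real.tan_eq_sin_div_cos, le_div_iff₀ hc] at this

/-- The difference of the two sides vanishes at 0 and has derivative (t/5)(3 sin t - t cos t),
nonnegative by `mul_cos_le_sin`. -/
lemma sq_mul_sin_le {θ : ℝ} (h0 : 0 ≤ θ) (h1 : θ ≤ Real.pi / 2) :
    θ ^ 2 / 5 * Real.sin θ ≤ Real.sin θ - θ * Real.cos θ := by
  have hd : ∀ t : ℝ, HasDerivAt
      (fun t => Real.sin t - t * Real.cos t - t ^ 2 / 5 * Real.sin t)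
      (t / 5 * (3 * Real.sin t - t * Real.cos t)) t := by
    intro t
    have h := ((Real.hasDerivAt_sin t).sub ((hasDerivAt_id t).mul (Real.hasDerivAt_cos t))).sub
      (((hasDerivAt_pow 2 t).div_const 5).mul (Real.hasDerivAt_sin t))
    refine h.congr_deriv ?_
    simp only [id]
    push_cast
    ring
  have hm : MonotoneOn (fun t => Real.sin t - t * Real.cos t - t ^ 2 / 5 * Real.sin t)
      (Set.Icc 0 (Real.pi / 2)) := by
    refine monotoneOn_of_deriv_nonneg (convex_Icc _ _)
      (fun t _ => (hd t).continuousAt.continuousWithinAt)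
      (fun t _ => (hd t).differentiableAt.differentiableWithinAt) ?_
    intro t ht
    rw [interior_Icc] at ht
    rw [(hd t).deriv]
    have := mul_cos_le_sin ht.1.le ht.2.le
    have hs := Real.sin_nonneg_of_nonneg_of_le_pi ht.1.le (by linarith [ht.2, Real.pi_pos])
    exact mul_nonneg (div_nonneg ht.1.le (by norm_num)) (by linarith)
  have := hm ⟨le_rfl, by positivity⟩ ⟨h0, h1⟩ h0
  simp at this
  linarith

/-- Call the right side A. Then cos A - cos θ ≤ (θ - A) sin θ, and by `sq_mul_sin_le` this is at
most (sin θ - θ cos θ)/π = `angleCos θ` - cos θ. The quadratic decrease is what forces the iterates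
to decay like 1/k. -/
lemma angleMap_le_sub {θ : ℝ} (h0 : 0 ≤ θ) (h1 : θ ≤ Real.pi / 2) :
    angleMap θ ≤ θ - θ ^ 2 / (5 * Real.pi) := by
  have hp := Real.pi_pos
  set A := θ - θ ^ 2 / (5 * Real.pi) with hA
  have hA0 : 0 ≤ A := by
    rw [hA, sub_nonneg, div_le_iff₀ (by positivity)]
    nlinarith
  have hAθ : A ≤ θ := by
    have : 0 ≤ θ ^ 2 / (5 * Real.pi) := by positivity
    linarith
  have hs0 := Real.sin_nonneg_of_nonneg_of_le_pi h0 (by linarith)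
  have hcos : Real.cos A ≤ angleCos θ := by
    have e1 : Real.cos A - Real.cos θ =
        2 * Real.sin ((θ + A) / 2) * Real.sin ((θ - A) / 2) := by
      rw [Real.cos_sub_cos, show (A - θ) / 2 = -((θ - A) / 2) by ring, Real.sin_neg, add_comm A]
      ring
    have e2 : Real.sin ((θ + A) / 2) ≤ Real.sin θ :=
      Real.sin_le_sin_of_le_of_le_pi_div_two (by linarith) h1 (by linarith)
    have e3 : Real.sin ((θ - A) / 2) ≤ (θ - A) / 2 := Real.sin_le (by linarith)
    have e4 : 0 ≤ Real.sin ((θ - A) / 2) :=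
      Real.sin_nonneg_of_nonneg_of_le_pi (by linarith) (by linarith)
    have e5 : Real.cos A - Real.cos θ ≤ Real.sin θ * (θ - A) := by
      rw [e1]; nlinarith
    have e6 : θ - A = θ ^ 2 / 5 / Real.pi := by rw [hA]; field_simp; ring
    have e7 : angleCos θ = Real.cos θ + (Real.sin θ - θ * Real.cos θ) / Real.pi := by
      rw [angleCos]; field_simp; ring
    have e8 := div_le_div_of_nonneg_right (sq_mul_sin_le h0 h1) hp.le
    have e9 : Real.sin θ * (θ - A) = θ ^ 2 / 5 * Real.sin θ / Real.pi := by rw [e6]; ring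
    rw [e7]; linarith
  calc angleMap θ ≤ Real.arccos (Real.cos A) := Real.arccos_le_arccos hcos
    _ = A := Real.arccos_cos hA0 (by linarith)

/-! ### Iterates of the angle map -/

lemma iterate_angleMap_mem {θ : ℝ} (h : θ ∈ Set.Icc 0 Real.pi) (k : ℕ) :
    angleMap^[k] θ ∈ Set.Icc 0 Real.pi := by
  cases k with
  | zero => exact h
  | succ k => rw [Function.iterate_succ_apply']; exact angleMap_mem _

lemma iterate_angleMap_zero (k : ℕ) : angleMap^[k] 0 = 0 :=
  Function.iterate_fixed angleMap_zero k

lemma checkAngle_eq (k : ℕ) : checkAngle k = angleMap^[k] Real.pi := by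
  induction k with
  | zero => rfl
  | succ k ih => rw [Function.iterate_succ_apply', ← ih]; rfl

lemma iterate_angleMap_lipschitz {a b : ℝ} (ha : a ∈ Set.Icc 0 Real.pi)
    (hb : b ∈ Set.Icc 0 Real.pi) (k : ℕ) : |angleMap^[k] a - angleMap^[k] b| ≤ |a - b| := by
  induction k with
  | zero => rfl
  | succ k ih =>
    rw [Function.iterate_succ_apply', Function.iterate_succ_apply']
    exact (angleMap_lipschitz (iterate_angleMap_mem ha k) (iterate_angleMap_mem hb k)).trans ih

lemma iterate_angleMap_le_checkAngle {θ : ℝ} (h : θ ∈ Set.Icc 0 Real.pi) (k : ℕ) :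
    angleMap^[k] θ ≤ checkAngle k := by
  rw [checkAngle_eq]
  induction k with
  | zero => exact h.2
  | succ k ih =>
    rw [Function.iterate_succ_apply', Function.iterate_succ_apply']
    exact monotoneOn_angleMap (iterate_angleMap_mem h k)
      (iterate_angleMap_mem ⟨Real.pi_pos.le, le_rfl⟩ k) ih

lemma checkAngle_mem (k : ℕ) : checkAngle k ∈ Set.Icc 0 Real.pi := by
  rw [checkAngle_eq]
  exact iterate_angleMap_mem ⟨Real.pi_pos.le, le_rfl⟩ k

lemma checkAngle_one : checkAngle 1 = Real.pi / 2 := angleMap_pi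

/-- The map B ↦ B - B²/(5π) sends 5π/(k+10) below 5π/(k+11). The shift 10 makes the bound an
equality at the first iterate, π/2. -/
lemma checkAngle_succ_le (k : ℕ) : checkAngle (k + 1) ≤ 5 * Real.pi / (k + 10) := by
  have hp := Real.pi_pos
  induction k with
  | zero => rw [zero_add, checkAngle_one]; apply le_of_eq; norm_num; ring
  | succ k ih =>
    set B := 5 * Real.pi / ((k : ℝ) + 10) with hB
    have hk : (0 : ℝ) ≤ k := Nat.cast_nonneg k
    have hB0 : 0 ≤ B := by positivity
    have hB1 : B ≤ Real.pi / 2 := by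
      rw [hB, div_le_iff₀ (by positivity)]; nlinarith
    have h1 : checkAngle (k + 1 + 1) ≤ angleMap B :=
      monotoneOn_angleMap (checkAngle_mem _) ⟨hB0, by linarith⟩ ih
    refine h1.trans ((angleMap_le_sub hB0 hB1).trans ?_)
    have e : B - B ^ 2 / (5 * Real.pi) = 5 * Real.pi * ((k + 9) / (k + 10) ^ 2) := by
      rw [hB]; field_simp; ring
    have e2 : ((k : ℝ) + 9) / (k + 10) ^ 2 ≤ 1 / (k + 11) := by
      rw [div_le_div_iff₀ (by positivity) (by positivity)]; nlinarith
    rw [e]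
    calc 5 * Real.pi * (((k : ℝ) + 9) / (k + 10) ^ 2) ≤ 5 * Real.pi * (1 / (k + 11)) :=
          mul_le_mul_of_nonneg_left e2 (by positivity)
      _ = _ := by push_cast; ring

lemma tendsto_checkAngle : Tendsto checkAngle atTop (𝓝 0) := by
  rw [← tendsto_add_atTop_iff_nat 1]
  refine squeeze_zero (fun k => (checkAngle_mem _).1) checkAngle_succ_le ?_
  exact tendsto_const_nhds.div_atTop
    (tendsto_atTop_add_const_right _ _ tendsto_natCast_atTop_atTop)

lemma checkAngle_le_two {k : ℕ} (hk : 2 ≤ k) : checkAngle k ≤ checkAngle 2 := by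
  induction k, hk using Nat.le_induction with
  | base => rfl
  | succ k hk ih =>
    refine le_trans ?_ ih
    obtain ⟨j, rfl⟩ : ∃ j, k = j + 1 := ⟨k - 1, by omega⟩
    have hp := Real.pi_pos
    have hj : checkAngle (j + 1) ≤ Real.pi / 2 := by
      refine (checkAngle_succ_le j).trans ?_
      rw [div_le_iff₀ (by positivity)]
      nlinarith [(Nat.cast_nonneg j : (0 : ℝ) ≤ j)]
    refine (angleMap_le_sub (checkAngle_mem (j + 1)).1 hj).trans ?_
    have : 0 ≤ checkAngle (j + 1) ^ 2 / (5 * Real.pi) := by positivity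
    linarith

/-- The worst starting angle is π, and there the second iterate has cosine 1/π. Two layers are
needed: the first iterate of π is π/2. -/
lemma quarter_le_cos_iterate {θ : ℝ} (h : θ ∈ Set.Icc 0 Real.pi) {k : ℕ} (hk : 2 ≤ k) :
    1 / 4 ≤ Real.cos (angleMap^[k] θ) := by
  have h1 : angleMap^[k] θ ≤ checkAngle 2 :=
    (iterate_angleMap_le_checkAngle h k).trans (checkAngle_le_two hk)
  have hp := Real.pi_pos
  have h2 : Real.cos (checkAngle 2) = 1 / Real.pi := by
    have : checkAngle 2 = angleMap (checkAngle 1) := rfl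
    rw [this, checkAngle_one, cos_angleMap ⟨by positivity, by linarith⟩, angleCos]
    simp
  have h3 := Real.cos_le_cos_of_nonneg_of_le_pi (iterate_angleMap_mem h k).1
    (checkAngle_mem 2).2 h1
  refine le_trans ?_ (h2 ▸ h3)
  exact one_div_le_one_div_of_le hp Real.pi_le_four

/-- The left side is chosen to telescope to k⁻⁵ when multiplied over the layers. By Bernoulli it is
at most (j+1)/(j+6) with k = j + 1, and this is below 1 - 5/(j+10). -/
lemma one_sub_iterate_div_ge {θ : ℝ} (h : θ ∈ Set.Icc 0 Real.pi) {k : ℕ} (hk : 1 ≤ k) :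
    ((k : ℝ) / (k + 1)) ^ 5 ≤ (Real.pi - angleMap^[k] θ) / Real.pi := by
  have hp := Real.pi_pos
  obtain ⟨j, rfl⟩ : ∃ j, k = j + 1 := ⟨k - 1, by omega⟩
  have hj : (0 : ℝ) ≤ j := Nat.cast_nonneg j
  have h1 : angleMap^[j + 1] θ / Real.pi ≤ 5 / (j + 10) := by
    rw [div_le_iff₀ hp]
    refine ((iterate_angleMap_le_checkAngle h _).trans (checkAngle_succ_le j)).trans (le_of_eq ?_)
    ring
  have h2 : 1 + (5 : ℕ) * (1 / ((j : ℝ) + 1)) ≤ (1 + 1 / ((j : ℝ) + 1)) ^ 5 :=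
    one_add_mul_le_pow (by have : 0 ≤ 1 / ((j : ℝ) + 1) := by positivity
                           linarith) 5
  have e1 : (((j + 1 : ℕ) : ℝ) / ((j + 1 : ℕ) + 1)) ^ 5 = ((1 + 1 / ((j : ℝ) + 1)) ^ 5)⁻¹ := by
    rw [← inv_pow]
    congr 1
    push_cast
    field_simp
  rw [e1, sub_div, div_self hp.ne']
  calc ((1 + 1 / ((j : ℝ) + 1)) ^ 5)⁻¹ ≤ (1 + (5 : ℕ) * (1 / ((j : ℝ) + 1)))⁻¹ :=
        inv_anti₀ (by positivity) h2
    _ ≤ 1 - 5 / ((j : ℝ) + 10) := by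
        rw [← one_div, div_le_iff₀ (by positivity), ← sub_nonneg]
        have : (1 - 5 / ((j : ℝ) + 10)) * (1 + (5 : ℕ) * (1 / ((j : ℝ) + 1))) - 1 =
            20 / ((j + 10) * (j + 1)) := by
          push_cast
          field_simp
          ring
        rw [this]
        positivity
    _ ≤ _ := by linarith

/-! ### The coefficients of the limiting direction -/

/-- The coefficient `∏_{j < k} (π - θⱼ) / π`, with `θⱼ` the iterates of `angleMap` at `θ`. -/
noncomputable def coefProd (θ : ℝ) : ℕ → ℝ
  | 0 => 1
  | k + 1 => (Real.pi - angleMap^[k] θ) / Real.pi * coefProd θ k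

/-- The coefficient `∑_{i < k} (sin θᵢ / π) ∏_{i < j < k} (π - θⱼ) / π`. -/
noncomputable def coefSum (θ : ℝ) : ℕ → ℝ
  | 0 => 0
  | k + 1 => (Real.pi - angleMap^[k] θ) / Real.pi * coefSum θ k + Real.sin (angleMap^[k] θ) / Real.pi

lemma coef_factor_nonneg {θ : ℝ} (h : θ ∈ Set.Icc 0 Real.pi) :
    0 ≤ (Real.pi - θ) / Real.pi :=
  div_nonneg (sub_nonneg.mpr h.2) Real.pi_pos.le

lemma coefProd_nonneg {θ : ℝ} (h : θ ∈ Set.Icc 0 Real.pi) (k : ℕ) : 0 ≤ coefProd θ k := by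
  induction k with
  | zero => exact zero_le_one
  | succ k ih => exact mul_nonneg (coef_factor_nonneg (iterate_angleMap_mem h k)) ih

lemma coefSum_nonneg {θ : ℝ} (h : θ ∈ Set.Icc 0 Real.pi) (k : ℕ) : 0 ≤ coefSum θ k := by
  induction k with
  | zero => exact le_rfl
  | succ k ih =>
    have hk := iterate_angleMap_mem h k
    exact add_nonneg (mul_nonneg (coef_factor_nonneg hk) ih)
      (div_nonneg (Real.sin_nonneg_of_mem_Icc hk) Real.pi_pos.le)

/-- As sin θ ≤ θ, each update is bounded by an average of the old sum and 1. This is what makes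
`limitDir` no longer than its second argument. -/
lemma coefProd_add_coefSum_le {θ : ℝ} (h : θ ∈ Set.Icc 0 Real.pi) (k : ℕ) :
    coefProd θ k + coefSum θ k ≤ 1 := by
  induction k with
  | zero => simp [coefProd, coefSum]
  | succ k ih =>
    have hk := iterate_angleMap_mem h k
    have h1 := coef_factor_nonneg hk
    have h2 : Real.sin (angleMap^[k] θ) / Real.pi ≤ angleMap^[k] θ / Real.pi :=
      div_le_div_of_nonneg_right (Real.sin_le hk.1) Real.pi_pos.le
    have h3 : (Real.pi - angleMap^[k] θ) / Real.pi = 1 - angleMap^[k] θ / Real.pi := by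
      rw [sub_div, div_self Real.pi_ne_zero]
    simp only [coefProd, coefSum]
    nlinarith

/-- The recursion of the two coefficients is the recursion cos θ ↦ `angleCos θ`. This evaluates ⟨x,
`limitDir k x y`⟩ and, at θ = π, identifies `rho` with a cosine. -/
lemma coefProd_mul_cos_add {θ : ℝ} (h : θ ∈ Set.Icc 0 Real.pi) (k : ℕ) :
    coefProd θ k * Real.cos θ + coefSum θ k = Real.cos (angleMap^[k] θ) := by
  induction k with
  | zero => simp [coefProd, coefSum]
  | succ k ih =>
    rw [Function.iterate_succ_apply', cos_angleMap (iterate_angleMap_mem h k), angleCos, ← ih]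
    simp only [coefProd, coefSum]
    ring

/-- Telescoping of `one_sub_iterate_div_ge`. The factor (π - θ)/π from the zeroth angle remains and
is the reason a second critical direction appears at θ = π. -/
lemma coefProd_ge {θ : ℝ} (h : θ ∈ Set.Icc 0 Real.pi) {k : ℕ} (hk : 1 ≤ k) :
    (Real.pi - θ) / Real.pi / (k : ℝ) ^ 5 ≤ coefProd θ k := by
  induction k, hk using Nat.le_induction with
  | base => simp [coefProd]
  | succ k hk ih =>
    have hk0 : (0 : ℝ) < k := by exact_mod_cast hk
    have h1 := one_sub_iterate_div_ge h hk
    have e : (Real.pi - θ) / Real.pi / ((k + 1 : ℕ) : ℝ) ^ 5 =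
        ((k : ℝ) / (k + 1)) ^ 5 * ((Real.pi - θ) / Real.pi / (k : ℝ) ^ 5) := by
      push_cast; field_simp
    rw [e]
    exact mul_le_mul h1 ih (div_nonneg (coef_factor_nonneg h) (by positivity))
      (coef_factor_nonneg (iterate_angleMap_mem h k))

lemma coefProd_pi {k : ℕ} (hk : 1 ≤ k) : coefProd Real.pi k = 0 := by
  induction k, hk using Nat.le_induction with
  | base => simp [coefProd]
  | succ k hk ih => rw [coefProd, ih, mul_zero]

lemma rho_eq_coefSum {k : ℕ} (hk : 1 ≤ k) : rho k = coefSum Real.pi k := by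
  induction k, hk using Nat.le_induction with
  | base => simp [rho, coefSum]
  | succ k hk ih =>
    rw [coefSum, ← ih, ← checkAngle_eq, rho, rho, Finset.sum_Ico_succ_top hk, Finset.mul_sum]
    congr 1
    · refine Finset.sum_congr rfl fun i hi => ?_
      rw [Finset.mem_Ico] at hi
      rw [Finset.prod_Ico_succ_top (by omega)]
      ring
    · simp

lemma rho_eq_cos {k : ℕ} (hk : 1 ≤ k) : rho k = Real.cos (angleMap^[k] Real.pi) := by
  rw [← coefProd_mul_cos_add ⟨Real.pi_pos.le, le_rfl⟩, coefProd_pi hk, rho_eq_coefSum hk]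
  ring

lemma rho_pos {d : ℕ} (hd : 2 ≤ d) : 0 < rho d := by
  rw [rho_eq_cos (by omega)]
  linarith [quarter_le_cos_iterate ⟨Real.pi_pos.le, le_rfl⟩ hd]

lemma tendsto_rho : Tendsto rho atTop (𝓝 1) := by
  have h : Tendsto (fun k => Real.cos (checkAngle k)) atTop (𝓝 1) := by
    rw [← Real.cos_zero]
    exact (Real.continuous_cos.tendsto 0).comp tendsto_checkAngle
  refine h.congr' ?_
  filter_upwards [eventually_ge_atTop 1] with k hk
  rw [rho_eq_cos hk, checkAngle_eq]

/-! ### The linear pieces of a network -/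

/-- The matrix `W_{k,+,x} ⋯ W_{1,+,x}` of the linear piece of the first `k` layers at `x`. -/
noncomputable def pattern {n : ℕ → ℕ} (W : ∀ i, Matrix (Fin (n (i + 1))) (Fin (n i)) ℝ) :
    (k : ℕ) → Vec (n 0) → Matrix (Fin (n k)) (Fin (n 0)) ℝ
  | 0, _ => 1
  | k + 1, x => posPart (W k) (innerNet W k x) * pattern W k x

lemma innerNet_eq {n : ℕ → ℕ} (W : ∀ i, Matrix (Fin (n (i + 1))) (Fin (n i)) ℝ) (k : ℕ)
    (x : Vec (n 0)) : innerNet W k x = act (pattern W k x) x := by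
  induction k with
  | zero => exact (act_one x).symm
  | succ k ih => rw [innerNet, pattern, act_mul, ← ih, layer_eq]

/-- The first `N` layers satisfy the weight distributed condition with constants `(σ², 1)`, where
`σ` is small compared with `N`. -/
structure InnerWDC {n : ℕ → ℕ} (W : ∀ i, Matrix (Fin (n (i + 1))) (Fin (n i)) ℝ) (N : ℕ)
    (σ : ℝ) : Prop where
  wdc : ∀ i < N, WDC (W i) (σ ^ 2) 1
  nonneg : 0 ≤ σ
  small : (N + 1) * σ ≤ 1 / 8

/-- Since (1 + 2t)(1 - 2t) ≤ 1, Bernoulli's lower bound for (1 - 2t)ᵏ yields an upper bound for (1 +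
2t)ᵏ. -/
lemma one_add_pow_le {t : ℝ} (ht : 0 ≤ t) (k : ℕ) (hk : k * t ≤ 1 / 8) (ht' : t ≤ 1 / 8) :
    (1 + 2 * t) ^ k ≤ 1 + 4 * (k * t) := by
  have h1 : 1 + (k : ℝ) * (-(2 * t)) ≤ (1 + -(2 * t)) ^ k := one_add_mul_le_pow (by linarith) k
  have h2 : (1 + 2 * t) ^ k * (1 + -(2 * t)) ^ k ≤ 1 := by
    rw [← mul_pow]
    exact pow_le_one₀ (by nlinarith) (by nlinarith)
  have h3 : 0 ≤ (1 + 2 * t) ^ k := by positivity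
  have h4 : 0 ≤ (k : ℝ) * t := by positivity
  have h5 : (1 + 2 * t) ^ k * (1 + (k : ℝ) * (-(2 * t))) ≤ 1 :=
    (mul_le_mul_of_nonneg_left h1 h3).trans h2
  have h6 : (1 + 2 * t) ^ k * (1 - 2 * (k * t)) ≤ (1 + 4 * (k * t)) * (1 - 2 * (k * t)) := by
    refine le_trans (le_of_eq (by ring)) (h5.trans ?_)
    nlinarith
  exact le_of_mul_le_mul_right h6 (by linarith)

lemma one_sub_pow_ge {t : ℝ} (ht' : t ≤ 1 / 8) (k : ℕ) :
    1 - 2 * (k * t) ≤ (1 - 2 * t) ^ k := by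
  have h1 : 1 + (k : ℝ) * (-(2 * t)) ≤ (1 + -(2 * t)) ^ k := one_add_mul_le_pow (by linarith) k
  calc 1 - 2 * (k * t) = 1 + (k : ℝ) * (-(2 * t)) := by ring
    _ ≤ _ := h1
    _ = _ := by ring

namespace InnerWDC

variable {n : ℕ → ℕ} {W : ∀ i, Matrix (Fin (n (i + 1))) (Fin (n i)) ℝ} {N : ℕ} {σ : ℝ}

lemma le_eighth (H : InnerWDC W N σ) : σ ≤ 1 / 8 := by
  have := H.small
  have := mul_nonneg (Nat.cast_nonneg N : (0 : ℝ) ≤ N) H.nonneg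
  linarith

lemma sq_le (H : InnerWDC W N σ) : σ ^ 2 ≤ σ := by
  nlinarith [H.nonneg, H.le_eighth]

lemma mul_sq_le (H : InnerWDC W N σ) {k : ℕ} (hk : k ≤ N) : k * σ ^ 2 ≤ 1 / 8 := by
  have h1 : (k : ℝ) ≤ N := by exact_mod_cast hk
  have h2 : (k : ℝ) * σ ^ 2 ≤ N * σ :=
    mul_le_mul h1 H.sq_le (sq_nonneg σ) (Nat.cast_nonneg N)
  linarith [H.small, H.nonneg]

lemma pow_add_le (H : InnerWDC W N σ) {k : ℕ} (hk : k ≤ N) :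
    (1 + 2 * σ ^ 2) ^ k ≤ 1 + 4 * (k * σ ^ 2) :=
  one_add_pow_le (sq_nonneg σ) k (H.mul_sq_le hk) (H.sq_le.trans H.le_eighth)

lemma pow_sub_ge (H : InnerWDC W N σ) (k : ℕ) :
    1 - 2 * (k * σ ^ 2) ≤ (1 - 2 * σ ^ 2) ^ k :=
  one_sub_pow_ge (H.sq_le.trans H.le_eighth) k

/-! ### Norms of layer outputs and of linear pieces -/

lemma norm_innerNet_ge_pow (H : InnerWDC W N σ) (x : Vec (n 0)) {k : ℕ} (hk : k ≤ N) :
    (1 - 2 * σ ^ 2) ^ k * ‖x‖ ^ 2 ≤ 2 ^ k * ‖innerNet W k x‖ ^ 2 := by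
  induction k with
  | zero => simp [innerNet]
  | succ k ih =>
    have h1 := (abs_le.mp ((H.wdc k (by omega)).norm_layer_sq (innerNet W k x))).1
    have h2 : 0 ≤ 1 - 2 * σ ^ 2 := by linarith [H.sq_le, H.le_eighth]
    have h3 : (0 : ℝ) ≤ 2 ^ k := by positivity
    rw [innerNet, pow_succ, pow_succ]
    calc _ = (1 - 2 * σ ^ 2) * ((1 - 2 * σ ^ 2) ^ k * ‖x‖ ^ 2) := by ring
      _ ≤ (1 - 2 * σ ^ 2) * (2 ^ k * ‖innerNet W k x‖ ^ 2) :=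
        mul_le_mul_of_nonneg_left (ih (by omega)) h2
      _ = 2 ^ k * ((1 - 2 * σ ^ 2) * ‖innerNet W k x‖ ^ 2) := by ring
      _ ≤ 2 ^ k * (2 * ‖layer (W k) (innerNet W k x)‖ ^ 2) :=
        mul_le_mul_of_nonneg_left (by linarith) h3
      _ = _ := by ring

lemma norm_innerNet_ge (H : InnerWDC W N σ) (x : Vec (n 0)) {k : ℕ} (hk : k ≤ N) :
    (1 - 2 * (k * σ ^ 2)) * ‖x‖ ^ 2 ≤ 2 ^ k * ‖innerNet W k x‖ ^ 2 :=
  (mul_le_mul_of_nonneg_right (H.pow_sub_ge k) (sq_nonneg _)).trans (H.norm_innerNet_ge_pow x hk)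

lemma innerNet_ne_zero (H : InnerWDC W N σ) {x : Vec (n 0)} (hx : x ≠ 0) {k : ℕ} (hk : k ≤ N) :
    innerNet W k x ≠ 0 := by
  intro h
  have h1 := H.norm_innerNet_ge x hk
  have h2 := H.mul_sq_le hk
  have h3 : 0 < ‖x‖ ^ 2 := by positivity
  rw [h, norm_zero] at h1
  nlinarith

lemma norm_act_pattern_pow (H : InnerWDC W N σ) {x : Vec (n 0)} (hx : x ≠ 0) (z : Vec (n 0))
    {k : ℕ} (hk : k ≤ N) :
    2 ^ k * ‖act (pattern W k x) z‖ ^ 2 ≤ (1 + 2 * σ ^ 2) ^ k * ‖z‖ ^ 2 := by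
  induction k with
  | zero => simp [pattern]
  | succ k ih =>
    have h1 := (abs_le.mp ((H.wdc k (by omega)).norm_act_posPart_sq
      (H.innerNet_ne_zero hx (k := k) (by omega)) (act (pattern W k x) z))).2
    rw [pattern, act_mul, pow_succ, pow_succ]
    calc _ = 2 ^ k * (2 * ‖act (posPart (W k) (innerNet W k x)) (act (pattern W k x) z)‖ ^ 2) := by
          ring
      _ ≤ 2 ^ k * ((1 + 2 * σ ^ 2) * ‖act (pattern W k x) z‖ ^ 2) :=
        mul_le_mul_of_nonneg_left (by linarith) (by positivity)
      _ = (1 + 2 * σ ^ 2) * (2 ^ k * ‖act (pattern W k x) z‖ ^ 2) := by ring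
      _ ≤ (1 + 2 * σ ^ 2) * ((1 + 2 * σ ^ 2) ^ k * ‖z‖ ^ 2) :=
        mul_le_mul_of_nonneg_left (ih (by omega)) (by positivity)
      _ = _ := by ring

lemma norm_act_pattern (H : InnerWDC W N σ) {x : Vec (n 0)} (hx : x ≠ 0) (z : Vec (n 0))
    {k : ℕ} (hk : k ≤ N) :
    2 ^ k * ‖act (pattern W k x) z‖ ^ 2 ≤ (1 + 4 * (k * σ ^ 2)) * ‖z‖ ^ 2 :=
  (H.norm_act_pattern_pow hx z hk).trans
    (mul_le_mul_of_nonneg_right (H.pow_add_le hk) (sq_nonneg _))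

lemma norm_innerNet_le (H : InnerWDC W N σ) (x : Vec (n 0)) {k : ℕ} (hk : k ≤ N) :
    2 ^ k * ‖innerNet W k x‖ ^ 2 ≤ (1 + 4 * (k * σ ^ 2)) * ‖x‖ ^ 2 := by
  by_cases hx : x = 0
  · rw [innerNet_eq, hx, map_zero]; simp
  · rw [innerNet_eq]; exact H.norm_act_pattern hx x hk

lemma norm_act_pattern_transpose (H : InnerWDC W N σ) {x : Vec (n 0)} (hx : x ≠ 0) {k : ℕ}
    (hk : k ≤ N) (z : Vec (n k)) :
    2 ^ k * ‖act (pattern W k x)ᵀ z‖ ^ 2 ≤ 2 * ‖z‖ ^ 2 := by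
  have h0 : (0 : ℝ) < 2 ^ k := by positivity
  have h := norm_act_transpose_sq_le (M := pattern W k x) (c := 2 / 2 ^ k) (by positivity)
    (fun v => by
      rw [div_mul_eq_mul_div, le_div_iff₀ h0, mul_comm]
      refine (H.norm_act_pattern hx v hk).trans ?_
      have := H.mul_sq_le hk
      gcongr
      linarith) z
  rw [div_mul_eq_mul_div, le_div_iff₀ h0] at h
  linarith

/-- Errors that are small relative to the output of the `k`-th layer stay small when they are
propagated back to the input. -/
lemma norm_propagate_le (H : InnerWDC W N σ) {x : Vec (n 0)} (hx : x ≠ 0) (y : Vec (n 0)) {k : ℕ}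
    (hk : k ≤ N) {e : Vec (n k)} {τ : ℝ} (hτ : 0 ≤ τ) (he : ‖e‖ ≤ τ * ‖innerNet W k y‖) :
    2 ^ k * ‖act (pattern W k x)ᵀ e‖ ≤ 2 * τ * ‖y‖ := by
  have h1 := H.norm_act_pattern_transpose hx hk e
  have h2 := H.norm_innerNet_le y hk
  have h3 := H.mul_sq_le hk
  have h0 : (0 : ℝ) < 2 ^ k := by positivity
  have h4 : 2 ^ k * ‖innerNet W k y‖ ^ 2 ≤ 2 * ‖y‖ ^ 2 :=
    h2.trans (by gcongr; linarith)
  refine abs_le_of_sq_le_sq' ?_ (by positivity) |>.2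
  calc (2 ^ k * ‖act (pattern W k x)ᵀ e‖) ^ 2
      = 2 ^ k * (2 ^ k * ‖act (pattern W k x)ᵀ e‖ ^ 2) := by ring
    _ ≤ 2 ^ k * (2 * ‖e‖ ^ 2) := by gcongr
    _ ≤ 2 ^ k * (2 * (τ * ‖innerNet W k y‖) ^ 2) := by gcongr
    _ = 2 * τ ^ 2 * (2 ^ k * ‖innerNet W k y‖ ^ 2) := by ring
    _ ≤ 2 * τ ^ 2 * (2 * ‖y‖ ^ 2) := by gcongr
    _ = _ := by ring

/-! ### Angles between the outputs of the layers -/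

/-- Dividing the error in the inner product by the product of the norms leaves a cosine error of at
most 4σ², so the squared angle error is at most 20σ². This loss of a square root is why the weight
condition is written with ε = σ². -/
lemma angle_step {l n : ℕ} {V : Matrix (Fin l) (Fin n) ℝ} {σ : ℝ} (hV : WDC V (σ ^ 2) 1)
    (h0 : 0 ≤ σ) (h1 : σ ^ 2 ≤ 1 / 8) {x y : Vec n} (hx : x ≠ 0) (hy : y ≠ 0) :
    |InnerProductGeometry.angle (layer V x) (layer V y) -
      angleMap (InnerProductGeometry.angle x y)| ≤ 5 * σ := by
  have hθ : InnerProductGeometry.angle x y ∈ Set.Icc 0 Real.pi :=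
    ⟨InnerProductGeometry.angle_nonneg _ _, InnerProductGeometry.angle_le_pi _ _⟩
  have hθ' : InnerProductGeometry.angle (layer V x) (layer V y) ∈ Set.Icc 0 Real.pi :=
    ⟨InnerProductGeometry.angle_nonneg _ _, InnerProductGeometry.angle_le_pi _ _⟩
  refine abs_le_of_sq_le_sq ?_ (by positivity)
  refine (sq_sub_le_abs_cos_sub hθ' (angleMap_mem _)).trans ?_
  rw [cos_angleMap hθ]
  have hi := abs_le.mp (hV.inner_layer hx hy)
  rw [← InnerProductGeometry.cos_angle_mul_norm_mul_norm (layer V x) (layer V y)] at hi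
  have hc := Real.abs_cos_le_one (InnerProductGeometry.angle (layer V x) (layer V y))
  have hc' := abs_le.mp hc
  generalize Real.cos (InnerProductGeometry.angle (layer V x) (layer V y)) = c at *
  generalize angleCos (InnerProductGeometry.angle x y) = K at *
  have hX := abs_le.mp (hV.norm_layer_sq x)
  have hY := abs_le.mp (hV.norm_layer_sq y)
  have hB : 0 < ‖x‖ * ‖y‖ := by positivity
  set B := ‖x‖ * ‖y‖ with hBd
  set D := ‖layer V x‖ * ‖layer V y‖ with hDd
  have hD0 : 0 ≤ D := by positivity
  have hD1 : D ≤ (1 / 2 + σ ^ 2) * B := by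
    refine abs_le_of_sq_le_sq' ?_ (by positivity) |>.2
    calc D ^ 2 = ‖layer V x‖ ^ 2 * ‖layer V y‖ ^ 2 := by rw [hDd]; ring
      _ ≤ ((1 / 2 + σ ^ 2) * ‖x‖ ^ 2) * ((1 / 2 + σ ^ 2) * ‖y‖ ^ 2) := by
        gcongr <;> linarith
      _ = _ := by rw [hBd]; ring
  have hD2 : (1 / 2 - σ ^ 2) * B ≤ D := by
    refine abs_le_of_sq_le_sq' ?_ hD0 |>.2
    have hp : 0 ≤ 1 / 2 - σ ^ 2 := by linarith
    calc ((1 / 2 - σ ^ 2) * B) ^ 2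
        = ((1 / 2 - σ ^ 2) * ‖x‖ ^ 2) * ((1 / 2 - σ ^ 2) * ‖y‖ ^ 2) := by rw [hBd]; ring
      _ ≤ ‖layer V x‖ ^ 2 * ‖layer V y‖ ^ 2 := by
        gcongr <;> linarith
      _ = _ := by rw [hDd]; ring
  have hcD : |c * D - 1 / 2 * B * c| ≤ σ ^ 2 * B := by
    have e : c * D - 1 / 2 * B * c = c * (D - 1 / 2 * B) := by ring
    rw [e, abs_mul]
    have : |D - 1 / 2 * B| ≤ σ ^ 2 * B := abs_le.mpr ⟨by linarith, by linarith⟩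
    calc |c| * |D - 1 / 2 * B| ≤ 1 * (σ ^ 2 * B) := by gcongr
      _ = _ := one_mul _
  have hcD' := abs_le.mp hcD
  have : |c - K| ≤ 4 * σ ^ 2 := by
    rw [abs_le]
    constructor
    · have : 1 / 2 * B * (-(4 * σ ^ 2)) ≤ 1 / 2 * B * (c - K) := by nlinarith
      exact le_of_mul_le_mul_left this (by positivity)
    · have : 1 / 2 * B * (c - K) ≤ 1 / 2 * B * (4 * σ ^ 2) := by nlinarith
      exact le_of_mul_le_mul_left this (by positivity)
  nlinarith [sq_nonneg σ]

lemma angle_innerNet (H : InnerWDC W N σ) {x y : Vec (n 0)} (hx : x ≠ 0) (hy : y ≠ 0) {k : ℕ}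
    (hk : k ≤ N) :
    |InnerProductGeometry.angle (innerNet W k x) (innerNet W k y) -
      angleMap^[k] (InnerProductGeometry.angle x y)| ≤ 5 * (k * σ) := by
  induction k with
  | zero => simp [innerNet]
  | succ k ih =>
    have h1 := angle_step (H.wdc k (by omega)) H.nonneg (H.sq_le.trans H.le_eighth)
      (H.innerNet_ne_zero hx (k := k) (by omega)) (H.innerNet_ne_zero hy (k := k) (by omega))
    have h2 := angleMap_lipschitz
      (a := InnerProductGeometry.angle (innerNet W k x) (innerNet W k y))
      (b := angleMap^[k] (InnerProductGeometry.angle x y))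
      ⟨InnerProductGeometry.angle_nonneg _ _, InnerProductGeometry.angle_le_pi _ _⟩
      (iterate_angleMap_mem
        ⟨InnerProductGeometry.angle_nonneg _ _, InnerProductGeometry.angle_le_pi _ _⟩ k)
    rw [Function.iterate_succ_apply']
    have h3 := (abs_sub_le _ _ _).trans (add_le_add h1 (h2.trans (ih (by omega))))
    refine h3.trans (le_of_eq ?_)
    push_cast
    ring

end InnerWDC

/-! ### Concentration of the linear pieces -/

/-- The vector to which `2ᵏ Λ_xᵀ Λ_y y` is close for a `k`-layer network, where `Λ_x` and `Λ_y` are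
the linear pieces at `x` and `y`. -/
noncomputable def limitDir {n : ℕ} (k : ℕ) (x y : Vec n) : Vec n :=
  coefProd (InnerProductGeometry.angle x y) k • y +
    (coefSum (InnerProductGeometry.angle x y) k * ‖y‖) • unit x

lemma angle_mem {n : ℕ} (x y : Vec n) : InnerProductGeometry.angle x y ∈ Set.Icc 0 Real.pi :=
  ⟨InnerProductGeometry.angle_nonneg _ _, InnerProductGeometry.angle_le_pi _ _⟩

lemma norm_unit_le {n : ℕ} (x : Vec n) : ‖unit x‖ ≤ 1 := by
  by_cases hx : x = 0
  · simp [unit, hx]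
  · exact (norm_unit hx).le

lemma norm_limitDir_le {n : ℕ} (k : ℕ) (x y : Vec n) : ‖limitDir k x y‖ ≤ ‖y‖ := by
  have h := angle_mem x y
  have h1 := coefProd_nonneg h k
  have h2 := coefSum_nonneg h k
  have h3 := coefProd_add_coefSum_le h k
  calc ‖limitDir k x y‖ ≤ coefProd (InnerProductGeometry.angle x y) k * ‖y‖ +
        coefSum (InnerProductGeometry.angle x y) k * ‖y‖ * ‖unit x‖ := by
        refine (norm_add_le _ _).trans (le_of_eq ?_)
        rw [norm_smul, norm_smul, Real.norm_of_nonneg h1,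
          Real.norm_of_nonneg (mul_nonneg h2 (norm_nonneg y))]
    _ ≤ coefProd (InnerProductGeometry.angle x y) k * ‖y‖ +
        coefSum (InnerProductGeometry.angle x y) k * ‖y‖ * 1 := by
        gcongr; exact norm_unit_le x
    _ = (coefProd (InnerProductGeometry.angle x y) k +
        coefSum (InnerProductGeometry.angle x y) k) * ‖y‖ := by ring
    _ ≤ 1 * ‖y‖ := by gcongr
    _ = ‖y‖ := one_mul _

lemma inner_limitDir {n : ℕ} (k : ℕ) (x y : Vec n) :
    inner ℝ x (limitDir k x y) =
      ‖x‖ * ‖y‖ * Real.cos (angleMap^[k] (InnerProductGeometry.angle x y)) := by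
  rw [limitDir, inner_add_right, inner_smul_right, inner_smul_right, inner_unit_self,
    ← coefProd_mul_cos_add (angle_mem x y), ← InnerProductGeometry.cos_angle_mul_norm_mul_norm x y]
  ring

lemma limitDir_zero_right {n : ℕ} (k : ℕ) (x : Vec n) : limitDir k x 0 = 0 := by
  simp [limitDir]

lemma norm_smul_unit {n : ℕ} (x : Vec n) : ‖x‖ • unit x = x := by
  by_cases hx : x = 0
  · simp [hx]
  · rw [unit, smul_smul, mul_inv_cancel₀ (norm_ne_zero_iff.mpr hx), one_smul]

lemma limitDir_self {n : ℕ} (k : ℕ) (x : Vec n) : limitDir k x x = x := by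
  by_cases hx : x = 0
  · rw [hx, limitDir_zero_right]
  have h := coefProd_mul_cos_add (θ := 0) ⟨le_rfl, Real.pi_pos.le⟩ k
  rw [iterate_angleMap_zero, Real.cos_zero, mul_one] at h
  rw [limitDir, InnerProductGeometry.angle_self hx, mul_smul, norm_smul_unit, ← add_smul, h,
    one_smul]

namespace InnerWDC

variable {n : ℕ → ℕ} {W : ∀ i, Matrix (Fin (n (i + 1))) (Fin (n i)) ℝ} {N : ℕ} {σ : ℝ}

/-- For equal arguments Q is half the identity, so no angle has to be tracked and each layer costs
only O(σ²). -/
lemma pattern_transpose_self (H : InnerWDC W N σ) {x : Vec (n 0)} (hx : x ≠ 0) {k : ℕ}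
    (hk : k ≤ N) :
    ‖(2 : ℝ) ^ k • act (pattern W k x)ᵀ (innerNet W k x) - x‖ ≤ 4 * (k * σ ^ 2) * ‖x‖ := by
  induction k with
  | zero => simp [pattern, innerNet]
  | succ k ih =>
    have hxk := H.innerNet_ne_zero hx (k := k) (by omega)
    have h1 := (H.wdc k (by omega)).norm_sub_le hxk hxk (innerNet W k x)
    rw [← layer_eq, one_smul, act_Q_self hxk] at h1
    have h2 := H.norm_propagate_le hx x (k := k) (by omega) (sq_nonneg σ) h1
    have e : (2 : ℝ) ^ (k + 1) • act (pattern W (k + 1) x)ᵀ (innerNet W (k + 1) x) - x =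
        (2 * (2 : ℝ) ^ k) • act (pattern W k x)ᵀ (act (posPart (W k) (innerNet W k x))ᵀ
          (layer (W k) (innerNet W k x)) - (1 / 2 : ℝ) • innerNet W k x) +
        ((2 : ℝ) ^ k • act (pattern W k x)ᵀ (innerNet W k x) - x) := by
      rw [pattern, innerNet, Matrix.transpose_mul, act_mul, map_sub, map_smul, pow_succ]
      module
    rw [e]
    refine (norm_add_le _ _).trans ?_
    rw [norm_smul, Real.norm_of_nonneg (by positivity)]
    have h3 := ih (by omega)
    push_cast
    linarith

/-- Both norms shrink by about 2^(-k/2), which cancels in the quotient. The constant 6 comes from 1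
+ 4t ≤ (1 + 6t)²(1 - 2t) and its counterpart, valid for t ≤ 1/8. -/
lemma norm_ratio (H : InnerWDC W N σ) {x y : Vec (n 0)} (hx : x ≠ 0) (hy : y ≠ 0) {k : ℕ}
    (hk : k ≤ N) :
    |‖innerNet W k y‖ / ‖innerNet W k x‖ - ‖y‖ / ‖x‖| ≤ 6 * (k * σ ^ 2) * (‖y‖ / ‖x‖) := by
  have hxk := norm_pos_iff.mpr (H.innerNet_ne_zero hx hk)
  have hyk := norm_nonneg (innerNet W k y)
  have hx' := norm_pos_iff.mpr hx
  have hy' := norm_pos_iff.mpr hy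
  have ht := H.mul_sq_le hk
  have ht0 : 0 ≤ k * σ ^ 2 := by positivity
  have hy1 := H.norm_innerNet_ge y hk
  have hy2 := H.norm_innerNet_le y hk
  have hx1 := H.norm_innerNet_ge x hk
  have hx2 := H.norm_innerNet_le x hk
  have h2 : (0 : ℝ) < 2 ^ k := by positivity
  generalize (k : ℝ) * σ ^ 2 = t at *
  generalize (2 : ℝ) ^ k = c at *
  generalize ‖innerNet W k y‖ = yk at *
  generalize ‖innerNet W k x‖ = xk at *
  generalize ‖x‖ = X at *
  generalize ‖y‖ = Y at *
  have e : yk / xk - Y / X = (yk * X - Y * xk) / (xk * X) := by field_simp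
  have e' : 6 * t * (Y / X) = 6 * t * (Y * xk) / (xk * X) := by field_simp
  have u1 : yk * X ≤ (1 + 6 * t) * (Y * xk) := by
    refine abs_le_of_sq_le_sq' (le_of_mul_le_mul_left ?_ h2) (by positivity) |>.2
    calc c * (yk * X) ^ 2 = (c * yk ^ 2) * X ^ 2 := by ring
      _ ≤ ((1 + 4 * t) * Y ^ 2) * X ^ 2 := by gcongr
      _ ≤ ((1 + 6 * t) ^ 2 * (1 - 2 * t) * Y ^ 2) * X ^ 2 := by
        gcongr
        nlinarith [mul_nonneg ht0 (mul_nonneg ht0 (sub_nonneg.mpr ht))]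
      _ = (1 + 6 * t) ^ 2 * Y ^ 2 * ((1 - 2 * t) * X ^ 2) := by ring
      _ ≤ (1 + 6 * t) ^ 2 * Y ^ 2 * (c * xk ^ 2) := by gcongr
      _ = _ := by ring
  have u2 : (1 - 6 * t) * (Y * xk) ≤ yk * X := by
    refine abs_le_of_sq_le_sq' (le_of_mul_le_mul_left ?_ h2) (by positivity) |>.2
    calc c * ((1 - 6 * t) * (Y * xk)) ^ 2 = (1 - 6 * t) ^ 2 * Y ^ 2 * (c * xk ^ 2) := by ring
      _ ≤ (1 - 6 * t) ^ 2 * Y ^ 2 * ((1 + 4 * t) * X ^ 2) := by gcongr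
      _ = ((1 - 6 * t) ^ 2 * (1 + 4 * t) * Y ^ 2) * X ^ 2 := by ring
      _ ≤ ((1 - 2 * t) * Y ^ 2) * X ^ 2 := by
        gcongr
        nlinarith [mul_nonneg ht0 (mul_nonneg ht0 (sub_nonneg.mpr ht))]
      _ ≤ (c * yk ^ 2) * X ^ 2 := by gcongr
      _ = _ := by ring
  rw [e, e', abs_div, abs_of_pos (mul_pos hxk hx')]
  gcongr
  rw [abs_le]
  constructor <;> linarith

/-- Q acts on the k-th output of y by combining it with the unit vector of the k-th output of x.
Pulled back to the input, the former is near `limitDir k x y` and the latter near a multiple of x,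
which reproduces the recursion of `coefProd` and `coefSum`. -/
lemma limitDir_step (H : InnerWDC W N σ) {x y : Vec (n 0)} (hx : x ≠ 0) (hy : y ≠ 0) {k : ℕ}
    (hk : k ≤ N) {E : ℝ}
    (h : ‖(2 : ℝ) ^ k • act (pattern W k x)ᵀ (innerNet W k y) - limitDir k x y‖ ≤ E * ‖y‖) :
    ‖(2 : ℝ) ^ (k + 1) • act (pattern W k x)ᵀ
        (act (Q (innerNet W k x) (innerNet W k y)) (innerNet W k y)) - limitDir (k + 1) x y‖ ≤
      (E + 8 * (k * σ)) * ‖y‖ := by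
  have hxk := H.innerNet_ne_zero hx hk
  have hyk := H.innerNet_ne_zero hy hk
  have hθ := angle_mem (innerNet W k x) (innerNet W k y)
  have hφ := iterate_angleMap_mem (angle_mem x y) k
  have hang := H.angle_innerNet hx hy hk
  have hself := H.pattern_transpose_self hx hk
  have hratio := H.norm_ratio hx hy hk
  have hL := norm_limitDir_le k x y
  rw [act_Q_right hxk hyk]
  set θ := InnerProductGeometry.angle (innerNet W k x) (innerNet W k y)
  set φ := angleMap^[k] (InnerProductGeometry.angle x y) with hφd
  set z := (2 : ℝ) ^ k • act (pattern W k x)ᵀ (innerNet W k y) with hz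
  set v := (2 : ℝ) ^ k • act (pattern W k x)ᵀ (innerNet W k x) with hv
  set r := ‖innerNet W k y‖ / ‖innerNet W k x‖ with hr
  have hp := Real.pi_pos
  have hp3 := Real.pi_gt_three
  have hx' := norm_pos_iff.mpr hx
  have hσ0 := H.nonneg
  -- Four sources of error: the previous stage, the angle in the coefficient of `limitDir`, the
  -- pull-back of x together with the norm ratio, and the angle inside the sine. Up to the factor
  -- kσ‖y‖, the last three contribute 5/3, 4 and 5/3, in total at most 8.
  have e : (2 : ℝ) ^ (k + 1) • act (pattern W k x)ᵀ
        (((Real.pi - θ) / (2 * Real.pi)) • innerNet W k y +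
          (Real.sin θ / (2 * Real.pi) * ‖innerNet W k y‖) • unit (innerNet W k x)) -
        limitDir (k + 1) x y =
      ((Real.pi - θ) / Real.pi) • (z - limitDir k x y) + ((φ - θ) / Real.pi) • limitDir k x y +
      (Real.sin θ / Real.pi) • (r • (v - x) + (r - ‖y‖ / ‖x‖) • x) +
      ((Real.sin θ - Real.sin φ) / Real.pi * ‖y‖) • unit x := by
    have e1 : limitDir (k + 1) x y = ((Real.pi - φ) / Real.pi) • limitDir k x y +
        (Real.sin φ / Real.pi * ‖y‖) • unit x := by
      simp only [limitDir, coefProd, coefSum, ← hφd]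
      module
    have e2 : (2 : ℝ) ^ (k + 1) • act (pattern W k x)ᵀ
        (((Real.pi - θ) / (2 * Real.pi)) • innerNet W k y +
          (Real.sin θ / (2 * Real.pi) * ‖innerNet W k y‖) • unit (innerNet W k x)) =
        ((Real.pi - θ) / Real.pi) • z + (Real.sin θ / Real.pi * r) • v := by
      rw [map_add, map_smul, map_smul, unit, map_smul, hz, hv, hr]
      simp only [smul_add, smul_smul]
      congr 2 <;> field_simp <;> ring
    have e3 : (‖y‖ / ‖x‖) • x = ‖y‖ • unit x := by
      rw [unit, smul_smul, div_eq_mul_inv]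
    have e4 : (r - ‖y‖ / ‖x‖) • x = r • x - ‖y‖ • unit x := by rw [sub_smul, e3]
    rw [e1, e2, e4]
    have e5 : (φ - θ) / Real.pi = (Real.pi - θ) / Real.pi - (Real.pi - φ) / Real.pi := by ring
    have e6 : (Real.sin θ - Real.sin φ) / Real.pi * ‖y‖ =
      Real.sin θ / Real.pi * ‖y‖ - Real.sin φ / Real.pi * ‖y‖ := by ring
    rw [e5, e6]
    module
  rw [e]
  have ht := H.mul_sq_le hk
  have ht0 : 0 ≤ k * σ ^ 2 := by positivity
  have b1 : ‖((Real.pi - θ) / Real.pi) • (z - limitDir k x y)‖ ≤ E * ‖y‖ := by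
    rw [norm_smul, Real.norm_of_nonneg (coef_factor_nonneg hθ)]
    refine le_trans (mul_le_of_le_one_left (norm_nonneg _) ?_) h
    rw [div_le_one hp]
    linarith [hθ.1]
  have b2 : ‖((φ - θ) / Real.pi) • limitDir k x y‖ ≤ 5 * (k * σ) / 3 * ‖y‖ := by
    rw [norm_smul, Real.norm_eq_abs, abs_div, abs_of_pos hp, abs_sub_comm]
    gcongr
  have b3 : ‖(Real.sin θ / Real.pi) • (r • (v - x) + (r - ‖y‖ / ‖x‖) • x)‖ ≤
      12 * (k * σ) / 3 * ‖y‖ := by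
    have hs : |Real.sin θ / Real.pi| ≤ 1 / 3 := by
      rw [abs_div, abs_of_pos hp]
      exact div_le_div₀ zero_le_one (Real.abs_sin_le_one θ) (by norm_num) hp3.le
    have hr0 : 0 ≤ r := by positivity
    have hρ : 0 ≤ ‖y‖ / ‖x‖ := by positivity
    have hr2 : r ≤ (1 + 6 * (k * σ ^ 2)) * (‖y‖ / ‖x‖) := by linarith [(abs_le.mp hratio).2]
    have hr3 : r ≤ 7 / 4 * (‖y‖ / ‖x‖) :=
      hr2.trans (mul_le_mul_of_nonneg_right (by linarith) hρ)
    have c1 : ‖r • (v - x) + (r - ‖y‖ / ‖x‖) • x‖ ≤ 13 * (k * σ ^ 2) * ‖y‖ := by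
      refine (norm_add_le _ _).trans ?_
      rw [norm_smul, norm_smul, Real.norm_of_nonneg hr0, Real.norm_eq_abs]
      calc r * ‖v - x‖ + |r - ‖y‖ / ‖x‖| * ‖x‖
          ≤ (7 / 4 * (‖y‖ / ‖x‖)) * (4 * (k * σ ^ 2) * ‖x‖) +
            (6 * (k * σ ^ 2) * (‖y‖ / ‖x‖)) * ‖x‖ := by gcongr
        _ = _ := by field_simp; ring
    rw [norm_smul, Real.norm_eq_abs]
    calc |Real.sin θ / Real.pi| * ‖r • (v - x) + (r - ‖y‖ / ‖x‖) • x‖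
        ≤ 1 / 3 * (13 * (k * σ ^ 2) * ‖y‖) := by gcongr
      _ ≤ _ := by
        have : k * σ ^ 2 ≤ k * σ * (1 / 8) := by
          rw [pow_two, ← mul_assoc]
          exact mul_le_mul_of_nonneg_left H.le_eighth
            (mul_nonneg (Nat.cast_nonneg k) H.nonneg)
        nlinarith [norm_nonneg y, mul_nonneg (Nat.cast_nonneg k : (0 : ℝ) ≤ k) H.nonneg]
  have b4 : ‖((Real.sin θ - Real.sin φ) / Real.pi * ‖y‖) • unit x‖ ≤
      5 * (k * σ) / 3 * ‖y‖ := by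
    rw [norm_smul, norm_unit hx, mul_one, Real.norm_eq_abs, abs_mul, abs_norm, abs_div,
      abs_of_pos hp]
    have hs : |Real.sin θ - Real.sin φ| ≤ 5 * (k * σ) :=
      (Real.abs_sin_sub_sin_le θ φ).trans hang
    gcongr
  refine (norm_add_le _ _).trans ?_
  have := norm_add_le (((Real.pi - θ) / Real.pi) • (z - limitDir k x y) +
    ((φ - θ) / Real.pi) • limitDir k x y) ((Real.sin θ / Real.pi) • (r • (v - x) +
      (r - ‖y‖ / ‖x‖) • x))
  have := norm_add_le (((Real.pi - θ) / Real.pi) • (z - limitDir k x y))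
    (((φ - θ) / Real.pi) • limitDir k x y)
  have : 0 ≤ k * σ * ‖y‖ :=
    mul_nonneg (mul_nonneg (Nat.cast_nonneg k) H.nonneg) (norm_nonneg y)
  linarith

/-- At each layer `WDC` replaces W_{+,x}ᵀ W_{+,y} by Q, with an error controlled by
`norm_propagate_le`, and `limitDir_step` evaluates the result. -/
lemma pattern_transpose (H : InnerWDC W N σ) {x y : Vec (n 0)} (hx : x ≠ 0) (hy : y ≠ 0) {k : ℕ}
    (hk : k ≤ N) :
    ‖(2 : ℝ) ^ k • act (pattern W k x)ᵀ (innerNet W k y) - limitDir k x y‖ ≤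
      4 * (k ^ 2 * σ) * ‖y‖ := by
  induction k with
  | zero => simp [pattern, innerNet, limitDir, coefProd, coefSum]
  | succ k ih =>
    have hxk := H.innerNet_ne_zero hx (k := k) (by omega)
    have hyk := H.innerNet_ne_zero hy (k := k) (by omega)
    have hs := H.limitDir_step hx hy (k := k) (by omega) (ih (by omega))
    have h1 := (H.wdc k (by omega)).norm_sub_le hxk hyk (innerNet W k y)
    rw [← layer_eq, one_smul] at h1
    have h2 := H.norm_propagate_le hx y (k := k) (by omega) (sq_nonneg σ) h1
    have e : (2 : ℝ) ^ (k + 1) • act (pattern W (k + 1) x)ᵀ (innerNet W (k + 1) y) -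
          limitDir (k + 1) x y =
        (2 * (2 : ℝ) ^ k) • act (pattern W k x)ᵀ (act (posPart (W k) (innerNet W k x))ᵀ
          (layer (W k) (innerNet W k y)) -
            act (Q (innerNet W k x) (innerNet W k y)) (innerNet W k y)) +
        ((2 : ℝ) ^ (k + 1) • act (pattern W k x)ᵀ
          (act (Q (innerNet W k x) (innerNet W k y)) (innerNet W k y)) -
            limitDir (k + 1) x y) := by
      rw [pattern, innerNet, Matrix.transpose_mul, act_mul, map_sub, pow_succ]
      module
    rw [e]
    refine (norm_add_le _ _).trans ?_
    rw [norm_smul, Real.norm_of_nonneg (by positivity)]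
    have h3 : σ ^ 2 * ‖y‖ ≤ σ * ‖y‖ := mul_le_mul_of_nonneg_right H.sq_le (norm_nonneg y)
    push_cast
    -- The error recursion closes exactly: 4k² + 8k + 4 = 4(k+1)².
    nlinarith

/-- The estimate for `2ᵏ⁺¹ Λ_xᵀ Q Λ_y y`, where `Q` belongs to the outputs of the `k`-th layer. -/
lemma pattern_transpose_Q (H : InnerWDC W N σ) {x y : Vec (n 0)} (hx : x ≠ 0) (hy : y ≠ 0) :
    ‖(2 : ℝ) ^ (N + 1) • act (pattern W N x)ᵀ
        (act (Q (innerNet W N x) (innerNet W N y)) (innerNet W N y)) - limitDir (N + 1) x y‖ ≤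
      4 * ((N + 1) ^ 2 * σ) * ‖y‖ := by
  refine (H.limitDir_step hx hy le_rfl (H.pattern_transpose hx hy le_rfl)).trans ?_
  refine mul_le_mul_of_nonneg_right ?_ (norm_nonneg y)
  nlinarith [H.nonneg]

end InnerWDC

/-! ### Entrywise products -/

lemma act_sub {l n : ℕ} (M N : Matrix (Fin l) (Fin n) ℝ) (x : Vec n) :
    act (M - N) x = act M x - act N x := by
  rw [act_apply, Matrix.sub_mulVec, WithLp.toLp_sub, ← act_apply, ← act_apply]

lemma hadamard_apply {l : ℕ} (u v : Vec l) (i : Fin l) : hadamard u v i = u i * v i := rfl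

lemma hadamard_comm {l : ℕ} (u v : Vec l) : hadamard u v = hadamard v u := by
  ext i; simp [hadamard_apply, mul_comm]

lemma hadamard_sub_left {l : ℕ} (u u' v : Vec l) :
    hadamard (u - u') v = hadamard u v - hadamard u' v := by
  ext i; simp [hadamard_apply, sub_mul]

lemma hadamard_zero_left {l : ℕ} (v : Vec l) : hadamard 0 v = 0 := by
  ext i; simp [hadamard_apply]

lemma hadamard_zero_right {l : ℕ} (v : Vec l) : hadamard v 0 = 0 := by
  ext i; simp [hadamard_apply]

/-! ### The last layer -/

section
open scoped Matrix.Norms.L2Operator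

lemma JointWDC.norm_sub_le {l n p : ℕ} {B : Matrix (Fin l) (Fin n) ℝ}
    {C : Matrix (Fin l) (Fin p) ℝ} {ε α : ℝ} (hJ : JointWDC B C ε α) {h x : Vec n} {m y : Vec p}
    (hh : h ≠ 0) (hx : x ≠ 0) (hm : m ≠ 0) (hy : y ≠ 0) :
    ‖act (posPart B h)ᵀ (hadamard (hadamard (layer B x) (layer C y)) (layer C m)) -
        (α / l * inner ℝ m (act (Q m y) y)) • act (Q h x) x‖ ≤
      ε / l * ‖m‖ * ‖y‖ * ‖x‖ := by
  have h1 := norm_act_le (hJ h x m y hh hx hm hy).1 x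
  have e : act (Matrix.diagonal ((posPart C m *ᵥ m.ofLp) * (posPart C y *ᵥ y.ofLp)))
      (act (posPart B x) x) = hadamard (hadamard (layer B x) (layer C y)) (layer C m) := by
    ext i
    rw [act_apply, hadamard_apply, hadamard_apply, layer_eq, layer_eq, layer_eq]
    simp only [Matrix.mulVec_diagonal, Pi.mul_apply, act_apply]
    ring
  rw [act_sub, act_smul, act_mul, act_mul, e] at h1
  rw [inner_eq_dotProduct]
  exact h1

lemma JointWDC.symm {l n p : ℕ} {B : Matrix (Fin l) (Fin n) ℝ}
    {C : Matrix (Fin l) (Fin p) ℝ} {ε α : ℝ} (hJ : JointWDC B C ε α) : JointWDC C B ε α :=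
  fun h x m y hh hx hm hy => (hJ m y h x hm hy hh hx).symm

end

/-- The matrix of the linear piece at `x` of the network with `N` inner layers. -/
noncomputable def fullPattern {n : ℕ → ℕ} {l : ℕ} (N : ℕ)
    (W : ∀ i, Matrix (Fin (n (i + 1))) (Fin (n i)) ℝ) (V : Matrix (Fin l) (Fin (n N)) ℝ)
    (x : Vec (n 0)) : Matrix (Fin l) (Fin (n 0)) ℝ :=
  posPart V (innerNet W N x) * pattern W N x

lemma generator_eq {n : ℕ → ℕ} {l : ℕ} (N : ℕ)
    (W : ∀ i, Matrix (Fin (n (i + 1))) (Fin (n i)) ℝ) (V : Matrix (Fin l) (Fin (n N)) ℝ)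
    (x : Vec (n 0)) : generator (N + 1) W V x = act (fullPattern N W V x) x := by
  rw [fullPattern, act_mul, ← innerNet_eq, ← layer_eq]
  rfl

lemma generator_zero {n : ℕ → ℕ} {l : ℕ} (N : ℕ)
    (W : ∀ i, Matrix (Fin (n (i + 1))) (Fin (n i)) ℝ) (V : Matrix (Fin l) (Fin (n N)) ℝ) :
    generator (N + 1) W V 0 = 0 := by
  rw [generator_eq, map_zero]

section

variable {l : ℕ} {n p : ℕ → ℕ} {W₁ : ∀ i, Matrix (Fin (n (i + 1))) (Fin (n i)) ℝ}
  {W₂ : ∀ i, Matrix (Fin (p (i + 1))) (Fin (p i)) ℝ} {N₁ N₂ : ℕ}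
  {V₁ : Matrix (Fin l) (Fin (n N₁)) ℝ} {V₂ : Matrix (Fin l) (Fin (p N₂)) ℝ} {σ α : ℝ}

/-- The joint condition replaces the two last layers at once by a Q on the h-side and a scalar ⟨m_k,
Q m₀_k⟩ on the m-side, where the subscript marks outputs of the inner layers. The scalar is ⟨m, ·⟩
of a pulled-back vector, so `pattern_transpose_Q` applies to both networks. -/
lemma norm_term_sub_le_of_ne_zero (H₁ : InnerWDC W₁ N₁ σ) (H₂ : InnerWDC W₂ N₂ σ)
    (hJ : JointWDC V₁ V₂ (σ ^ 2) α) (hα0 : 0 ≤ α) (hα1 : α ≤ 1) (hl : 0 < l)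
    (hs : 4 * ((N₂ + 1) ^ 2 * σ) ≤ 1) {h h₀ : Vec (n 0)} {m m₀ : Vec (p 0)}
    (hh : h ≠ 0) (hm : m ≠ 0) (hh₀ : h₀ ≠ 0) (hm₀ : m₀ ≠ 0) :
    ‖(l * 2 ^ (N₁ + 1) * 2 ^ (N₂ + 1) : ℝ) • act (fullPattern N₁ W₁ V₁ h)ᵀ
        (hadamard (hadamard (generator (N₁ + 1) W₁ V₁ h₀) (generator (N₂ + 1) W₂ V₂ m₀))
          (generator (N₂ + 1) W₂ V₂ m)) -
      (α * inner ℝ m (limitDir (N₂ + 1) m m₀)) • limitDir (N₁ + 1) h h₀‖ ≤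
      24 * (((N₁ + 1) ^ 2 + (N₂ + 1) ^ 2) * σ) * (‖m‖ * ‖m₀‖ * ‖h₀‖) := by
  have hl' : (0 : ℝ) < l := by exact_mod_cast hl
  have hσ := H₁.nonneg
  have hJ' := hJ.norm_sub_le (H₁.innerNet_ne_zero hh le_rfl) (H₁.innerNet_ne_zero hh₀ le_rfl)
    (H₂.innerNet_ne_zero hm le_rfl) (H₂.innerNet_ne_zero hm₀ le_rfl)
  have hA := H₁.pattern_transpose_Q hh hh₀
  have hB := H₂.pattern_transpose_Q hm hm₀
  have hHs := norm_limitDir_le (N₁ + 1) h h₀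
  have hps := norm_limitDir_le (N₂ + 1) m m₀
  set z := act (Q (innerNet W₁ N₁ h) (innerNet W₁ N₁ h₀)) (innerNet W₁ N₁ h₀) with hz
  set w := act (Q (innerNet W₂ N₂ m) (innerNet W₂ N₂ m₀)) (innerNet W₂ N₂ m₀) with hw
  set e := act (posPart V₁ (innerNet W₁ N₁ h))ᵀ
    (hadamard (hadamard (layer V₁ (innerNet W₁ N₁ h₀)) (layer V₂ (innerNet W₂ N₂ m₀)))
      (layer V₂ (innerNet W₂ N₂ m))) - (α / l * inner ℝ (innerNet W₂ N₂ m) w) • z with he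
  have hprop := H₁.norm_propagate_le hh h₀ (k := N₁) le_rfl (e := e)
    (τ := σ ^ 2 / l * ‖innerNet W₂ N₂ m‖ * ‖innerNet W₂ N₂ m₀‖) (by positivity) hJ'
  set P := (2 : ℝ) ^ (N₁ + 1) • act (pattern W₁ N₁ h)ᵀ z with hP
  set R := (2 : ℝ) ^ (N₂ + 1) • act (pattern W₂ N₂ m)ᵀ w with hR
  set P' := limitDir (N₁ + 1) h h₀
  set R' := limitDir (N₂ + 1) m m₀
  have hin : inner ℝ (innerNet W₂ N₂ m) w * 2 ^ (N₂ + 1) = inner ℝ m R := by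
    rw [hR, inner_smul_right, ← inner_act', ← innerNet_eq, mul_comm]
  have e1 : (l * 2 ^ (N₁ + 1) * 2 ^ (N₂ + 1) : ℝ) • act (fullPattern N₁ W₁ V₁ h)ᵀ
        (hadamard (hadamard (generator (N₁ + 1) W₁ V₁ h₀) (generator (N₂ + 1) W₂ V₂ m₀))
          (generator (N₂ + 1) W₂ V₂ m)) - (α * inner ℝ m R') • P' =
      -- The joint-condition error is separated from the two concentration errors, the latter as
      -- ⟨m,R⟩P - ⟨m,R'⟩P' = ⟨m,R⟩(P - P') + ⟨m,R - R'⟩P'.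
      (l * 2 ^ (N₁ + 1) * 2 ^ (N₂ + 1) : ℝ) • act (pattern W₁ N₁ h)ᵀ e +
        α • (inner ℝ m R • (P - P') + inner ℝ m (R - R') • P') := by
    have e2 : act (fullPattern N₁ W₁ V₁ h)ᵀ
        (hadamard (hadamard (generator (N₁ + 1) W₁ V₁ h₀) (generator (N₂ + 1) W₂ V₂ m₀))
          (generator (N₂ + 1) W₂ V₂ m)) =
        act (pattern W₁ N₁ h)ᵀ (e + (α / l * inner ℝ (innerNet W₂ N₂ m) w) • z) := by
      rw [fullPattern, Matrix.transpose_mul, act_mul, he, sub_add_cancel]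
      rfl
    have e3 : (l * 2 ^ (N₁ + 1) * 2 ^ (N₂ + 1) : ℝ) • act (pattern W₁ N₁ h)ᵀ
        ((α / l * inner ℝ (innerNet W₂ N₂ m) w) • z) = (α * inner ℝ m R) • P := by
      rw [map_smul, hP, smul_smul, smul_smul, ← hin]
      congr 1
      field_simp
    rw [e2, map_add, smul_add, e3, inner_sub_right]
    module
  rw [e1]
  have b1 : ‖(l * 2 ^ (N₁ + 1) * 2 ^ (N₂ + 1) : ℝ) • act (pattern W₁ N₁ h)ᵀ e‖ ≤
      16 * σ ^ 2 * (‖m‖ * ‖m₀‖ * ‖h₀‖) := by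
    have c1 : 2 ^ N₂ * (‖innerNet W₂ N₂ m‖ * ‖innerNet W₂ N₂ m₀‖) ≤ 2 * (‖m‖ * ‖m₀‖) := by
      have d0 := H₂.mul_sq_le (le_refl N₂)
      have d1 : 2 ^ N₂ * ‖innerNet W₂ N₂ m‖ ^ 2 ≤ 2 * ‖m‖ ^ 2 :=
        (H₂.norm_innerNet_le m le_rfl).trans (by gcongr; linarith)
      have d2 : 2 ^ N₂ * ‖innerNet W₂ N₂ m₀‖ ^ 2 ≤ 2 * ‖m₀‖ ^ 2 :=
        (H₂.norm_innerNet_le m₀ le_rfl).trans (by gcongr; linarith)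
      refine abs_le_of_sq_le_sq' ?_ (by positivity) |>.2
      calc _ = (2 ^ N₂ * ‖innerNet W₂ N₂ m‖ ^ 2) * (2 ^ N₂ * ‖innerNet W₂ N₂ m₀‖ ^ 2) := by ring
        _ ≤ (2 * ‖m‖ ^ 2) * (2 * ‖m₀‖ ^ 2) := by gcongr
        _ = _ := by ring
    rw [norm_smul, Real.norm_of_nonneg (by positivity)]
    calc l * 2 ^ (N₁ + 1) * 2 ^ (N₂ + 1) * ‖act (pattern W₁ N₁ h)ᵀ e‖
        = l * 4 * 2 ^ N₂ * (2 ^ N₁ * ‖act (pattern W₁ N₁ h)ᵀ e‖) := by ring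
      _ ≤ l * 4 * 2 ^ N₂ *
          (2 * (σ ^ 2 / l * ‖innerNet W₂ N₂ m‖ * ‖innerNet W₂ N₂ m₀‖) * ‖h₀‖) := by gcongr
      _ = 8 * σ ^ 2 * (2 ^ N₂ * (‖innerNet W₂ N₂ m‖ * ‖innerNet W₂ N₂ m₀‖)) * ‖h₀‖ := by
        field_simp; ring
      _ ≤ 8 * σ ^ 2 * (2 * (‖m‖ * ‖m₀‖)) * ‖h₀‖ := by gcongr
      _ = _ := by ring
  have b2 : |inner ℝ m (R - R')| ≤ 4 * ((N₂ + 1) ^ 2 * σ) * (‖m‖ * ‖m₀‖) := by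
    refine (abs_real_inner_le_norm _ _).trans ?_
    calc ‖m‖ * ‖R - R'‖ ≤ ‖m‖ * (4 * ((N₂ + 1) ^ 2 * σ) * ‖m₀‖) := by gcongr
      _ = _ := by ring
  have b3 : |inner ℝ m R| ≤ 2 * (‖m‖ * ‖m₀‖) := by
    have c1 : |inner ℝ m R'| ≤ ‖m‖ * ‖m₀‖ :=
      (abs_real_inner_le_norm _ _).trans (by gcongr)
    have c2 : 4 * ((N₂ + 1) ^ 2 * σ) * (‖m‖ * ‖m₀‖) ≤ 1 * (‖m‖ * ‖m₀‖) := by gcongr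
    have c3 : inner ℝ m R = inner ℝ m R' + inner ℝ m (R - R') := by
      rw [inner_sub_right]; ring
    rw [c3]
    refine (abs_add_le _ _).trans ?_
    linarith
  have b4 : ‖α • (inner ℝ m R • (P - P') + inner ℝ m (R - R') • P')‖ ≤
      (8 * ((N₁ + 1) ^ 2 * σ) + 4 * ((N₂ + 1) ^ 2 * σ)) * (‖m‖ * ‖m₀‖ * ‖h₀‖) := by
    rw [norm_smul, Real.norm_of_nonneg hα0]
    refine (mul_le_of_le_one_left (norm_nonneg _) hα1).trans ((norm_add_le _ _).trans ?_)
    rw [norm_smul, norm_smul, Real.norm_eq_abs, Real.norm_eq_abs]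
    calc |inner ℝ m R| * ‖P - P'‖ + |inner ℝ m (R - R')| * ‖P'‖
        ≤ 2 * (‖m‖ * ‖m₀‖) * (4 * ((N₁ + 1) ^ 2 * σ) * ‖h₀‖) +
          4 * ((N₂ + 1) ^ 2 * σ) * (‖m‖ * ‖m₀‖) * ‖h₀‖ := by gcongr
      _ = _ := by ring
  refine (norm_add_le _ _).trans ((add_le_add b1 b4).trans ?_)
  rw [← add_mul]
  refine mul_le_mul_of_nonneg_right ?_ (by positivity)
  have d1 : (1 : ℝ) ≤ (N₁ + 1) ^ 2 := one_le_pow₀ (by linarith [(Nat.cast_nonneg N₁ : (0 : ℝ) ≤ N₁)])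
  have d3 : σ ≤ (N₁ + 1) ^ 2 * σ := le_mul_of_one_le_left hσ d1
  have d2 := H₁.sq_le
  have d4 : 0 ≤ (N₂ + 1) ^ 2 * σ := by positivity
  linarith

lemma norm_term_sub_le (H₁ : InnerWDC W₁ N₁ σ) (H₂ : InnerWDC W₂ N₂ σ)
    (hJ : JointWDC V₁ V₂ (σ ^ 2) α) (hα0 : 0 ≤ α) (hα1 : α ≤ 1) (hl : 0 < l)
    (hs : 4 * ((N₂ + 1) ^ 2 * σ) ≤ 1) {h : Vec (n 0)} {m : Vec (p 0)}
    (hh : h ≠ 0) (hm : m ≠ 0) (h₀ : Vec (n 0)) (m₀ : Vec (p 0)) :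
    ‖(l * 2 ^ (N₁ + 1) * 2 ^ (N₂ + 1) : ℝ) • act (fullPattern N₁ W₁ V₁ h)ᵀ
        (hadamard (hadamard (generator (N₁ + 1) W₁ V₁ h₀) (generator (N₂ + 1) W₂ V₂ m₀))
          (generator (N₂ + 1) W₂ V₂ m)) -
      (α * inner ℝ m (limitDir (N₂ + 1) m m₀)) • limitDir (N₁ + 1) h h₀‖ ≤
      24 * (((N₁ + 1) ^ 2 + (N₂ + 1) ^ 2) * σ) * (‖m‖ * ‖m₀‖ * ‖h₀‖) := by
  by_cases hh₀ : h₀ = 0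
  · simp [hh₀, generator_zero, hadamard_zero_left, limitDir_zero_right]
  by_cases hm₀ : m₀ = 0
  · simp [hm₀, generator_zero, hadamard_zero_left, hadamard_zero_right, limitDir_zero_right]
  exact norm_term_sub_le_of_ne_zero H₁ H₂ hJ hα0 hα1 hl hs hh hm hh₀ hm₀

/-- `(G₁(h) ⊙ G₂(m) - y₀) ⊙ G₂(m)`, for a network output `g = G₁(h)` and `u = G₂(m)`. -/
noncomputable def residual (y₀ g u : Vec l) : Vec l := hadamard (hadamard g u - y₀) u

/-- A multiple of the vector around which `∇_h f(h, m)` concentrates. -/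
noncomputable def gradField {n p : ℕ} (N₁ N₂ : ℕ) (h₀ : Vec n) (m₀ : Vec p) (h : Vec n)
    (m : Vec p) : Vec n :=
  ‖m‖ ^ 2 • h - inner ℝ m (limitDir (N₂ + 1) m m₀) • limitDir (N₁ + 1) h h₀

/-- The gradient is a difference of two instances of `norm_term_sub_le`, with reference points (h,
m) and (h₀, m₀). In the first, `limitDir_self` gives exactly ‖m‖² h. -/
lemma norm_grad_sub_le (H₁ : InnerWDC W₁ N₁ σ) (H₂ : InnerWDC W₂ N₂ σ)
    (hJ : JointWDC V₁ V₂ (σ ^ 2) α) (hα0 : 0 ≤ α) (hα1 : α ≤ 1) (hl : 0 < l)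
    (hs : 4 * ((N₂ + 1) ^ 2 * σ) ≤ 1) {h : Vec (n 0)} {m : Vec (p 0)}
    (hh : h ≠ 0) (hm : m ≠ 0) (h₀ : Vec (n 0)) (m₀ : Vec (p 0)) :
    ‖(l * 2 ^ (N₁ + 1) * 2 ^ (N₂ + 1) : ℝ) • act (fullPattern N₁ W₁ V₁ h)ᵀ
        (residual (hadamard (generator (N₁ + 1) W₁ V₁ h₀) (generator (N₂ + 1) W₂ V₂ m₀))
          (generator (N₁ + 1) W₁ V₁ h) (generator (N₂ + 1) W₂ V₂ m)) -
      α • gradField N₁ N₂ h₀ m₀ h m‖ ≤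
      24 * (((N₁ + 1) ^ 2 + (N₂ + 1) ^ 2) * σ) * (‖m‖ * (‖h‖ * ‖m‖ + ‖h₀‖ * ‖m₀‖)) := by
  have a := norm_term_sub_le H₁ H₂ hJ hα0 hα1 hl hs hh hm h m
  have b := norm_term_sub_le H₁ H₂ hJ hα0 hα1 hl hs hh hm h₀ m₀
  rw [limitDir_self, limitDir_self, real_inner_self_eq_norm_sq] at a
  have c := (norm_sub_le _ _).trans (add_le_add a b)
  rw [residual, hadamard_sub_left, gradField, map_sub]
  refine le_trans (le_of_eq ?_) (c.trans (le_of_eq ?_))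
  · congr 1; module
  · ring

end

/-! ### Where the limiting gradient is small -/

lemma norm_sub_smul_le {n : ℕ} (x : Vec n) {a : Vec n} (ha : a ≠ 0) :
    ‖x - (‖x‖ / ‖a‖) • a‖ ≤ ‖x‖ * InnerProductGeometry.angle x a := by
  have ha' : ‖a‖ ≠ 0 := norm_ne_zero_iff.mpr ha
  have hθ := (angle_mem x a).1
  refine abs_le_of_sq_le_sq' ?_ (mul_nonneg (norm_nonneg _) hθ) |>.2
  rw [norm_sub_sq_real, inner_smul_right, norm_smul, Real.norm_of_nonneg (by positivity),
    div_mul_cancel₀ _ ha', ← InnerProductGeometry.cos_angle_mul_norm_mul_norm x a]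
  have e : ‖x‖ / ‖a‖ * (Real.cos (InnerProductGeometry.angle x a) * (‖x‖ * ‖a‖)) =
      ‖x‖ ^ 2 * Real.cos (InnerProductGeometry.angle x a) := by field_simp
  rw [e]
  have := Real.one_sub_sq_div_two_le_cos (x := InnerProductGeometry.angle x a)
  nlinarith [sq_nonneg ‖x‖]

/-- Along the curve c is free, so only the two directions and the product of the norms have to
match. -/
lemma mem_hyperbolicNhd {n p : ℕ} {h a : Vec n} {m b : Vec p} (hh : h ≠ 0) (ha : a ≠ 0)
    (hb : b ≠ 0) {τ r : ℝ}
    (hτ : |‖h‖ * ‖m‖ - ‖a‖ * ‖b‖| ≤ τ * (‖a‖ * ‖b‖))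
    (hr : InnerProductGeometry.angle h a + InnerProductGeometry.angle m b + 5 * τ ≤ r) :
    (h, m) ∈ hyperbolicNhd r a b := by
  have hh' := norm_pos_iff.mpr hh
  have ha' := norm_pos_iff.mpr ha
  have hb' := norm_pos_iff.mpr hb
  -- This c gives c • a the norm of h; the error in the product of the norms then falls entirely on
  -- the second component.
  refine ⟨‖h‖ / ‖a‖, by positivity, ?_⟩
  set c := ‖h‖ / ‖a‖ with hc
  have hc0 : 0 < c := by positivity
  have hτ0 : 0 ≤ τ := by
    have := (abs_nonneg _).trans hτ
    exact nonneg_of_mul_nonneg_left this (by positivity)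
  set B := ‖(1 / c) • b‖ with hB
  have hB' : B = ‖a‖ * ‖b‖ / ‖h‖ := by
    rw [hB, norm_smul, Real.norm_of_nonneg (by positivity), hc]
    field_simp
  have hA' : ‖c • a‖ = ‖h‖ := by
    rw [norm_smul, Real.norm_of_nonneg hc0.le, hc]
    field_simp
  have hB0 : 0 < B := by rw [hB']; positivity
  have h1 : ‖h - c • a‖ ≤ ‖c • a‖ * InnerProductGeometry.angle h a := by
    rw [hA']; exact norm_sub_smul_le h ha
  have h2 : |‖m‖ - B| ≤ τ * B := by
    have e : ‖m‖ - B = (‖h‖ * ‖m‖ - ‖a‖ * ‖b‖) / ‖h‖ := by rw [hB']; field_simp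
    rw [e, abs_div, abs_of_pos hh', div_le_iff₀ hh', hB']
    refine hτ.trans (le_of_eq ?_)
    field_simp
  have h3 : ‖m - (1 / c) • b‖ ≤ B * (InnerProductGeometry.angle m b + 5 * τ) := by
    have e : m - (1 / c) • b = (m - (‖m‖ / ‖b‖) • b) + ((‖m‖ - B) / ‖b‖) • b := by
      have : B / ‖b‖ = 1 / c := by
        rw [hB', hc]; field_simp
      rw [sub_div, sub_smul, this]
      abel
    rw [e]
    refine (norm_add_le _ _).trans ?_
    rw [norm_smul, Real.norm_eq_abs, abs_div, abs_norm, div_mul_cancel₀ _ hb'.ne']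
    have k1 := norm_sub_smul_le m hb
    have k2 := angle_mem m b
    have k3 : ‖m‖ ≤ (1 + τ) * B := by linarith [(abs_le.mp h2).2]
    have k4 : ‖m‖ * InnerProductGeometry.angle m b ≤
        (1 + τ) * B * InnerProductGeometry.angle m b :=
      mul_le_mul_of_nonneg_right k3 k2.1
    -- The coefficient 5 of τ is 4 (from angle ≤ π ≤ 4) plus 1 (from the norm mismatch).
    have k5 : τ * B * InnerProductGeometry.angle m b ≤ τ * B * 4 :=
      mul_le_mul_of_nonneg_left (k2.2.trans Real.pi_le_four) (by positivity)
    nlinarith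
  have n1 : ‖WithLp.toLp 2 (h, m) - WithLp.toLp 2 (c • a, (1 / c) • b)‖ ≤
      ‖h - c • a‖ + ‖m - (1 / c) • b‖ := by
    rw [WithLp.prod_norm_eq_of_L2]
    refine Real.sqrt_le_iff.mpr ⟨by positivity, ?_⟩
    change ‖h - c • a‖ ^ 2 + ‖m - (1 / c) • b‖ ^ 2 ≤ _
    nlinarith [norm_nonneg (h - c • a), norm_nonneg (m - (1 / c) • b)]
  have n2 : ‖c • a‖ ≤ ‖WithLp.toLp 2 (c • a, (1 / c) • b)‖ := by
    rw [WithLp.prod_norm_eq_of_L2]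
    refine Real.le_sqrt_of_sq_le ?_
    exact le_add_of_nonneg_right (sq_nonneg _)
  have n3 : B ≤ ‖WithLp.toLp 2 (c • a, (1 / c) • b)‖ := by
    rw [WithLp.prod_norm_eq_of_L2]
    refine Real.le_sqrt_of_sq_le ?_
    exact le_add_of_nonneg_left (sq_nonneg _)
  set D := ‖WithLp.toLp 2 (c • a, (1 / c) • b)‖
  have hD : 0 ≤ D := hB0.le.trans n3
  have i1 := (angle_mem h a).1
  have i2 := (angle_mem m b).1
  calc _ ≤ _ := n1
    _ ≤ ‖c • a‖ * InnerProductGeometry.angle h a +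
        B * (InnerProductGeometry.angle m b + 5 * τ) := add_le_add h1 h3
    _ ≤ D * InnerProductGeometry.angle h a + D * (InnerProductGeometry.angle m b + 5 * τ) := by
      gcongr
    _ = (InnerProductGeometry.angle h a + InnerProductGeometry.angle m b + 5 * τ) * D := by ring
    _ ≤ r * D := mul_le_mul_of_nonneg_right hr hD

/-- Jordan's inequality on either half of the interval. Near π both factors vanish, so only the
square of π - φ is controlled; this second square root leads to ε^(1/4). -/
lemma small_or_near_pi {φ t : ℝ} (hφ : φ ∈ Set.Icc 0 Real.pi)
    (h : (Real.pi - φ) * Real.sin φ ≤ t) : φ ≤ t ∨ (Real.pi - φ) ^ 2 ≤ 2 * t := by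
  have hp := Real.pi_pos
  by_cases hc : φ ≤ Real.pi / 2
  · left
    have h1 := Real.mul_le_sin hφ.1 hc
    have h2 : 0 ≤ 2 / Real.pi * φ := mul_nonneg (by positivity) hφ.1
    calc φ = Real.pi / 2 * (2 / Real.pi * φ) := by field_simp
      _ ≤ (Real.pi - φ) * Real.sin φ :=
        mul_le_mul (by linarith) h1 h2 (by linarith)
      _ ≤ t := h
  · right
    have h0 : 0 ≤ Real.pi - φ := sub_nonneg.mpr hφ.2
    have h1 := Real.mul_le_sin h0 (by linarith)
    rw [Real.sin_pi_sub] at h1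
    have h2 : (Real.pi - φ) * (2 / Real.pi * (Real.pi - φ)) ≤ t :=
      (mul_le_mul_of_nonneg_left h1 h0).trans h
    have h3 : (Real.pi - φ) ^ 2 ≤ Real.pi / 2 * t := by
      calc (Real.pi - φ) ^ 2 =
            Real.pi / 2 * ((Real.pi - φ) * (2 / Real.pi * (Real.pi - φ))) := by
            field_simp
        _ ≤ _ := by gcongr
    have ht : 0 ≤ t :=
      le_trans (mul_nonneg h0 (Real.sin_nonneg_of_mem_Icc hφ)) h
    nlinarith [Real.pi_le_four]

section

variable {n p : ℕ} {N₁ N₂ : ℕ} {h h₀ : Vec n} {m m₀ : Vec p} {η : ℝ}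

/-- Pair the limiting gradient with h, apply `inner_limitDir` to both factors and divide by ‖h‖‖m‖.
-/
lemma radial_bound (hh : h ≠ 0) (hm : m ≠ 0)
    (hg : ‖gradField N₁ N₂ h₀ m₀ h m‖ ≤ η * (‖m‖ * (‖h‖ * ‖m‖ + ‖h₀‖ * ‖m₀‖))) :
    |‖h‖ * ‖m‖ - ‖h₀‖ * ‖m₀‖ * (Real.cos (angleMap^[N₁ + 1] (InnerProductGeometry.angle h h₀)) *
      Real.cos (angleMap^[N₂ + 1] (InnerProductGeometry.angle m m₀)))| ≤
      η * (‖h‖ * ‖m‖ + ‖h₀‖ * ‖m₀‖) := by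
  have hh' := norm_pos_iff.mpr hh
  have hm' := norm_pos_iff.mpr hm
  have h1 := abs_real_inner_le_norm h (gradField N₁ N₂ h₀ m₀ h m)
  have hin : inner ℝ h (gradField N₁ N₂ h₀ m₀ h m) = ‖m‖ ^ 2 * ‖h‖ ^ 2 -
      inner ℝ m (limitDir (N₂ + 1) m m₀) * inner ℝ h (limitDir (N₁ + 1) h h₀) := by
    rw [gradField, inner_sub_right, inner_smul_right, inner_smul_right,
      real_inner_self_eq_norm_sq]
  rw [hin, inner_limitDir, inner_limitDir] at h1
  have h2 := h1.trans (mul_le_mul_of_nonneg_left hg (norm_nonneg h))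
  generalize Real.cos (angleMap^[N₁ + 1] (InnerProductGeometry.angle h h₀)) = c₁ at *
  generalize Real.cos (angleMap^[N₂ + 1] (InnerProductGeometry.angle m m₀)) = c₂ at *
  have e : ‖m‖ ^ 2 * ‖h‖ ^ 2 - ‖m‖ * ‖m₀‖ * c₂ * (‖h‖ * ‖h₀‖ * c₁) =
      (‖h‖ * ‖m‖) * (‖h‖ * ‖m‖ - ‖h₀‖ * ‖m₀‖ * (c₁ * c₂)) := by ring
  rw [e, abs_mul, abs_of_pos (by positivity)] at h2
  refine le_of_mul_le_mul_left (h2.trans (le_of_eq ?_)) (mul_pos hh' hm')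
  ring

/-- Pair with the component e of h₀ orthogonal to h. This removes every multiple of h and leaves the
`coefProd` term, with ‖e‖ = ‖h₀‖ sin ∠(h, h₀). -/
lemma tangential_bound (hh : h ≠ 0) (hm : m ≠ 0) (hη : 0 ≤ η)
    (hg : ‖gradField N₁ N₂ h₀ m₀ h m‖ ≤ η * (‖m‖ * (‖h‖ * ‖m‖ + ‖h₀‖ * ‖m₀‖))) :
    ‖h₀‖ * ‖m₀‖ * (Real.cos (angleMap^[N₂ + 1] (InnerProductGeometry.angle m m₀)) *
      coefProd (InnerProductGeometry.angle h h₀) (N₁ + 1) *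
      Real.sin (InnerProductGeometry.angle h h₀)) ≤ η * (‖h‖ * ‖m‖ + ‖h₀‖ * ‖m₀‖) := by
  have hh' := norm_pos_iff.mpr hh
  have hm' := norm_pos_iff.mpr hm
  set e : Vec n := h₀ - (inner ℝ h h₀ / ‖h‖ ^ 2) • h with he
  have e1 : inner ℝ e h = 0 := by
    rw [he, inner_sub_left, real_inner_smul_left, real_inner_self_eq_norm_sq, real_inner_comm]
    field_simp
    ring
  have e2 : inner ℝ e h₀ = ‖e‖ ^ 2 := by
    rw [← real_inner_self_eq_norm_sq]
    conv_rhs => rw [he, inner_sub_right, inner_smul_right, ← he, e1]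
    ring
  have e3 : ‖e‖ = ‖h₀‖ * Real.sin (InnerProductGeometry.angle h h₀) := by
    have hs := Real.sin_nonneg_of_mem_Icc (angle_mem h h₀)
    rw [← sq_eq_sq₀ (norm_nonneg _) (by positivity), ← e2, he, inner_sub_left,
      real_inner_smul_left, real_inner_self_eq_norm_sq, mul_pow, Real.sin_sq,
      ← InnerProductGeometry.cos_angle_mul_norm_mul_norm h h₀]
    field_simp
  have h1 := (neg_le_abs _).trans (abs_real_inner_le_norm e (gradField N₁ N₂ h₀ m₀ h m))
  have hin : inner ℝ e (gradField N₁ N₂ h₀ m₀ h m) = -(inner ℝ m (limitDir (N₂ + 1) m m₀) *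
      (coefProd (InnerProductGeometry.angle h h₀) (N₁ + 1) * ‖e‖ ^ 2)) := by
    rw [gradField, inner_sub_right, inner_smul_right, inner_smul_right, e1,
      limitDir.eq_1 (N₁ + 1), inner_add_right, inner_smul_right, inner_smul_right, unit,
      inner_smul_right, e1, e2]
    ring
  rw [hin, neg_neg, inner_limitDir] at h1
  have h2 := h1.trans (mul_le_mul_of_nonneg_left hg (norm_nonneg e))
  generalize Real.cos (angleMap^[N₂ + 1] (InnerProductGeometry.angle m m₀)) = c₂ at *
  generalize coefProd (InnerProductGeometry.angle h h₀) (N₁ + 1) = P at *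
  have e4 : ‖h₀‖ * ‖m₀‖ * (c₂ * P * Real.sin (InnerProductGeometry.angle h h₀)) =
      ‖m₀‖ * c₂ * P * ‖e‖ := by rw [e3]; ring
  rw [e4]
  rcases (norm_nonneg e).eq_or_lt with h0 | h0
  · rw [← h0, mul_zero]
    positivity
  · refine le_of_mul_le_mul_left (le_trans (le_of_eq ?_) (h2.trans (le_of_eq ?_)))
      (mul_pos h0 hm') <;> ring

/-- Where the limiting gradient in `h` is small, `h` points either almost in the direction of `h₀`
or almost in the opposite direction. -/
lemma angle_dichotomy (hh : h ≠ 0) (hm : m ≠ 0) (hη : 0 ≤ η) (hN : 1 ≤ N₂)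
    (hb : 0 < ‖h₀‖ * ‖m₀‖) (hab : ‖h‖ * ‖m‖ ≤ 2 * (‖h₀‖ * ‖m₀‖))
    (hg : ‖gradField N₁ N₂ h₀ m₀ h m‖ ≤ η * (‖m‖ * (‖h‖ * ‖m‖ + ‖h₀‖ * ‖m₀‖))) :
    InnerProductGeometry.angle h h₀ ≤ 48 * ((N₁ + 1) ^ 5 * η) ∨
      (Real.pi - InnerProductGeometry.angle h h₀) ^ 2 ≤ 2 * (48 * ((N₁ + 1) ^ 5 * η)) := by
  have hφ := angle_mem h h₀
  refine small_or_near_pi hφ ?_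
  have h1 := tangential_bound hh hm hη hg
  have hc := quarter_le_cos_iterate (angle_mem m m₀) (show 2 ≤ N₂ + 1 by omega)
  have hP := coefProd_ge hφ (show 1 ≤ N₁ + 1 by omega)
  have hs := Real.sin_nonneg_of_mem_Icc hφ
  have hp := Real.pi_pos
  have hpφ : 0 ≤ Real.pi - InnerProductGeometry.angle h h₀ := sub_nonneg.mpr hφ.2
  push_cast at hP
  generalize Real.cos (angleMap^[N₂ + 1] (InnerProductGeometry.angle m m₀)) = c₂ at *
  generalize coefProd (InnerProductGeometry.angle h h₀) (N₁ + 1) = P at *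
  set φ := InnerProductGeometry.angle h h₀
  set b := ‖h₀‖ * ‖m₀‖
  have hD : (0 : ℝ) < ((N₁ : ℝ) + 1) ^ 5 := by positivity
  generalize ((N₁ : ℝ) + 1) ^ 5 = D at *
  -- The bound ‖h‖‖m‖ ≤ 2‖h₀‖‖m₀‖ makes the error at most 3η‖h₀‖‖m₀‖. The final 48 is 4 (from cos ≥
  -- 1/4) times 4 (from π ≤ 4) times 3.
  have h2 : c₂ * P * Real.sin φ ≤ 3 * η := by
    refine le_of_mul_le_mul_left (h1.trans ?_) hb
    nlinarith
  have h3 : 1 / 4 * ((Real.pi - φ) / Real.pi / D) * Real.sin φ ≤ 3 * η := by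
    refine le_trans ?_ h2
    gcongr
  calc (Real.pi - φ) * Real.sin φ =
        4 * Real.pi * D * (1 / 4 * ((Real.pi - φ) / Real.pi / D) * Real.sin φ) := by field_simp
    _ ≤ 4 * Real.pi * D * (3 * η) := by gcongr
    _ ≤ 4 * 4 * D * (3 * η) := by gcongr; exact Real.pi_le_four
    _ = _ := by ring

/-- Both cosines are at most 1, so the radial bound caps ‖h‖‖m‖. It also excludes ‖h₀‖‖m₀‖ = 0,
since then ‖h‖‖m‖ ≤ η‖h‖‖m‖ with η < 1. -/
lemma product_bounds (hh : h ≠ 0) (hm : m ≠ 0) (hη : η ≤ 1 / 3)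
    (hg : ‖gradField N₁ N₂ h₀ m₀ h m‖ ≤ η * (‖m‖ * (‖h‖ * ‖m‖ + ‖h₀‖ * ‖m₀‖))) :
    0 < ‖h₀‖ * ‖m₀‖ ∧ ‖h‖ * ‖m‖ ≤ 2 * (‖h₀‖ * ‖m₀‖) := by
  have ha : 0 < ‖h‖ * ‖m‖ := by positivity
  have h1 := (le_abs_self _).trans (radial_bound hh hm hg)
  have hb : 0 ≤ ‖h₀‖ * ‖m₀‖ := by positivity
  have hc : Real.cos (angleMap^[N₁ + 1] (InnerProductGeometry.angle h h₀)) *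
      Real.cos (angleMap^[N₂ + 1] (InnerProductGeometry.angle m m₀)) ≤ 1 :=
    (le_abs_self _).trans ((abs_mul _ _).le.trans
      (mul_le_one₀ (Real.abs_cos_le_one _) (abs_nonneg _) (Real.abs_cos_le_one _)))
  generalize Real.cos (angleMap^[N₁ + 1] (InnerProductGeometry.angle h h₀)) *
      Real.cos (angleMap^[N₂ + 1] (InnerProductGeometry.angle m m₀)) = c at *
  have h2 : ‖h₀‖ * ‖m₀‖ * c ≤ ‖h₀‖ * ‖m₀‖ := mul_le_of_le_one_right hb hc
  have h3 : η * (‖h‖ * ‖m‖ + ‖h₀‖ * ‖m₀‖) ≤ 1 / 3 * (‖h‖ * ‖m‖ + ‖h₀‖ * ‖m₀‖) := by gcongr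
  constructor <;> nlinarith

/-- Membership in a hyperbolic neighborhood from closeness of the angles of `h` and `m` to given
angles `φ`, `ψ`, which determine the scale. -/
lemma mem_hyperbolicNhd_of_angles (hh : h ≠ 0) (hm : m ≠ 0) (hη : η ≤ 1 / 3)
    (hη0 : 0 ≤ η) (hN₁ : 1 ≤ N₁) (hN₂ : 1 ≤ N₂)
    (hg : ‖gradField N₁ N₂ h₀ m₀ h m‖ ≤ η * (‖m‖ * (‖h‖ * ‖m‖ + ‖h₀‖ * ‖m₀‖)))
    {a : Vec n} {b : Vec p} {φ ψ r : ℝ} (hφ : φ ∈ Set.Icc 0 Real.pi) (hψ : ψ ∈ Set.Icc 0 Real.pi)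
    (hab : ‖a‖ * ‖b‖ =
      ‖h₀‖ * ‖m₀‖ * (Real.cos (angleMap^[N₁ + 1] φ) * Real.cos (angleMap^[N₂ + 1] ψ)))
    (ha : InnerProductGeometry.angle h a = |InnerProductGeometry.angle h h₀ - φ|)
    (hb : InnerProductGeometry.angle m b = |InnerProductGeometry.angle m m₀ - ψ|)
    (hr : 240 * η + 81 * (|InnerProductGeometry.angle h h₀ - φ| +
      |InnerProductGeometry.angle m m₀ - ψ|) ≤ r) :
    (h, m) ∈ hyperbolicNhd r a b := by
  obtain ⟨hb0, hab2⟩ := product_bounds hh hm hη hg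
  have hrad := radial_bound hh hm hg
  have k1 := (Real.abs_cos_sub_cos_le _ _).trans
    (iterate_angleMap_lipschitz (angle_mem h h₀) hφ (N₁ + 1))
  have k2 := (Real.abs_cos_sub_cos_le _ _).trans
    (iterate_angleMap_lipschitz (angle_mem m m₀) hψ (N₂ + 1))
  have q1 := quarter_le_cos_iterate hφ (show 2 ≤ N₁ + 1 by omega)
  have q2 := quarter_le_cos_iterate hψ (show 2 ≤ N₂ + 1 by omega)
  have u1 := Real.abs_cos_le_one (angleMap^[N₁ + 1] (InnerProductGeometry.angle h h₀))
  have u2 := Real.abs_cos_le_one (angleMap^[N₂ + 1] ψ)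
  generalize Real.cos (angleMap^[N₁ + 1] (InnerProductGeometry.angle h h₀)) = c₁ at *
  generalize Real.cos (angleMap^[N₂ + 1] (InnerProductGeometry.angle m m₀)) = c₂ at *
  generalize Real.cos (angleMap^[N₁ + 1] φ) = d₁ at *
  generalize Real.cos (angleMap^[N₂ + 1] ψ) = d₂ at *
  rw [← ha] at k1 hr
  rw [← hb] at k2 hr
  have hd : 1 / 16 ≤ d₁ * d₂ := by nlinarith
  have hpos : 0 < ‖a‖ * ‖b‖ := by rw [hab]; positivity
  have ha0 : a ≠ 0 := by
    rintro rfl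
    simp at hpos
  have hb0' : b ≠ 0 := by
    rintro rfl
    simp at hpos
  -- The factor 16 turns errors relative to ‖h₀‖‖m₀‖ into errors relative to ‖a‖‖b‖, as d₁d₂ ≥ 1/16.
  -- Then 5τ plus the angles is 240η plus 81 times the angles.
  refine mem_hyperbolicNhd hh ha0 hb0'
    (τ := 16 * (3 * η + InnerProductGeometry.angle h a + InnerProductGeometry.angle m b)) ?_
    (le_trans (le_of_eq ?_) hr)
  · have hcd : |c₁ * c₂ - d₁ * d₂| ≤
        InnerProductGeometry.angle h a + InnerProductGeometry.angle m b := by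
      have e : c₁ * c₂ - d₁ * d₂ = c₁ * (c₂ - d₂) + (c₁ - d₁) * d₂ := by ring
      rw [e]
      refine (abs_add_le _ _).trans ?_
      rw [abs_mul, abs_mul, add_comm]
      refine add_le_add ((mul_le_of_le_one_right (abs_nonneg _) u2).trans k1)
        ((mul_le_of_le_one_left (abs_nonneg _) u1).trans k2)
    set B := ‖h₀‖ * ‖m₀‖
    set A := ‖h‖ * ‖m‖
    set δ := InnerProductGeometry.angle h a + InnerProductGeometry.angle m b with hδ
    have hδ0 : 0 ≤ δ := add_nonneg (angle_mem _ _).1 (angle_mem _ _).1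
    rw [hab]
    have e : A - B * (d₁ * d₂) = (A - B * (c₁ * c₂)) + B * (c₁ * c₂ - d₁ * d₂) := by ring
    rw [e]
    refine (abs_add_le _ _).trans ?_
    rw [abs_mul, abs_of_pos hb0]
    have i1 : η * (A + B) ≤ 3 * η * B := by nlinarith
    have i2 : B * |c₁ * c₂ - d₁ * d₂| ≤ B * δ := by gcongr
    have i3 : (3 * η + δ) * B ≤ 16 * (3 * η + δ) * (B * (d₁ * d₂)) := by
      have : B ≤ 16 * (B * (d₁ * d₂)) := by nlinarith
      calc (3 * η + δ) * B ≤ (3 * η + δ) * (16 * (B * (d₁ * d₂))) := by gcongr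
        _ = _ := by ring
    have e2 : 16 * (3 * η + InnerProductGeometry.angle h a + InnerProductGeometry.angle m b) =
        16 * (3 * η + δ) := by rw [hδ]; ring
    rw [e2]
    linarith
  · ring

end

/-! ### Bookkeeping of the error constants -/

/-- The size of the error in the concentration of the gradient, relative to the gradient. -/
noncomputable def relError (N₁ N₂ : ℕ) (E α : ℝ) : ℝ :=
  72 * (((N₁ + 1) ^ 2 + (N₂ + 1) ^ 2) * E ^ 2) / α

lemma relError_comm (N₁ N₂ : ℕ) (E α : ℝ) : relError N₁ N₂ E α = relError N₂ N₁ E α := by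
  rw [relError, relError, add_comm (((N₁ : ℝ) + 1) ^ 2)]

section

variable {N₁ N₂ : ℕ} {E α : ℝ}

lemma relError_nonneg (hα : 0 < α) : 0 ≤ relError N₁ N₂ E α := by
  unfold relError; positivity

lemma relError_mul_le (hE : 0 < E) (hα : 0 < α) :
    ((N₁ : ℝ) + 1) ^ 5 * relError N₁ N₂ E α ≤
      144 * (((N₁ : ℝ) + 1) ^ 7 * (N₂ + 1) ^ 2 * E) * (E / α) := by
  have hd : (1 : ℝ) ≤ (N₁ : ℝ) + 1 := by linarith [(Nat.cast_nonneg N₁ : (0 : ℝ) ≤ N₁)]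
  have hs : (1 : ℝ) ≤ (N₂ : ℝ) + 1 := by linarith [(Nat.cast_nonneg N₂ : (0 : ℝ) ≤ N₂)]
  rw [relError]
  generalize (N₁ : ℝ) + 1 = d at *
  generalize (N₂ : ℝ) + 1 = s at *
  have hd2 : 1 ≤ d ^ 2 := one_le_pow₀ hd
  have hs2 : 1 ≤ s ^ 2 := one_le_pow₀ hs
  have h1 : d ^ 2 + s ^ 2 ≤ 2 * (d ^ 2 * s ^ 2) := by nlinarith
  calc d ^ 5 * (72 * ((d ^ 2 + s ^ 2) * E ^ 2) / α)
      ≤ d ^ 5 * (72 * ((2 * (d ^ 2 * s ^ 2)) * E ^ 2) / α) := by gcongr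
    _ = _ := by ring

lemma relError_bounds (hE : 0 < E) (hα : 0 < α) (hα1 : α ≤ 1)
    (hs : 10000 * (((N₁ : ℝ) + 1) ^ 7 * (N₂ + 1) ^ 2 * E) ≤ α) :
    relError N₁ N₂ E α ≤ E / α ∧ relError N₁ N₂ E α ≤ 1 / 3 ∧
      48 * (((N₁ : ℝ) + 1) ^ 5 * relError N₁ N₂ E α) ≤ E / α := by
  have h1 := relError_mul_le (N₁ := N₁) (N₂ := N₂) hE hα
  have h0 := relError_nonneg (N₁ := N₁) (N₂ := N₂) (E := E) hα
  have hd : (1 : ℝ) ≤ ((N₁ : ℝ) + 1) ^ 5 :=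
    one_le_pow₀ (by linarith [(Nat.cast_nonneg N₁ : (0 : ℝ) ≤ N₁)])
  have he : 0 < E / α := by positivity
  -- The constant 10000 only has to exceed 144 · 48 = 6912.
  have hX : 144 * (((N₁ : ℝ) + 1) ^ 7 * (N₂ + 1) ^ 2 * E) * (E / α) ≤ 1 / 48 * (E / α) :=
    mul_le_mul_of_nonneg_right (by linarith) he.le
  have hle : relError N₁ N₂ E α ≤ ((N₁ : ℝ) + 1) ^ 5 * relError N₁ N₂ E α :=
    le_mul_of_one_le_left h0 hd
  refine ⟨by linarith, ?_, by linarith⟩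
  have hEα : E / α ≤ 1 := by
    rw [div_le_one hα]
    have hd7 : (1 : ℝ) ≤ ((N₁ : ℝ) + 1) ^ 7 :=
      one_le_pow₀ (by linarith [(Nat.cast_nonneg N₁ : (0 : ℝ) ≤ N₁)])
    have hs2 : (1 : ℝ) ≤ ((N₂ : ℝ) + 1) ^ 2 :=
      one_le_pow₀ (by linarith [(Nat.cast_nonneg N₂ : (0 : ℝ) ≤ N₂)])
    have : 1 * E ≤ ((N₁ : ℝ) + 1) ^ 7 * (N₂ + 1) ^ 2 * E :=
      mul_le_mul_of_nonneg_right (one_le_mul_of_one_le_of_one_le hd7 hs2) hE.le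
    linarith
  linarith

/-- The relative error carries E², E = ε^(1/4), so the square root is linear in E; and 2 · 48 · 144
≤ 120². -/
lemma relError_sqrt_bound (hE : 0 < E) (hα : 0 < α) (hα1 : α ≤ 1) {x : ℝ}
    (hx : x ^ 2 ≤ 2 * (48 * (((N₁ : ℝ) + 1) ^ 5 * relError N₁ N₂ E α))) :
    |x| ≤ 120 * (((N₁ : ℝ) + 1) ^ 4 * (N₂ + 1)) * (E / α) := by
  have h1 := relError_mul_le (N₁ := N₁) (N₂ := N₂) hE hα
  have hd : (1 : ℝ) ≤ (N₁ : ℝ) + 1 := by linarith [(Nat.cast_nonneg N₁ : (0 : ℝ) ≤ N₁)]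
  refine abs_le_of_sq_le_sq ?_ (by positivity)
  have h2 : x ^ 2 ≤ 14400 * (((N₁ : ℝ) + 1) ^ 7 * (N₂ + 1) ^ 2 * E) * (E / α) := by
    have : 0 ≤ (((N₁ : ℝ) + 1) ^ 7 * (N₂ + 1) ^ 2 * E) * (E / α) := by positivity
    linarith
  refine h2.trans ?_
  have h3 : E ≤ E / α := by rw [le_div_iff₀ hα]; exact mul_le_of_le_one_right hE.le hα1
  have h4 : ((N₁ : ℝ) + 1) ^ 7 ≤ ((N₁ : ℝ) + 1) ^ 8 := pow_le_pow_right₀ hd (by norm_num)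
  calc 14400 * (((N₁ : ℝ) + 1) ^ 7 * (N₂ + 1) ^ 2 * E) * (E / α)
      ≤ 14400 * (((N₁ : ℝ) + 1) ^ 8 * (N₂ + 1) ^ 2 * (E / α)) * (E / α) := by gcongr
    _ = _ := by ring

end

lemma angle_neg_smul_eq {n : ℕ} (h h₀ : Vec n) {c : ℝ} (hc : 0 < c) :
    InnerProductGeometry.angle h (-c • h₀) =
      |InnerProductGeometry.angle h h₀ - Real.pi| := by
  rw [neg_smul, InnerProductGeometry.angle_neg_right,
    InnerProductGeometry.angle_smul_right_of_pos _ _ hc, abs_sub_comm,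
    abs_of_nonneg (sub_nonneg.mpr (angle_mem h h₀).2)]

lemma angle_eq_abs {n : ℕ} (h h₀ : Vec n) :
    InnerProductGeometry.angle h h₀ = |InnerProductGeometry.angle h h₀ - 0| := by
  rw [sub_zero, abs_of_nonneg (angle_mem h h₀).1]

/-- A point at which both limiting partial gradients are small lies in one of the four hyperbolic
neighborhoods. -/
lemma mem_fourNhds {n p : ℕ} {N₁ N₂ : ℕ} {h h₀ : Vec n} {m m₀ : Vec p} {ε α : ℝ}
    (hh : h ≠ 0) (hm : m ≠ 0) (hε : 0 < ε) (hα : 0 < α) (hα1 : α ≤ 1)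
    (hN₁ : 1 ≤ N₁) (hN₂ : 1 ≤ N₂)
    (hs₁ : 10000 * (((N₁ : ℝ) + 1) ^ 7 * (N₂ + 1) ^ 2 * ε ^ (1 / 4 : ℝ)) ≤ α)
    (hs₂ : 10000 * (((N₂ : ℝ) + 1) ^ 7 * (N₁ + 1) ^ 2 * ε ^ (1 / 4 : ℝ)) ≤ α)
    (hg₁ : ‖gradField N₁ N₂ h₀ m₀ h m‖ ≤
      relError N₁ N₂ (ε ^ (1 / 4 : ℝ)) α * (‖m‖ * (‖h‖ * ‖m‖ + ‖h₀‖ * ‖m₀‖)))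
    (hg₂ : ‖gradField N₂ N₁ m₀ h₀ m h‖ ≤
      relError N₁ N₂ (ε ^ (1 / 4 : ℝ)) α * (‖h‖ * (‖m‖ * ‖h‖ + ‖m₀‖ * ‖h₀‖))) :
    (h, m) ∈ fourNhds 20000 (N₁ + 1) (N₂ + 1) ε α h₀ m₀ := by
  unfold fourNhds
  have hE : 0 < ε ^ (1 / 4 : ℝ) := Real.rpow_pos_of_pos hε _
  generalize ε ^ (1 / 4 : ℝ) = E at *
  obtain ⟨a1, a2, a3⟩ := relError_bounds hE hα hα1 hs₁
  obtain ⟨-, -, a4⟩ := relError_bounds hE hα hα1 hs₂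
  have a0 := relError_nonneg (N₁ := N₁) (N₂ := N₂) (E := E) hα
  obtain ⟨hb0, hab2⟩ := product_bounds hh hm a2 hg₁
  have D₁ := angle_dichotomy hh hm a0 hN₂ hb0 hab2 hg₁
  have D₂ := angle_dichotomy hm hh a0 hN₁ (by rwa [mul_comm])
    (by rwa [mul_comm, mul_comm ‖m₀‖]) hg₂
  have key := fun (a : Vec n) (b : Vec p) (φ ψ r : ℝ) =>
    mem_hyperbolicNhd_of_angles (a := a) (b := b) (φ := φ) (ψ := ψ) (r := r)
      hh hm a2 a0 hN₁ hN₂ hg₁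
  rw [relError_comm] at D₂
  have hd : (1 : ℝ) ≤ (N₁ : ℝ) + 1 := by linarith [(Nat.cast_nonneg N₁ : (0 : ℝ) ≤ N₁)]
  have hs : (1 : ℝ) ≤ (N₂ : ℝ) + 1 := by linarith [(Nat.cast_nonneg N₂ : (0 : ℝ) ≤ N₂)]
  have D₁' : |InnerProductGeometry.angle h h₀ - 0| ≤ E / α ∨
      |InnerProductGeometry.angle h h₀ - Real.pi| ≤
        120 * (((N₁ : ℝ) + 1) ^ 4 * (N₂ + 1)) * (E / α) := by
    rw [← angle_eq_abs, abs_sub_comm]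
    exact D₁.imp (fun h => h.trans a3) (relError_sqrt_bound hE hα hα1)
  have D₂' : |InnerProductGeometry.angle m m₀ - 0| ≤ E / α ∨
      |InnerProductGeometry.angle m m₀ - Real.pi| ≤
        120 * (((N₂ : ℝ) + 1) ^ 4 * (N₁ + 1)) * (E / α) := by
    rw [← angle_eq_abs, abs_sub_comm]
    exact D₂.imp (fun h => h.trans a4) (relError_sqrt_bound hE hα hα1)
  have hρ₁ := rho_pos (show 2 ≤ N₁ + 1 by omega)
  have hρ₂ := rho_pos (show 2 ≤ N₂ + 1 by omega)
  have hc₁ := rho_eq_cos (show 1 ≤ N₁ + 1 by omega)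
  have hc₂ := rho_eq_cos (show 1 ≤ N₂ + 1 by omega)
  have z0 : (0 : ℝ) ∈ Set.Icc 0 Real.pi := ⟨le_rfl, Real.pi_pos.le⟩
  have zp : Real.pi ∈ Set.Icc 0 Real.pi := ⟨Real.pi_pos.le, le_rfl⟩
  have he : 0 < E / α := by positivity
  have hpow : ∀ {i j i' j' : ℕ}, i ≤ i' → j ≤ j' →
      ((N₁ : ℝ) + 1) ^ i * ((N₂ : ℝ) + 1) ^ j * (E / α) ≤
        ((N₁ : ℝ) + 1) ^ i' * ((N₂ : ℝ) + 1) ^ j' * (E / α) := by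
    intro i j i' j' hi hj
    have := pow_le_pow_right₀ hd hi
    have := pow_le_pow_right₀ hs hj
    gcongr
  have e0 : ∀ i j : ℕ, E / α ≤ ((N₁ : ℝ) + 1) ^ i * ((N₂ : ℝ) + 1) ^ j * (E / α) := fun i j => by
    simpa using hpow (Nat.zero_le i) (Nat.zero_le j)
  have er : ∀ i j : ℕ, (20000 * ((N₁ + 1 : ℕ) : ℝ) ^ i * ((N₂ + 1 : ℕ) : ℝ) ^ j * E * α⁻¹) =
      20000 * (((N₁ : ℝ) + 1) ^ i * ((N₂ : ℝ) + 1) ^ j * (E / α)) := fun i j => by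
    push_cast; ring
  simp only [er]
  -- Target angles (0,0), (0,π), (π,0), (π,π). An angle π contributes the cosine ρ to the product of
  -- the norms, which fixes the scale of the curve. In the worst case the radius constant is 240 +
  -- 81 · 240 = 19680 ≤ 20000.
  rcases D₁' with D₁ | D₁ <;> rcases D₂' with D₂ | D₂
  · refine Or.inl (Or.inl (Or.inl (key _ _ 0 0 _ z0 z0 ?_ (angle_eq_abs _ _) (angle_eq_abs _ _) ?_)))
    · rw [iterate_angleMap_zero, iterate_angleMap_zero, Real.cos_zero]; ring
    · linarith [e0 3 3]
  · refine Or.inl (Or.inr (key _ _ 0 Real.pi _ z0 zp ?_ ?_ ?_ ?_))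
    · rw [iterate_angleMap_zero, Real.cos_zero, ← hc₂, norm_neg, norm_smul,
        Real.norm_of_nonneg hρ₂.le]
      ring
    · rw [InnerProductGeometry.angle_smul_right_of_pos _ _ hρ₂]; exact angle_eq_abs _ _
    · rw [← angle_neg_smul_eq _ _ one_pos, neg_smul, one_smul]
    · have := hpow (i := 1) (j := 4) (i' := 3) (j' := 8) (by norm_num) (by norm_num)
      rw [pow_one] at this
      linarith [e0 3 8]
  · refine Or.inl (Or.inl (Or.inr (key _ _ Real.pi 0 _ zp z0 ?_ ?_ (angle_eq_abs _ _) ?_)))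
    · rw [iterate_angleMap_zero, Real.cos_zero, ← hc₁, neg_smul, norm_neg, norm_smul,
        Real.norm_of_nonneg hρ₁.le]
      ring
    · exact angle_neg_smul_eq _ _ hρ₁
    · have := hpow (i := 4) (j := 1) (i' := 8) (j' := 3) (by norm_num) (by norm_num)
      rw [pow_one] at this
      linarith [e0 8 3]
  · refine Or.inr (key _ _ Real.pi Real.pi _ zp zp ?_ ?_ ?_ ?_)
    · rw [← hc₁, ← hc₂, neg_smul, norm_neg, norm_neg, norm_smul,
        Real.norm_of_nonneg (mul_pos hρ₁ hρ₂).le]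
      ring
    · exact angle_neg_smul_eq _ _ (mul_pos hρ₁ hρ₂)
    · rw [← angle_neg_smul_eq _ _ one_pos, neg_smul, one_smul]
    · have h1 := hpow (i := 4) (j := 1) (i' := 8) (j' := 8) (by norm_num) (by norm_num)
      have h2 := hpow (i := 1) (j := 4) (i' := 8) (j' := 8) (by norm_num) (by norm_num)
      rw [pow_one] at h1 h2
      linarith [e0 8 8]

/-! ### Continuity and local structure of networks -/

lemma lipschitzWith_coordinatewise {l : ℕ} {φ : Fin l → ℝ → ℝ}
    (hφ : ∀ i a b, |φ i a - φ i b| ≤ |a - b|) :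
    LipschitzWith 1 (fun s : Vec l => (WithLp.toLp 2 fun i => φ i (s i) : Vec l)) := by
  refine LipschitzWith.of_dist_le_mul fun s t => ?_
  rw [NNReal.coe_one, one_mul, EuclideanSpace.dist_eq, EuclideanSpace.dist_eq]
  refine Real.sqrt_le_sqrt (Finset.sum_le_sum fun i _ => ?_)
  rw [Real.dist_eq, Real.dist_eq]
  exact pow_le_pow_left₀ (abs_nonneg _) (hφ i _ _) 2

lemma abs_max_zero_sub_le (a b : ℝ) : |max a 0 - max b 0| ≤ |a - b| :=
  abs_max_sub_max_le_abs a b 0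

lemma exists_lipschitzWith_act {l n : ℕ} (V : Matrix (Fin l) (Fin n) ℝ) :
    ∃ K, LipschitzWith K (act V) :=
  ⟨_, (LinearMap.toContinuousLinearMap (act V)).lipschitz⟩

lemma continuous_layer {l n : ℕ} (V : Matrix (Fin l) (Fin n) ℝ) : Continuous (layer V) := by
  obtain ⟨K, hK⟩ := exists_lipschitzWith_act V
  exact ((lipschitzWith_coordinatewise (φ := fun _ a => max a 0)
    fun _ => abs_max_zero_sub_le).comp hK).continuous

lemma continuous_innerNet {n : ℕ → ℕ} (W : ∀ i, Matrix (Fin (n (i + 1))) (Fin (n i)) ℝ) (k : ℕ) :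
    Continuous (innerNet W k) := by
  induction k with
  | zero => exact continuous_id
  | succ k ih => exact (continuous_layer _).comp ih

lemma continuous_generator {n : ℕ → ℕ} {l : ℕ} (d : ℕ)
    (W : ∀ i, Matrix (Fin (n (i + 1))) (Fin (n i)) ℝ) (V : Matrix (Fin l) (Fin (n (d - 1))) ℝ) :
    Continuous (generator d W V) :=
  (continuous_layer V).comp (continuous_innerNet W _)

/-- Near `x`, `F` is the sum of `F x` and a positively homogeneous Lipschitz function of the
displacement. -/
def HasConicGerm {n l : ℕ} (F : Vec n → Vec l) (x : Vec n) : Prop :=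
  ∃ L : Vec n → Vec l, (∃ K, LipschitzWith K L) ∧ (∀ t : ℝ, 0 < t → ∀ z, L (t • z) = t • L z) ∧
    ∀ᶠ z in 𝓝 0, F (x + z) = F x + L z

lemma HasConicGerm.map_zero_eq {n l : ℕ} {L : Vec n → Vec l}
    (hL : ∀ t : ℝ, 0 < t → ∀ z, L (t • z) = t • L z) : L 0 = 0 := by
  have h := hL 2 two_pos 0
  rw [smul_zero, two_smul] at h
  simpa using h

lemma HasConicGerm.comp {n k l : ℕ} {F : Vec k → Vec l} {G : Vec n → Vec k} {x : Vec n}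
    (hF : HasConicGerm F (G x)) (hG : HasConicGerm G x) : HasConicGerm (F ∘ G) x := by
  obtain ⟨L, ⟨K, hK⟩, hL, hLe⟩ := hF
  obtain ⟨L', ⟨K', hK'⟩, hL', hLe'⟩ := hG
  refine ⟨L ∘ L', ⟨_, hK.comp hK'⟩, fun t ht z => ?_, ?_⟩
  · simp only [Function.comp, hL' t ht, hL t ht]
  · have h1 : Tendsto L' (𝓝 0) (𝓝 0) := by
      have := hK'.continuous.tendsto 0
      rwa [HasConicGerm.map_zero_eq hL'] at this
    filter_upwards [hLe', h1.eventually hLe] with z h2 h3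
    simp only [Function.comp, h2, h3]

/-- Away from 0 the function is locally affine, and at 0 it is itself positively homogeneous. -/
lemma relu_germ (a : ℝ) : ∃ φ : ℝ → ℝ, (∀ s t, |φ s - φ t| ≤ |s - t|) ∧
    (∀ t : ℝ, 0 < t → ∀ s, φ (t * s) = t * φ s) ∧
    ∀ᶠ s in 𝓝 0, max (a + s) 0 = max a 0 + φ s := by
  rcases lt_trichotomy a 0 with h | h | h
  · refine ⟨fun _ => 0, by simp, by simp, ?_⟩
    filter_upwards [Iio_mem_nhds (show (0 : ℝ) < -a by linarith)] with s hs
    rw [Set.mem_Iio] at hs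
    rw [max_eq_right h.le, max_eq_right (by linarith), add_zero]
  · subst h
    refine ⟨fun s => max s 0, abs_max_zero_sub_le, fun t ht s => ?_, ?_⟩
    · rw [mul_max_of_nonneg _ _ ht.le, mul_zero]
    · simp
  · refine ⟨fun s => s, by simp, by simp, ?_⟩
    filter_upwards [Ioi_mem_nhds (show -a < (0 : ℝ) by linarith)] with s hs
    rw [Set.mem_Ioi] at hs
    rw [max_eq_left h.le, max_eq_left (by linarith)]

lemma hasConicGerm_layer {l n : ℕ} (V : Matrix (Fin l) (Fin n) ℝ) (x : Vec n) :
    HasConicGerm (layer V) x := by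
  choose φ h1 h2 h3 using fun i => relu_germ (act V x i)
  obtain ⟨K, hK⟩ := exists_lipschitzWith_act V
  refine ⟨fun z => WithLp.toLp 2 fun i => φ i (act V z i),
    ⟨_, (lipschitzWith_coordinatewise h1).comp hK⟩, fun t ht z => ?_, ?_⟩
  · ext i
    simp [map_smul, h2 i t ht]
  · have hc : Tendsto (act V) (𝓝 0) (𝓝 0) := by
      have := hK.continuous.tendsto 0
      rwa [map_zero] at this
    have hi : ∀ i, ∀ᶠ z in 𝓝 (0 : Vec n), max (act V x i + act V z i) 0 =
        max (act V x i) 0 + φ i (act V z i) := fun i => by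
      have h4 : Tendsto (fun z => act V z i) (𝓝 0) (𝓝 0) :=
        ((EuclideanSpace.proj (𝕜 := ℝ) i).continuous.tendsto (0 : Vec l)).comp hc
      exact h4.eventually (h3 i)
    filter_upwards [eventually_all.mpr hi] with z hz
    ext i
    have := hz i
    rw [← PiLp.add_apply, ← map_add] at this
    exact this

lemma hasConicGerm_innerNet {n : ℕ → ℕ} (W : ∀ i, Matrix (Fin (n (i + 1))) (Fin (n i)) ℝ) (k : ℕ)
    (x : Vec (n 0)) : HasConicGerm (innerNet W k) x := by
  induction k with
  | zero =>
    exact ⟨id, ⟨1, LipschitzWith.id⟩, fun _ _ _ => rfl, Eventually.of_forall fun _ => rfl⟩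
  | succ k ih => exact (hasConicGerm_layer (W k) (innerNet W k x)).comp ih

lemma hasConicGerm_generator {n : ℕ → ℕ} {l : ℕ} (d : ℕ)
    (W : ∀ i, Matrix (Fin (n (i + 1))) (Fin (n i)) ℝ) (V : Matrix (Fin l) (Fin (n (d - 1))) ℝ)
    (x : Vec (n 0)) : HasConicGerm (generator d W V) x :=
  (hasConicGerm_layer V _).comp (hasConicGerm_innerNet W _ x)

/-- By Rademacher's theorem the Lipschitz germ L is differentiable at some w. Homogeneity carries
this to every δw with δ > 0, and near x the function F is a translate of L. -/
lemma HasConicGerm.exists_direction {n l : ℕ} {F : Vec n → Vec l} {x : Vec n}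
    (hF : HasConicGerm F x) : ∃ w, ∀ᶠ δ : ℝ in 𝓝[>] 0, DifferentiableAt ℝ F (x + δ • w) := by
  obtain ⟨L, ⟨K, hK⟩, hL, hLe⟩ := hF
  obtain ⟨w, hw⟩ := (hK.ae_differentiableAt (μ := MeasureTheory.volume)).exists
  refine ⟨w, ?_⟩
  have h0 : Tendsto (fun δ : ℝ => δ • w) (𝓝[>] 0) (𝓝 0) := by
    have : Tendsto (fun δ : ℝ => δ • w) (𝓝 0) (𝓝 ((0 : ℝ) • w)) :=
      (continuous_id.smul continuous_const).tendsto 0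
    rw [zero_smul] at this
    exact this.mono_left nhdsWithin_le_nhds
  filter_upwards [h0.eventually hLe.eventually_nhds, self_mem_nhdsWithin] with δ hδ hpos
  rw [Set.mem_Ioi] at hpos
  have h1 : DifferentiableAt ℝ L (δ • w) := by
    have e : L = fun z => δ • L (δ⁻¹ • z) := by
      funext z
      rw [← hL δ hpos, smul_smul, mul_inv_cancel₀ hpos.ne', one_smul]
    rw [e]
    refine DifferentiableAt.const_smul ?_ δ
    have hw' : DifferentiableAt ℝ L (δ⁻¹ • δ • w) := by
      rwa [smul_smul, inv_mul_cancel₀ hpos.ne', one_smul]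
    exact hw'.comp (δ • w) (differentiableAt_id.const_smul δ⁻¹)
  have h2 : DifferentiableAt ℝ (fun x' => F x + L (x' - x)) (x + δ • w) := by
    refine DifferentiableAt.const_add _ ?_
    have h1' : DifferentiableAt ℝ L ((x + δ • w) - x) := by rwa [add_sub_cancel_left]
    exact h1'.comp (x + δ • w) (differentiableAt_id.sub_const x)
  refine h2.congr_of_eventuallyEq ?_
  have h3 : Tendsto (fun x' => x' - x) (𝓝 (x + δ • w)) (𝓝 (δ • w)) := by
    have := (continuous_sub_right x).tendsto (x + δ • w)
    rwa [add_sub_cancel_left] at this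
  filter_upwards [h3.eventually hδ] with x' hx'
  rw [← hx', add_sub_cancel]

/-! ### Constancy of the linear piece along a two-scale perturbation -/

/-- The filter of pairs `(δ, η)` of positive numbers with `δ` small and `η` small depending on
`δ`. -/
noncomputable abbrev twoScale : Filter (ℝ × ℝ) := (𝓝[>] (0 : ℝ)).curry (𝓝[>] (0 : ℝ))

instance neBot_twoScale : twoScale.NeBot := by
  refine ⟨fun h => ?_⟩
  have h1 : ∀ᶠ _q in twoScale, False := by rw [h]; exact eventually_bot
  rw [eventually_curry_iff] at h1
  obtain ⟨δ, hδ⟩ := h1.exists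
  exact hδ.exists.elim fun _ h => h

lemma eventually_pos_of_pos {A : ℝ} (B : ℝ) (hA : 0 < A) : ∀ᶠ δ : ℝ in 𝓝[>] 0, 0 < A + δ * B := by
  have : Tendsto (fun δ : ℝ => A + δ * B) (𝓝 0) (𝓝 (A + 0 * B)) :=
    (by fun_prop : Continuous fun δ : ℝ => A + δ * B).tendsto 0
  rw [zero_mul, add_zero] at this
  exact (this.mono_left nhdsWithin_le_nhds).eventually (lt_mem_nhds hA)

lemma eventually_sign_const (A B : ℝ) :
    (∀ᶠ δ : ℝ in 𝓝[>] 0, 0 < A + δ * B) ∨ (∀ᶠ δ : ℝ in 𝓝[>] 0, A + δ * B < 0) ∨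
      (A = 0 ∧ B = 0) := by
  rcases lt_trichotomy A 0 with h | h | h
  · right; left
    filter_upwards [eventually_pos_of_pos (-B) (neg_pos.mpr h)] with δ hδ
    linarith
  · subst h
    rcases lt_trichotomy B 0 with h | h | h
    · right; left
      filter_upwards [self_mem_nhdsWithin] with δ hδ
      rw [zero_add]
      exact mul_neg_of_pos_of_neg hδ h
    · exact Or.inr (Or.inr ⟨rfl, h⟩)
    · left
      filter_upwards [self_mem_nhdsWithin] with δ hδ
      rw [zero_add]
      exact mul_pos hδ h
  · exact Or.inl (eventually_pos_of_pos B h)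

/-- At two scales the sign is decided lexicographically: by A, then B, then C. -/
lemma twoScale_sign_const (A B C : ℝ) :
    ∃ b : Prop, ∀ᶠ q in twoScale, (0 < A + q.1 * B + q.2 * C ↔ b) := by
  simp only [eventually_curry_iff]
  rcases eventually_sign_const A B with h | h | ⟨rfl, rfl⟩
  · refine ⟨True, ?_⟩
    filter_upwards [h] with δ hδ
    filter_upwards [eventually_pos_of_pos C hδ] with η hη
    exact iff_true_intro hη
  · refine ⟨False, ?_⟩
    filter_upwards [h] with δ hδ
    filter_upwards [eventually_pos_of_pos (-C) (neg_pos.mpr hδ)] with η hη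
    exact iff_false_intro (by linarith)
  · refine ⟨0 < C, Eventually.of_forall fun δ => ?_⟩
    filter_upwards [self_mem_nhdsWithin] with η hη
    rw [mul_zero, add_zero, zero_add]
    exact mul_pos_iff_of_pos_left hη

lemma twoScale_posPart_const {l n : ℕ} (V : Matrix (Fin l) (Fin n) ℝ) (a b c : Vec n) :
    ∃ P, ∀ᶠ q in twoScale, posPart V (a + q.1 • b + q.2 • c) = P := by
  classical
  choose s hs using fun i => twoScale_sign_const ((V *ᵥ a.ofLp) i) ((V *ᵥ b.ofLp) i)
    ((V *ᵥ c.ofLp) i)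
  refine ⟨Matrix.diagonal (fun i => if s i then (1 : ℝ) else 0) * V, ?_⟩
  filter_upwards [eventually_all.mpr hs] with q hq
  rw [posPart, posDiag]
  congr 2
  funext i
  refine if_congr ?_ rfl rfl
  rw [← hq i]
  simp [Matrix.mulVec_add, Matrix.mulVec_smul]

/-- Once the earlier layers have a fixed piece M, the input of the next layer is Mh + δMw + ηMz,
again of the two-scale form. -/
lemma twoScale_pattern_const {n : ℕ → ℕ} (W : ∀ i, Matrix (Fin (n (i + 1))) (Fin (n i)) ℝ) (k : ℕ)
    (h w z : Vec (n 0)) : ∃ M, ∀ᶠ q in twoScale, pattern W k (h + q.1 • w + q.2 • z) = M := by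
  induction k with
  | zero => exact ⟨1, Eventually.of_forall fun _ => rfl⟩
  | succ k ih =>
    obtain ⟨M, hM⟩ := ih
    obtain ⟨P, hP⟩ := twoScale_posPart_const (W k) (act M h) (act M w) (act M z)
    refine ⟨P * M, ?_⟩
    filter_upwards [hM, hP] with q hq hq'
    rw [pattern, innerNet_eq, hq, map_add, map_add, map_smul, map_smul, hq']

lemma twoScale_fullPattern_const {n : ℕ → ℕ} {l : ℕ} (N : ℕ)
    (W : ∀ i, Matrix (Fin (n (i + 1))) (Fin (n i)) ℝ) (V : Matrix (Fin l) (Fin (n N)) ℝ)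
    (h w z : Vec (n 0)) :
    ∃ M, ∀ᶠ q in twoScale, fullPattern N W V (h + q.1 • w + q.2 • z) = M := by
  obtain ⟨M, hM⟩ := twoScale_pattern_const W N h w z
  obtain ⟨P, hP⟩ := twoScale_posPart_const V (act M h) (act M w) (act M z)
  refine ⟨P * M, ?_⟩
  filter_upwards [hM, hP] with q hq hq'
  rw [fullPattern, innerNet_eq, hq, map_add, map_add, map_smul, map_smul, hq']

lemma tendsto_smul_nhdsGT_zero {n : ℕ} (x w : Vec n) :
    Tendsto (fun δ : ℝ => x + δ • w) (𝓝[>] 0) (𝓝 x) := by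
  have : Tendsto (fun δ : ℝ => x + δ • w) (𝓝 0) (𝓝 (x + (0 : ℝ) • w)) :=
    (by fun_prop : Continuous fun δ : ℝ => x + δ • w).tendsto 0
  rw [zero_smul, add_zero] at this
  exact this.mono_left nhdsWithin_le_nhds

lemma tendsto_twoScale {n : ℕ} (h w z : Vec n) :
    Tendsto (fun q : ℝ × ℝ => h + q.1 • w + q.2 • z) twoScale (𝓝 h) := by
  have : Tendsto (fun q : ℝ × ℝ => h + q.1 • w + q.2 • z) (𝓝 (0, 0))
      (𝓝 (h + (0 : ℝ) • w + (0 : ℝ) • z)) :=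
    (by fun_prop : Continuous fun q : ℝ × ℝ => h + q.1 • w + q.2 • z).tendsto (0, 0)
  rw [zero_smul, zero_smul, add_zero, add_zero, nhds_prod_eq] at this
  exact this.mono_left (curry_le_prod.trans (prod_mono nhdsWithin_le_nhds nhdsWithin_le_nhds))

/-- The piece M is that of the perturbed points with η > 0; by continuity it also computes the value
at h + δw, whose own pattern may differ. -/
lemma generator_twoScale {n : ℕ → ℕ} {l : ℕ} {N : ℕ}
    {W : ∀ i, Matrix (Fin (n (i + 1))) (Fin (n i)) ℝ} {V : Matrix (Fin l) (Fin (n N)) ℝ}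
    {h w z : Vec (n 0)} {M : Matrix (Fin l) (Fin (n 0)) ℝ}
    (hM : ∀ᶠ q in twoScale, fullPattern N W V (h + q.1 • w + q.2 • z) = M) :
    ∀ᶠ δ : ℝ in 𝓝[>] 0, ∀ᶠ η : ℝ in 𝓝[>] 0, generator (N + 1) W V (h + δ • w + η • z) =
      generator (N + 1) W V (h + δ • w) + η • act M z := by
  rw [eventually_curry_iff] at hM
  filter_upwards [hM] with δ hδ
  have e : ∀ᶠ η : ℝ in 𝓝[>] 0, generator (N + 1) W V (h + δ • w + η • z) =
      act M (h + δ • w + η • z) := by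
    filter_upwards [hδ] with η hη
    rw [generator_eq, hη]
  have e0 : generator (N + 1) W V (h + δ • w) = act M (h + δ • w) := by
    have t := tendsto_smul_nhdsGT_zero (h + δ • w) z
    obtain ⟨K, hK⟩ := exists_lipschitzWith_act M
    refine tendsto_nhds_unique
      (((continuous_generator (N + 1) W V).tendsto _).comp t) ?_
    refine (((hK.continuous.tendsto _).comp t)).congr' ?_
    filter_upwards [e] with η hη
    exact hη.symm
  filter_upwards [e] with η hη
  rw [hη, e0, map_add, map_smul]

/-! ### One-sided derivatives and limits of gradients of the risk -/

lemma risk_swap {n p l : ℕ} (G₁ : Vec n → Vec l) (G₂ : Vec p → Vec l) (h₀ : Vec n) (m₀ : Vec p) :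
    (fun m h => risk G₁ G₂ h₀ m₀ h m) = risk G₂ G₁ m₀ h₀ := by
  funext m h
  rw [risk, risk, hadamard_comm (G₁ h₀), hadamard_comm (G₁ h)]

lemma inner_hadamard {l : ℕ} (a b c : Vec l) :
    inner ℝ (hadamard a b) c = inner ℝ a (hadamard c b) := by
  simp only [PiLp.inner_apply, hadamard_apply, RCLike.inner_apply, conj_trivial]
  exact Finset.sum_congr rfl fun i _ => by ring

lemma continuous_hadamard {l : ℕ} : Continuous fun q : Vec l × Vec l => hadamard q.1 q.2 := by
  unfold hadamard
  fun_prop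

lemma continuous_residual {l : ℕ} (y₀ : Vec l) :
    Continuous fun q : Vec l × Vec l => residual y₀ q.1 q.2 := by
  unfold residual hadamard
  fun_prop

lemma tendsto_residual {ι : Type*} {L : Filter ι} {l : ℕ} (y₀ : Vec l) {a b : ι → Vec l}
    {x y : Vec l} (ha : Tendsto a L (𝓝 x)) (hb : Tendsto b L (𝓝 y)) :
    Tendsto (fun i => residual y₀ (a i) (b i)) L (𝓝 (residual y₀ x y)) := by
  have h1 := (continuous_residual y₀).tendsto (x, y)
  have h2 := h1.comp (ha.prodMk_nhds hb)
  exact h2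

lemma half_norm_sq_diff_quotient {l : ℕ} (a b : Vec l) {t : ℝ} (ht : t ≠ 0) :
    (1 / 2 * ‖a - t • b‖ ^ 2 - 1 / 2 * ‖a‖ ^ 2) / t = -inner ℝ a b + t / 2 * ‖b‖ ^ 2 := by
  rw [norm_sub_sq_real, inner_smul_right, norm_smul, mul_pow, Real.norm_eq_abs, sq_abs]
  field_simp
  ring

section

variable {n p l : ℕ} {G₁ : Vec n → Vec l} {G₂ : Vec p → Vec l} {h₀ : Vec n} {m₀ : Vec p}

lemma hasOneSidedDeriv_risk_left {h z : Vec n} (m : Vec p) {v : Vec l}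
    (hG : ∀ᶠ η : ℝ in 𝓝[>] 0, G₁ (h + η • z) = G₁ h + η • v) :
    HasOneSidedDeriv (risk G₁ G₂ h₀ m₀) h m z 0
      (inner ℝ (residual (hadamard (G₁ h₀) (G₂ m₀)) (G₁ h) (G₂ m)) v) := by
  unfold HasOneSidedDeriv
  set a := hadamard (G₁ h₀) (G₂ m₀) - hadamard (G₁ h) (G₂ m) with ha
  set b := hadamard v (G₂ m) with hb
  have e : inner ℝ (residual (hadamard (G₁ h₀) (G₂ m₀)) (G₁ h) (G₂ m)) v = -inner ℝ a b := by
    rw [residual, inner_hadamard, ← hb, ← inner_neg_left, ha, neg_sub]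
  rw [e]
  have h1 : Tendsto (fun t : ℝ => -inner ℝ a b + t / 2 * ‖b‖ ^ 2) (𝓝[>] 0) (𝓝 (-inner ℝ a b)) := by
    have : Tendsto (fun t : ℝ => -inner ℝ a b + t / 2 * ‖b‖ ^ 2) (𝓝 0)
        (𝓝 (-inner ℝ a b + 0 / 2 * ‖b‖ ^ 2)) :=
      (by fun_prop : Continuous fun t : ℝ => -inner ℝ a b + t / 2 * ‖b‖ ^ 2).tendsto 0
    rw [zero_div, zero_mul, add_zero] at this
    exact this.mono_left nhdsWithin_le_nhds
  refine h1.congr' ?_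
  filter_upwards [hG, self_mem_nhdsWithin] with t ht hpos
  rw [Set.mem_Ioi] at hpos
  rw [← half_norm_sq_diff_quotient a b hpos.ne', risk, risk, smul_zero, add_zero, ht]
  have : hadamard (G₁ h₀) (G₂ m₀) - hadamard (G₁ h + t • v) (G₂ m) = a - t • b := by
    rw [ha, hb]
    ext i
    simp only [PiLp.sub_apply, hadamard_apply, PiLp.add_apply, PiLp.smul_apply, smul_eq_mul]
    ring
  rw [this]

/-- By homogeneity f(h + tx, ty) = ½‖y₀ - t G₁(h + tx) ⊙ G₂(y)‖², with y₀ = G₁(h₀) ⊙ G₂(m₀). Only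
continuity of G₁ is needed, and the derivative is -⟨y₀, G₁(h) ⊙ G₂(y)⟩. -/
lemma hasOneSidedDeriv_risk_axis (hG₁ : Continuous G₁) (h₁0 : ∀ h i, 0 ≤ G₁ h i)
    (h₂0 : ∀ m i, 0 ≤ G₂ m i) (hG₂ : ∀ t : ℝ, 0 < t → ∀ m, G₂ (t • m) = t • G₂ m)
    (hz : G₂ 0 = 0) (h x : Vec n) (y : Vec p) :
    ∃ D ≤ 0, HasOneSidedDeriv (risk G₁ G₂ h₀ m₀) h 0 x y D := by
  set a := hadamard (G₁ h₀) (G₂ m₀) with ha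
  refine ⟨-inner ℝ a (hadamard (G₁ h) (G₂ y)), ?_, ?_⟩
  · rw [neg_nonpos]
    simp only [PiLp.inner_apply, hadamard_apply, ha, RCLike.inner_apply, conj_trivial]
    exact Finset.sum_nonneg fun i _ => mul_nonneg (mul_nonneg (h₁0 _ _) (h₂0 _ _))
      (mul_nonneg (h₁0 _ _) (h₂0 _ _))
  · unfold HasOneSidedDeriv
    have hc : Continuous fun t : ℝ => hadamard (G₁ (h + t • x)) (G₂ y) :=
      continuous_hadamard.comp ((hG₁.comp (by fun_prop)).prodMk continuous_const)
    have h1 : Tendsto (fun t : ℝ => -inner ℝ a (hadamard (G₁ (h + t • x)) (G₂ y)) +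
        t / 2 * ‖hadamard (G₁ (h + t • x)) (G₂ y)‖ ^ 2) (𝓝[>] 0)
        (𝓝 (-inner ℝ a (hadamard (G₁ h) (G₂ y)))) := by
      have : Tendsto (fun t : ℝ => -inner ℝ a (hadamard (G₁ (h + t • x)) (G₂ y)) +
        t / 2 * ‖hadamard (G₁ (h + t • x)) (G₂ y)‖ ^ 2) (𝓝 0)
        (𝓝 (-inner ℝ a (hadamard (G₁ (h + (0 : ℝ) • x)) (G₂ y)) +
          0 / 2 * ‖hadamard (G₁ (h + (0 : ℝ) • x)) (G₂ y)‖ ^ 2)) :=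
        (by fun_prop : Continuous fun t : ℝ => -inner ℝ a (hadamard (G₁ (h + t • x)) (G₂ y)) +
          t / 2 * ‖hadamard (G₁ (h + t • x)) (G₂ y)‖ ^ 2).tendsto 0
      rw [zero_div, zero_mul, add_zero, zero_smul, add_zero] at this
      exact this.mono_left nhdsWithin_le_nhds
    refine h1.congr' ?_
    filter_upwards [self_mem_nhdsWithin] with t hpos
    rw [Set.mem_Ioi] at hpos
    rw [← half_norm_sq_diff_quotient _ _ hpos.ne', risk, risk, zero_add, hG₂ t hpos, hz,
      hadamard_zero_right, sub_zero]
    have : hadamard (G₁ (h + t • x)) (t • G₂ y) = t • hadamard (G₁ (h + t • x)) (G₂ y) := by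
      ext i
      simp only [hadamard_apply, PiLp.smul_apply, smul_eq_mul]
      ring
    rw [this]

lemma tendsto_slope_gradient {g : Vec n → ℝ} {x : Vec n} (hg : DifferentiableAt ℝ g x)
    (z : Vec n) : Tendsto (fun t : ℝ => (g (x + t • z) - g x) / t) (𝓝[>] 0)
      (𝓝 (inner ℝ (gradient g x) z)) := by
  have d := (hg.hasGradientAt.hasFDerivAt.hasLineDerivAt z).tendsto_slope_zero_right
  rw [InnerProductSpace.toDual_apply_apply] at d
  refine d.congr fun t => ?_
  rw [smul_eq_mul, div_eq_inv_mul]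

/-- In finite dimension weak convergence is convergence: the limit is assembled from its pairings
with the basis vectors. -/
lemma exists_inner_eq_of_tendsto {ι : Type*} {L : Filter ι} [L.NeBot] {g : ι → Vec n}
    {c : Vec n → ℝ} (hc : ∀ z, Tendsto (fun i => inner ℝ (g i) z) L (𝓝 (c z))) :
    ∃ v, Tendsto g L (𝓝 v) ∧ ∀ z, inner ℝ v z = c z := by
  set v : Vec n := WithLp.toLp 2 fun j => c (EuclideanSpace.single j 1) with hv
  have ht : Tendsto g L (𝓝 v) := by
    have h : Tendsto (fun i => (g i).ofLp) L (𝓝 v.ofLp) := by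
      rw [tendsto_pi_nhds]
      intro j
      have := hc (EuclideanSpace.single j 1)
      simpa [EuclideanSpace.inner_single_right] using this
    exact ((PiLp.continuous_toLp 2 _).tendsto v.ofLp).comp h
  exact ⟨v, ht, fun z => tendsto_nhds_unique (ht.inner tendsto_const_nhds) (hc z)⟩

/-- Differentiability of f does not give that of G₁, so the gradient is read off from one-sided
slopes, one direction z at a time; the linear piece T z may depend on z. -/
lemma exists_limitGrad_left (hG₁ : Continuous G₁) (hG₂ : Continuous G₂) {h w₁ : Vec n}
    {m w₂ : Vec p} {T : Vec n → Vec l}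
    (hT : ∀ z, ∀ᶠ δ : ℝ in 𝓝[>] 0, ∀ᶠ η : ℝ in 𝓝[>] 0,
      G₁ (h + δ • w₁ + η • z) = G₁ (h + δ • w₁) + η • T z)
    (hd : ∀ᶠ δ : ℝ in 𝓝[>] 0, DifferentiableAt ℝ
      (fun h' => risk G₁ G₂ h₀ m₀ h' (m + δ • w₂)) (h + δ • w₁)) :
    ∃ v, IsLimitGradLeft (risk G₁ G₂ h₀ m₀) h m w₁ w₂ v ∧
      ∀ z, inner ℝ v z =
        inner ℝ (residual (hadamard (G₁ h₀) (G₂ m₀)) (G₁ h) (G₂ m)) (T z) := by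
  refine exists_inner_eq_of_tendsto fun z => ?_
  set y₀ := hadamard (G₁ h₀) (G₂ m₀) with hy₀
  have hr : Tendsto (fun δ : ℝ => residual y₀ (G₁ (h + δ • w₁)) (G₂ (m + δ • w₂))) (𝓝[>] 0)
      (𝓝 (residual y₀ (G₁ h) (G₂ m))) := by
    have h1 : Tendsto (fun δ : ℝ => G₁ (h + δ • w₁)) (𝓝[>] 0) (𝓝 (G₁ h)) :=
      (hG₁.tendsto h).comp (tendsto_smul_nhdsGT_zero h w₁)
    have h2 : Tendsto (fun δ : ℝ => G₂ (m + δ • w₂)) (𝓝[>] 0) (𝓝 (G₂ m)) :=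
      (hG₂.tendsto m).comp (tendsto_smul_nhdsGT_zero m w₂)
    exact tendsto_residual y₀ h1 h2
  have hc : Tendsto (fun δ : ℝ => inner ℝ
      (residual y₀ (G₁ (h + δ • w₁)) (G₂ (m + δ • w₂))) (T z)) (𝓝[>] 0)
      (𝓝 (inner ℝ (residual y₀ (G₁ h) (G₂ m)) (T z))) := hr.inner tendsto_const_nhds
  refine hc.congr' ?_
  filter_upwards [hT z, hd] with δ h1 h2
  have d1 := hasOneSidedDeriv_risk_left (G₂ := G₂) (h₀ := h₀) (m₀ := m₀) (m + δ • w₂) h1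
  unfold HasOneSidedDeriv at d1
  simp only [smul_zero, add_zero] at d1
  exact tendsto_nhds_unique d1 (tendsto_slope_gradient h2 z)

lemma exists_admissible (h : Vec n) (m : Vec p) (hF₁ : HasConicGerm G₁ h)
    (hF₂ : HasConicGerm G₂ m) : ∃ w₁ w₂, Admissible (risk G₁ G₂ h₀ m₀) h m w₁ w₂ := by
  obtain ⟨w₁, h1⟩ := hF₁.exists_direction
  obtain ⟨w₂, h2⟩ := hF₂.exists_direction
  refine ⟨w₁, w₂, ?_⟩
  filter_upwards [h1, h2] with δ d1 d2
  have e1 : DifferentiableAt ℝ (fun z : Vec n × Vec p => G₁ z.1) (h + δ • w₁, m + δ • w₂) :=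
    DifferentiableAt.comp (g := G₁) (h + δ • w₁, m + δ • w₂) d1 differentiableAt_fst
  have e2 : DifferentiableAt ℝ (fun z : Vec n × Vec p => G₂ z.2) (h + δ • w₁, m + δ • w₂) :=
    DifferentiableAt.comp (g := G₂) (h + δ • w₁, m + δ • w₂) d2 differentiableAt_snd
  have e3 : DifferentiableAt ℝ (fun z : Vec n × Vec p => hadamard (G₁ z.1) (G₂ z.2))
      (h + δ • w₁, m + δ • w₂) := by
    rw [differentiableAt_euclidean]
    intro i
    exact ((differentiableAt_euclidean.mp e1) i).mul ((differentiableAt_euclidean.mp e2) i)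
  exact ((e3.const_sub _).norm_sq ℝ).const_mul _

lemma Admissible.left {f : Vec n → Vec p → ℝ} {h w₁ : Vec n} {m w₂ : Vec p}
    (hA : Admissible f h m w₁ w₂) :
    ∀ᶠ δ : ℝ in 𝓝[>] 0, DifferentiableAt ℝ (fun h' => f h' (m + δ • w₂)) (h + δ • w₁) := by
  filter_upwards [hA] with δ hδ
  exact DifferentiableAt.comp (g := fun z : Vec n × Vec p => f z.1 z.2)
    (f := fun h' => (h', m + δ • w₂)) (h + δ • w₁) hδ
    (differentiableAt_id.prodMk (differentiableAt_const _))

lemma Admissible.right {f : Vec n → Vec p → ℝ} {h w₁ : Vec n} {m w₂ : Vec p}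
    (hA : Admissible f h m w₁ w₂) :
    ∀ᶠ δ : ℝ in 𝓝[>] 0, DifferentiableAt ℝ (fun m' => f (h + δ • w₁) m') (m + δ • w₂) := by
  filter_upwards [hA] with δ hδ
  exact DifferentiableAt.comp (g := fun z : Vec n × Vec p => f z.1 z.2)
    (f := fun m' => (h + δ • w₁, m')) (m + δ • w₂) hδ
    ((differentiableAt_const _).prodMk differentiableAt_id)

end

/-! ### Descent -/

lemma continuousAt_norm_smul_sub_smul {n k : ℕ} {f g : Vec n → Vec k} {x : Vec n}
    (hf : ContinuousAt f x) (hg : ContinuousAt g x) (a b : ℝ) :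
    ContinuousAt (fun x => ‖a • f x - b • g x‖) x := by
  fun_prop

lemma continuousAt_limitDir {n : ℕ} (k : ℕ) {x : Vec n} (hx : x ≠ 0) (y : Vec n) :
    ContinuousAt (fun x => limitDir k x y) x := by
  by_cases hy : y = 0
  · simp only [hy, limitDir_zero_right]
    exact continuousAt_const
  have ha : ContinuousAt (fun x => InnerProductGeometry.angle x y) x :=
    ContinuousAt.comp (g := fun q : Vec n × Vec n => InnerProductGeometry.angle q.1 q.2)
      (f := fun x => (x, y)) (InnerProductGeometry.continuousAt_angle hx hy)
      (continuousAt_id.prodMk continuousAt_const)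
  have hi : ∀ k, Continuous angleMap^[k] := fun k => continuous_angleMap.iterate k
  have hP : ∀ k, Continuous fun θ => coefProd θ k := by
    intro k
    induction k with
    | zero => exact continuous_const
    | succ k ih =>
      simp only [coefProd]
      have := hi k
      fun_prop
  have hS : ∀ k, Continuous fun θ => coefSum θ k := by
    intro k
    induction k with
    | zero => exact continuous_const
    | succ k ih =>
      simp only [coefSum]
      have := hi k
      fun_prop
  have hu : ContinuousAt (fun x : Vec n => unit x) x :=
    (continuousAt_id.norm.inv₀ (norm_ne_zero_iff.mpr hx)).smul continuousAt_id
  exact ((((hP k).continuousAt).comp ha).smul continuousAt_const).add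
    (((((hS k).continuousAt).comp ha).mul continuousAt_const).smul hu)

section

variable {l : ℕ} {n p : ℕ → ℕ} {W₁ : ∀ i, Matrix (Fin (n (i + 1))) (Fin (n i)) ℝ}
  {W₂ : ∀ i, Matrix (Fin (p (i + 1))) (Fin (p i)) ℝ} {N₁ N₂ : ℕ}
  {V₁ : Matrix (Fin l) (Fin (n N₁)) ℝ} {V₂ : Matrix (Fin l) (Fin (p N₂)) ℝ} {σ α : ℝ}

/-- If h lies on a kink, M need not be the pattern at h. The bound of `norm_grad_sub_le` holds at
nearby points with pattern M and passes to the limit, both sides being continuous in the point once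
M is fixed. -/
lemma norm_limit_grad_sub_le (H₁ : InnerWDC W₁ N₁ σ) (H₂ : InnerWDC W₂ N₂ σ)
    (hJ : JointWDC V₁ V₂ (σ ^ 2) α) (hα0 : 0 ≤ α) (hα1 : α ≤ 1) (hl : 0 < l)
    (hs : 4 * ((N₂ + 1) ^ 2 * σ) ≤ 1) {h : Vec (n 0)} {m : Vec (p 0)}
    (hh : h ≠ 0) (hm : m ≠ 0) (h₀ : Vec (n 0)) (m₀ : Vec (p 0)) {w z : Vec (n 0)}
    {M : Matrix (Fin l) (Fin (n 0)) ℝ}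
    (hM : ∀ᶠ q in twoScale, fullPattern N₁ W₁ V₁ (h + q.1 • w + q.2 • z) = M) :
    ‖(l * 2 ^ (N₁ + 1) * 2 ^ (N₂ + 1) : ℝ) • act Mᵀ
        (residual (hadamard (generator (N₁ + 1) W₁ V₁ h₀) (generator (N₂ + 1) W₂ V₂ m₀))
          (generator (N₁ + 1) W₁ V₁ h) (generator (N₂ + 1) W₂ V₂ m)) -
      α • gradField N₁ N₂ h₀ m₀ h m‖ ≤
      24 * (((N₁ + 1) ^ 2 + (N₂ + 1) ^ 2) * σ) * (‖m‖ * (‖h‖ * ‖m‖ + ‖h₀‖ * ‖m₀‖)) := by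
  have ht := tendsto_twoScale h w z
  set y₀ := hadamard (generator (N₁ + 1) W₁ V₁ h₀) (generator (N₂ + 1) W₂ V₂ m₀)
  have hcR : ContinuousAt (fun x => residual y₀ (generator (N₁ + 1) W₁ V₁ x)
      (generator (N₂ + 1) W₂ V₂ m)) h :=
    tendsto_residual y₀ ((continuous_generator (N₁ + 1) W₁ V₁).tendsto h) tendsto_const_nhds
  obtain ⟨K, hK⟩ := exists_lipschitzWith_act Mᵀ
  have hcL : ContinuousAt (fun x => ‖(l * 2 ^ (N₁ + 1) * 2 ^ (N₂ + 1) : ℝ) • act Mᵀ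
      (residual y₀ (generator (N₁ + 1) W₁ V₁ x) (generator (N₂ + 1) W₂ V₂ m)) -
        α • gradField N₁ N₂ h₀ m₀ x m‖) h := by
    have c1 : ContinuousAt (fun x => act Mᵀ (residual y₀ (generator (N₁ + 1) W₁ V₁ x)
        (generator (N₂ + 1) W₂ V₂ m))) h := (hK.continuous.tendsto _).comp hcR
    have c2 : ContinuousAt (fun x => gradField N₁ N₂ h₀ m₀ x m) h := by
      unfold gradField
      exact (continuousAt_id.const_smul (‖m‖ ^ 2)).sub
        ((continuousAt_limitDir (N₁ + 1) hh h₀).const_smul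
          (inner ℝ m (limitDir (N₂ + 1) m m₀)))
    exact continuousAt_norm_smul_sub_smul c1 c2 _ α
  have hcU : Continuous fun x : Vec (n 0) => 24 * ((((N₁ : ℝ) + 1) ^ 2 + (N₂ + 1) ^ 2) * σ) *
      (‖m‖ * (‖x‖ * ‖m‖ + ‖h₀‖ * ‖m₀‖)) := by fun_prop
  refine le_of_tendsto_of_tendsto (hcL.tendsto.comp ht) ((hcU.tendsto h).comp ht) ?_
  filter_upwards [hM, ht.eventually (isOpen_ne.mem_nhds hh)] with q hq hq0
  have := norm_grad_sub_le H₁ H₂ hJ hα0 hα1 hl hs hq0 hm h₀ m₀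
  rw [hq] at this
  exact this

/-- Along the negative of a limit of partial gradients, the risk decreases unless the limiting
gradient is small. -/
lemma exists_descent_left (H₁ : InnerWDC W₁ N₁ σ) (H₂ : InnerWDC W₂ N₂ σ)
    (hJ : JointWDC V₁ V₂ (σ ^ 2) α) (hα0 : 0 ≤ α) (hα1 : α ≤ 1) (hl : 0 < l)
    (hs : 4 * ((N₂ + 1) ^ 2 * σ) ≤ 1) {h : Vec (n 0)} {m : Vec (p 0)}
    (hh : h ≠ 0) (hm : m ≠ 0) (h₀ : Vec (n 0)) (m₀ : Vec (p 0)) {w₁ : Vec (n 0)} {w₂ : Vec (p 0)}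
    (hd : ∀ᶠ δ : ℝ in 𝓝[>] 0, DifferentiableAt ℝ
      (fun h' => risk (generator (N₁ + 1) W₁ V₁) (generator (N₂ + 1) W₂ V₂) h₀ m₀ h'
        (m + δ • w₂)) (h + δ • w₁)) :
    ∃ v D, IsLimitGradLeft (risk (generator (N₁ + 1) W₁ V₁) (generator (N₂ + 1) W₂ V₂) h₀ m₀)
        h m w₁ w₂ v ∧
      HasOneSidedDeriv (risk (generator (N₁ + 1) W₁ V₁) (generator (N₂ + 1) W₂ V₂) h₀ m₀)
        h m (-v) 0 D ∧
      (0 ≤ D → α * ‖gradField N₁ N₂ h₀ m₀ h m‖ ≤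
        72 * (((N₁ + 1) ^ 2 + (N₂ + 1) ^ 2) * σ) * (‖m‖ * (‖h‖ * ‖m‖ + ‖h₀‖ * ‖m₀‖))) := by
  choose M hM using twoScale_fullPattern_const N₁ W₁ V₁ h w₁
  obtain ⟨v, hv, hvM⟩ := exists_limitGrad_left (G₂ := generator (N₂ + 1) W₂ V₂) (h₀ := h₀)
    (m₀ := m₀) (continuous_generator (N₁ + 1) W₁ V₁)
    (continuous_generator (N₂ + 1) W₂ V₂) (fun z => generator_twoScale (hM z)) hd
  -- With w = 0 the outer scale plays no role: M' is the piece entered when leaving h in direction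
  -- -v.
  obtain ⟨M', hM'⟩ := twoScale_fullPattern_const N₁ W₁ V₁ h 0 (-v)
  have hG : ∀ᶠ η : ℝ in 𝓝[>] 0, generator (N₁ + 1) W₁ V₁ (h + η • (-v)) =
      generator (N₁ + 1) W₁ V₁ h + η • act M' (-v) := by
    obtain ⟨δ, hδ⟩ := (generator_twoScale hM').exists
    simpa only [smul_zero, add_zero] using hδ
  refine ⟨v, _, hv, hasOneSidedDeriv_risk_left m hG, fun hD => ?_⟩
  have hB := norm_limit_grad_sub_le H₁ H₂ hJ hα0 hα1 hl hs hh hm h₀ m₀ hM'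
  have hBz := fun z => norm_limit_grad_sub_le H₁ H₂ hJ hα0 hα1 hl hs hh hm h₀ m₀ (hM z)
  set r := residual (hadamard (generator (N₁ + 1) W₁ V₁ h₀) (generator (N₂ + 1) W₂ V₂ m₀))
    (generator (N₁ + 1) W₁ V₁ h) (generator (N₂ + 1) W₂ V₂ m)
  set C : ℝ := l * 2 ^ (N₁ + 1) * 2 ^ (N₂ + 1) with hC
  have hC0 : 0 < C := by
    have : (0 : ℝ) < l := by exact_mod_cast hl
    positivity
  set F := α • gradField N₁ N₂ h₀ m₀ h m with hF
  have hFn : α * ‖gradField N₁ N₂ h₀ m₀ h m‖ = ‖F‖ := by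
    rw [hF, norm_smul, Real.norm_of_nonneg hα0]
  rw [hFn]
  have e72 : 72 * ((((N₁ : ℝ) + 1) ^ 2 + (N₂ + 1) ^ 2) * σ) *
        (‖m‖ * (‖h‖ * ‖m‖ + ‖h₀‖ * ‖m₀‖)) =
      3 * (24 * (((N₁ + 1) ^ 2 + (N₂ + 1) ^ 2) * σ) *
        (‖m‖ * (‖h‖ * ‖m‖ + ‖h₀‖ * ‖m₀‖))) := by ring
  rw [e72]
  set B := 24 * ((((N₁ : ℝ) + 1) ^ 2 + (N₂ + 1) ^ 2) * σ) *
    (‖m‖ * (‖h‖ * ‖m‖ + ‖h₀‖ * ‖m₀‖))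
  -- The vector v is known only through its pairings, with a piece M z for each z. Testing with z =
  -- C • v - F itself requires a single piece.
  have hv1 : ‖C • v - F‖ ≤ B := by
    set z := C • v - F with hz
    have e : ‖z‖ ^ 2 = inner ℝ (C • act (M z)ᵀ r - F) z := by
      rw [inner_sub_left, real_inner_smul_left, ← inner_act, ← hvM, ← real_inner_smul_left,
        ← inner_sub_left, ← hz, real_inner_self_eq_norm_sq]
    have h1 : ‖z‖ ^ 2 ≤ B * ‖z‖ :=
      e ▸ (real_inner_le_norm _ _).trans (mul_le_mul_of_nonneg_right (hBz z) (norm_nonneg z))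
    by_contra hlt
    have hB0 : 0 ≤ B := (norm_nonneg _).trans hB
    nlinarith [not_le.mp hlt]
  set u := act M'ᵀ r with hu
  -- The derivative along -v is -⟨u, v⟩, so D ≥ 0 says that u and v form no acute angle. Being
  -- 2B-close after scaling, they force ‖C • v‖ ≤ 2B, hence ‖F‖ ≤ 3B; this is the passage from 24 to
  -- 72.
  have hD' : inner ℝ (C • u) (C • v) ≤ 0 := by
    rw [map_neg, inner_neg_right, inner_act, ← hu] at hD
    rw [real_inner_smul_left, inner_smul_right]
    have : inner ℝ u v ≤ 0 := by linarith
    exact mul_nonpos_of_nonneg_of_nonpos hC0.le (mul_nonpos_of_nonneg_of_nonpos hC0.le this)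
  have huv : ‖C • v - C • u‖ ≤ 2 * B := by
    have e : C • v - C • u = (C • v - F) - (C • u - F) := by abel
    rw [e]
    exact (norm_sub_le _ _).trans (by linarith)
  have hvn : ‖C • v‖ ≤ 2 * B := by
    have h1 : ‖C • v‖ ^ 2 ≤ 2 * B * ‖C • v‖ := by
      have h2 : ‖C • v‖ ^ 2 ≤ inner ℝ (C • v - C • u) (C • v) := by
        rw [inner_sub_left, real_inner_self_eq_norm_sq]; linarith
      exact h2.trans ((real_inner_le_norm _ _).trans
        (mul_le_mul_of_nonneg_right huv (norm_nonneg _)))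
    by_contra hlt
    have hB0 : 0 ≤ B := (norm_nonneg _).trans hB
    nlinarith [not_le.mp hlt]
  have e : F = C • v - (C • v - F) := by abel
  rw [e]
  exact (norm_sub_le _ _).trans (by linarith)

end

/-! ### Positive homogeneity and nonnegativity -/

lemma layer_smul {l n : ℕ} (V : Matrix (Fin l) (Fin n) ℝ) {t : ℝ} (ht : 0 < t) (x : Vec n) :
    layer V (t • x) = t • layer V x := by
  ext i
  simp [layer, Matrix.mulVec_smul, mul_max_of_nonneg _ _ ht.le]

lemma innerNet_smul {n : ℕ → ℕ} (W : ∀ i, Matrix (Fin (n (i + 1))) (Fin (n i)) ℝ) (k : ℕ) {t : ℝ}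
    (ht : 0 < t) (x : Vec (n 0)) : innerNet W k (t • x) = t • innerNet W k x := by
  induction k with
  | zero => rfl
  | succ k ih => rw [innerNet, innerNet, ih, layer_smul _ ht]

lemma generator_smul {n : ℕ → ℕ} {l : ℕ} (d : ℕ)
    (W : ∀ i, Matrix (Fin (n (i + 1))) (Fin (n i)) ℝ) (V : Matrix (Fin l) (Fin (n (d - 1))) ℝ)
    {t : ℝ} (ht : 0 < t) (x : Vec (n 0)) : generator d W V (t • x) = t • generator d W V x := by
  rw [generator, generator, innerNet_smul _ _ ht, layer_smul _ ht]

lemma generator_nonneg {n : ℕ → ℕ} {l : ℕ} (d : ℕ)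
    (W : ∀ i, Matrix (Fin (n (i + 1))) (Fin (n i)) ℝ) (V : Matrix (Fin l) (Fin (n (d - 1))) ℝ)
    (x : Vec (n 0)) (i : Fin l) : 0 ≤ generator d W V x i :=
  le_max_right _ _

lemma exists_deriv_nonpos_of_mem_axes {l : ℕ} {n p : ℕ → ℕ} (N₁ N₂ : ℕ)
    (W₁ : ∀ i, Matrix (Fin (n (i + 1))) (Fin (n i)) ℝ)
    (W₂ : ∀ i, Matrix (Fin (p (i + 1))) (Fin (p i)) ℝ)
    (V₁ : Matrix (Fin l) (Fin (n N₁)) ℝ) (V₂ : Matrix (Fin l) (Fin (p N₂)) ℝ)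
    (h₀ : Vec (n 0)) (m₀ : Vec (p 0)) {h : Vec (n 0)} {m : Vec (p 0)}
    (hm : (h, m) ∈ axes (n 0) (p 0)) (x : Vec (n 0)) (y : Vec (p 0)) :
    ∃ D ≤ 0, HasOneSidedDeriv
      (risk (generator (N₁ + 1) W₁ V₁) (generator (N₂ + 1) W₂ V₂) h₀ m₀) h m x y D := by
  rcases hm with ⟨a, ha⟩ | ⟨a, ha⟩
  · obtain ⟨rfl, rfl⟩ := Prod.mk.inj ha
    exact hasOneSidedDeriv_risk_axis (continuous_generator (N₁ + 1) W₁ V₁)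
      (generator_nonneg (N₁ + 1) W₁ V₁) (generator_nonneg (N₂ + 1) W₂ V₂)
      (fun t ht => generator_smul (N₂ + 1) W₂ V₂ ht) (generator_zero N₂ W₂ V₂) _ _ _
  · obtain ⟨rfl, rfl⟩ := Prod.mk.inj ha
    rw [← risk_swap]
    exact hasOneSidedDeriv_risk_axis (continuous_generator (N₂ + 1) W₂ V₂)
      (generator_nonneg (N₂ + 1) W₂ V₂) (generator_nonneg (N₁ + 1) W₁ V₁)
      (fun t ht => generator_smul (N₁ + 1) W₁ V₁ ht) (generator_zero N₁ W₁ V₁) _ _ _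

/-! ### The landscape of the risk -/

/-- With no rows the joint condition holds trivially, as α/0 = 0, so l > 0 must come from `WDC`: the
empty sum would have to lie within ε of α/2 times the identity. -/
lemma WDC.pos_of_lt {l n : ℕ} {V : Matrix (Fin l) (Fin n) ℝ} {ε α : ℝ} (hV : WDC V ε α)
    (h : 2 * ε < α) {x : Vec n} (hx : x ≠ 0) : 0 < l := by
  rcases Nat.eq_zero_or_pos l with rfl | hl
  · exfalso
    have h1 := hV.norm_sub_le hx hx x
    rw [Subsingleton.elim (act (posPart V x) x) 0, map_zero, zero_sub, norm_neg, act_Q_self hx,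
      smul_smul, norm_smul] at h1
    have h2 := le_of_mul_le_mul_right h1 (norm_pos_iff.mpr hx)
    have h3 := (le_abs_self _).trans h2
    linarith
  · exact hl

lemma exists_descent_direction {l : ℕ} {n p : ℕ → ℕ}
    {W₁ : ∀ i, Matrix (Fin (n (i + 1))) (Fin (n i)) ℝ}
    {W₂ : ∀ i, Matrix (Fin (p (i + 1))) (Fin (p i)) ℝ} {N₁ N₂ : ℕ}
    {V₁ : Matrix (Fin l) (Fin (n N₁)) ℝ} {V₂ : Matrix (Fin l) (Fin (p N₂)) ℝ} {ε α₁ α₂ : ℝ}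
    (hN₁ : 1 ≤ N₁) (hN₂ : 1 ≤ N₂) (hε : 0 < ε) (hα₁ : 0 < α₁) (hα₁' : α₁ ≤ 1) (hα₂ : 0 < α₂)
    (hα₂' : α₂ ≤ 1)
    (hsmall : 10000 * (((N₁ + 1 : ℕ) : ℝ) ^ 7 * ((N₂ + 1 : ℕ) : ℝ) ^ 2 +
      ((N₁ + 1 : ℕ) : ℝ) ^ 2 * ((N₂ + 1 : ℕ) : ℝ) ^ 7) * ε ^ (1 / 4 : ℝ) / (α₁ * α₂) < 1)
    (hW₁ : ∀ i < N₁, WDC (W₁ i) ε 1) (hW₂ : ∀ i < N₂, WDC (W₂ i) ε 1) (hV₁ : WDC V₁ ε α₁)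
    (hJ : JointWDC V₁ V₂ ε (α₁ * α₂)) {h h₀ : Vec (n 0)} {m m₀ : Vec (p 0)}
    (hh : h ≠ 0) (hm : m ≠ 0)
    (hmem : (h, m) ∉ fourNhds 20000 (N₁ + 1) (N₂ + 1) ε (α₁ * α₂) h₀ m₀)
    {w₁ : Vec (n 0)} {w₂ : Vec (p 0)}
    (hA : Admissible (risk (generator (N₁ + 1) W₁ V₁) (generator (N₂ + 1) W₂ V₂) h₀ m₀)
      h m w₁ w₂) :
    ∃ v₁ v₂,
      IsLimitGradLeft (risk (generator (N₁ + 1) W₁ V₁) (generator (N₂ + 1) W₂ V₂) h₀ m₀)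
        h m w₁ w₂ v₁ ∧
      IsLimitGradRight (risk (generator (N₁ + 1) W₁ V₁) (generator (N₂ + 1) W₂ V₂) h₀ m₀)
        h m w₁ w₂ v₂ ∧
      ((∃ D < 0, HasOneSidedDeriv
          (risk (generator (N₁ + 1) W₁ V₁) (generator (N₂ + 1) W₂ V₂) h₀ m₀) h m (-v₁) 0 D) ∨
        (∃ D < 0, HasOneSidedDeriv
          (risk (generator (N₁ + 1) W₁ V₁) (generator (N₂ + 1) W₂ V₂) h₀ m₀) h m 0 (-v₂) D)) := by
  -- The inner layers are used with σ = E² = √ε, so that their condition has constant σ² = ε.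
  set E := ε ^ (1 / 4 : ℝ) with hEdef
  have hE : 0 < E := Real.rpow_pos_of_pos hε _
  have hEε : (E ^ 2) ^ 2 = ε := by
    rw [← pow_mul, hEdef, ← Real.rpow_natCast, ← Real.rpow_mul hε.le]
    norm_num
  have hα : 0 < α₁ * α₂ := mul_pos hα₁ hα₂
  have hα1 : α₁ * α₂ ≤ 1 := mul_le_one₀ hα₁' hα₂.le hα₂'
  have hαα : α₁ * α₂ ≤ α₁ := mul_le_of_le_one_right hα₁.le hα₂'
  push_cast at hsmall
  rw [div_lt_one hα] at hsmall
  have hd : (1 : ℝ) ≤ (N₁ : ℝ) + 1 := by linarith [(Nat.cast_nonneg N₁ : (0 : ℝ) ≤ N₁)]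
  have hs : (1 : ℝ) ≤ (N₂ : ℝ) + 1 := by linarith [(Nat.cast_nonneg N₂ : (0 : ℝ) ≤ N₂)]
  have p1 : 0 ≤ ((N₁ : ℝ) + 1) ^ 7 * ((N₂ : ℝ) + 1) ^ 2 * E := by positivity
  have p2 : 0 ≤ ((N₁ : ℝ) + 1) ^ 2 * ((N₂ : ℝ) + 1) ^ 7 * E := by positivity
  have hs₁ : 10000 * (((N₁ : ℝ) + 1) ^ 7 * (N₂ + 1) ^ 2 * E) ≤ α₁ * α₂ := by linarith
  have hs₂ : 10000 * (((N₂ : ℝ) + 1) ^ 7 * (N₁ + 1) ^ 2 * E) ≤ α₁ * α₂ := by linarith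
  have hmono : ∀ a b : ℝ, 1 ≤ a → 1 ≤ b → 10000 * (a ^ 7 * b ^ 2 * E) ≤ α₁ * α₂ →
      10000 * E ≤ α₁ * α₂ ∧ 10000 * (a ^ 2 * E) ≤ α₁ * α₂ := by
    intro a b ha hb h
    have hb2 : 1 ≤ b ^ 2 := one_le_pow₀ hb
    have ha27 : a ^ 2 ≤ a ^ 7 := pow_le_pow_right₀ ha (by norm_num)
    have ha2 : 1 ≤ a ^ 2 := one_le_pow₀ ha
    have h1 : a ^ 2 * E ≤ a ^ 7 * b ^ 2 * E :=
      mul_le_mul_of_nonneg_right (ha27.trans (le_mul_of_one_le_right (by positivity) hb2)) hE.le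
    have h2 : E ≤ a ^ 2 * E := le_mul_of_one_le_left hE.le ha2
    exact ⟨by linarith, by linarith⟩
  obtain ⟨hE1, hdE⟩ := hmono _ _ hd hs hs₁
  obtain ⟨-, hsE⟩ := hmono _ _ hs hd hs₂
  have hEsq : E ^ 2 ≤ E := by nlinarith
  have hsq : ∀ a : ℝ, 1 ≤ a → 10000 * (a ^ 2 * E) ≤ α₁ * α₂ →
      4 * (a ^ 2 * E ^ 2) ≤ 1 ∧ a * E ^ 2 ≤ 1 / 8 := by
    intro a ha h
    have h1 : a ^ 2 * E ^ 2 ≤ a ^ 2 * E := mul_le_mul_of_nonneg_left hEsq (by positivity)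
    have h2 : a * E ^ 2 ≤ a ^ 2 * E ^ 2 :=
      mul_le_mul_of_nonneg_right (by nlinarith) (by positivity)
    exact ⟨by linarith, by linarith⟩
  obtain ⟨q1, q2⟩ := hsq _ hd hdE
  obtain ⟨q3, q4⟩ := hsq _ hs hsE
  have H₁ : InnerWDC W₁ N₁ (E ^ 2) := ⟨fun i hi => hEε.symm ▸ hW₁ i hi, by positivity, q2⟩
  have H₂ : InnerWDC W₂ N₂ (E ^ 2) := ⟨fun i hi => hEε.symm ▸ hW₂ i hi, by positivity, q4⟩
  have hJ' : JointWDC V₁ V₂ ((E ^ 2) ^ 2) (α₁ * α₂) := hEε.symm ▸ hJ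
  have hl : 0 < l := by
    refine hV₁.pos_of_lt ?_ (H₁.innerNet_ne_zero hh le_rfl)
    have : ε ≤ E := by rw [← hEε]; nlinarith
    linarith
  obtain ⟨v₁, D₁, hv₁, hD₁, hn₁⟩ := exists_descent_left H₁ H₂ hJ' hα.le hα1 hl q3 hh hm h₀ m₀ hA.left
  have hA' := hA.right
  obtain ⟨v₂, D₂, hv₂, hD₂, hn₂⟩ := exists_descent_left (w₁ := w₂) (w₂ := w₁) H₂ H₁ hJ'.symm hα.le
    hα1 hl q1 hm hh m₀ h₀ (by rw [← risk_swap]; exact hA')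
  rw [← risk_swap] at hv₂ hD₂
  refine ⟨v₁, v₂, hv₁, hv₂, ?_⟩
  -- If neither direction descends, both limiting partial gradients are small and the point lies in
  -- one of the neighborhoods.
  by_contra hcon
  rw [not_or] at hcon
  have hD₁0 : 0 ≤ D₁ := by
    by_contra hlt
    exact hcon.1 ⟨D₁, not_le.mp hlt, hD₁⟩
  have hD₂0 : 0 ≤ D₂ := by
    by_contra hlt
    exact hcon.2 ⟨D₂, not_le.mp hlt, hD₂⟩
  refine hmem (mem_fourNhds hh hm hε hα hα1 hN₁ hN₂ hs₁ hs₂ ?_ ?_)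
  · rw [relError, div_mul_eq_mul_div, le_div_iff₀ hα, mul_comm]
    exact hn₁ hD₁0
  · rw [relError_comm, relError, div_mul_eq_mul_div, le_div_iff₀ hα, mul_comm]
    exact hn₂ hD₂0

end BlindDemod

theorem mainTheorem2 :
    (∀ d : ℕ, 2 ≤ d → 0 < rho d) ∧ Tendsto rho atTop (𝓝 1) ∧
    ∃ K₁ K₂ : ℝ, 0 < K₁ ∧ 0 < K₂ ∧
      ∀ (d s l : ℕ) (n p : ℕ → ℕ)
        (W₁ : ∀ i, Matrix (Fin (n (i + 1))) (Fin (n i)) ℝ)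
        (W₂ : ∀ i, Matrix (Fin (p (i + 1))) (Fin (p i)) ℝ)
        (V₁ : Matrix (Fin l) (Fin (n (d - 1))) ℝ)
        (V₂ : Matrix (Fin l) (Fin (p (s - 1))) ℝ)
        (ε α₁ α₂ : ℝ),
        2 ≤ d → 2 ≤ s → 0 < ε → 0 < α₁ → α₁ ≤ 1 → 0 < α₂ → α₂ ≤ 1 →
        K₁ * ((d : ℝ) ^ 7 * (s : ℝ) ^ 2 + (d : ℝ) ^ 2 * (s : ℝ) ^ 7) * ε ^ (1 / 4 : ℝ) /
          (α₁ * α₂) < 1 →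
        (∀ i < d - 1, WDC (W₁ i) ε 1) → (∀ i < s - 1, WDC (W₂ i) ε 1) →
        WDC V₁ ε α₁ → WDC V₂ ε α₂ → JointWDC V₁ V₂ ε (α₁ * α₂) →
        ∀ (h₀ : Vec (n 0)) (m₀ : Vec (p 0)), (h₀, m₀) ≠ (0, 0) →
        ∀ f : Vec (n 0) → Vec (p 0) → ℝ,
          f = risk (generator d W₁ V₁) (generator s W₂ V₂) h₀ m₀ →
          (∀ (h : Vec (n 0)) (m : Vec (p 0)),
            (h, m) ∉ fourNhds K₂ d s ε (α₁ * α₂) h₀ m₀ ∪ axes (n 0) (p 0) →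
            (∃ w₁ w₂, Admissible f h m w₁ w₂) ∧
            ∀ w₁ w₂, Admissible f h m w₁ w₂ →
              ∃ v₁ v₂, IsLimitGradLeft f h m w₁ w₂ v₁ ∧ IsLimitGradRight f h m w₁ w₂ v₂ ∧
                ((∃ D < 0, HasOneSidedDeriv f h m (-v₁) 0 D) ∨
                 (∃ D < 0, HasOneSidedDeriv f h m 0 (-v₂) D))) ∧
          (∀ (h : Vec (n 0)) (m : Vec (p 0)), (h, m) ∈ axes (n 0) (p 0) →
            ∀ (x : Vec (n 0)) (y : Vec (p 0)), ∃ D ≤ 0, HasOneSidedDeriv f h m x y D) := by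
  refine ⟨fun d hd => rho_pos hd, tendsto_rho, 10000, 20000, by norm_num, by norm_num, ?_⟩
  intro d s l n p W₁ W₂ V₁ V₂ ε α₁ α₂ hd hs hε hα₁ hα₁' hα₂ hα₂' hsmall hW₁ hW₂ hV₁ _ hJ h₀ m₀ _ f hf
  subst hf
  -- With d = N + 1 the index d - 1 reduces definitionally to the number N of inner layers.
  obtain ⟨N₁, rfl⟩ : ∃ N, d = N + 1 := ⟨d - 1, by omega⟩
  obtain ⟨N₂, rfl⟩ : ∃ N, s = N + 1 := ⟨s - 1, by omega⟩
  refine ⟨fun h m hmem => ?_, fun h m hmem x y =>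
    exists_deriv_nonpos_of_mem_axes N₁ N₂ W₁ W₂ V₁ V₂ h₀ m₀ hmem x y⟩
  refine ⟨exists_admissible h m (hasConicGerm_generator (N₁ + 1) W₁ V₁ h)
    (hasConicGerm_generator (N₂ + 1) W₂ V₂ m), fun w₁ w₂ hA => ?_⟩
  rw [Set.mem_union, not_or] at hmem
  have hh : h ≠ 0 := by
    rintro rfl
    exact hmem.2 (Or.inr ⟨m, rfl⟩)
  have hm : m ≠ 0 := by
    rintro rfl
    exact hmem.2 (Or.inl ⟨h, rfl⟩)
  exact exists_descent_direction (by omega) (by omega) hε hα₁ hα₁' hα₂ hα₂' hsmall hW₁ hW₂ hV₁ hJ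
    hh hm hmem.1 hA
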